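/- Let $\Omega=(-1,1)^2$ be divided into the four open subsquares $\Omega_1=(-1,0)\times(-1,0)$, $\Omega_2=(0,1)\times(-1,0)$, $\Omega_3=(0,1)\times(0,1)$, $\Omega_4=(-1,0)\times(0,1)$. For $i\ne j$ let $\Gamma_{ij}$ be the open segment common to $\partial\Omega_i$ and $\partial\Omega_j$ (empty for opposite subsquares), let $\Gamma=\bigcup_{i\neq j}\overline{\Gamma_{ij}}$, let $\partial\Omega_i^0=\partial\Omega_i\cap\partial\Omega$, and let $n_i$ be the outward unit normal on $\partial\Omega_i$. For a function $h$ let $h_e(x,y)=\tfrac12\big(h(x,y)+h(-x,-y)\big)$ be its even symmetric part. Let $f\in L^2(\Omega)$, let $g\in H^{3/2}(\partial\Omega)$ (the space of boundary values of functions in $H^2(\Omega)$), and let $u_e\in H^1(\Omega)$ be the weak solution of $-\Delta u_e=f_e$ in $\Omega$, $u_e=g_e$ on $\partial\Omega$. Let $u^0\in H^2(\Omega)$ and $\psi^0\in H^2(\Omega)\cap H^1_0(\Omega)$ with $u^0=g$ at the four points of $\partial\Omega\cap\Gamma$. For $\theta\in\mathbb R$, the Neumann-Neumann method applied to the even symmetric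 problem starts from $u^0_{e,i}=u^0_e|_{\Omega_i}$, $\psi^0_{e,i}=\psi^0_e|_{\Omega_i}$, and for $k\ge1$ and $i=1,\dots,4$ looks for weak solutions $u^k_{e,i},\psi^k_{e,i}\in H^1(\Omega_i)$ of $$-\Delta u_{e,i}^k=f_e \text{ in }\Omega_i,\quad u_{e,i}^k=g_e\text{ on }\partial\Omega_i^0,\quad u_{e,i}^k=u_{e,i}^{k-1}-\theta\big(\psi_{e,i}^{k-1}+\psi_{e,j}^{k-1}\big)\text{ on every nonempty }\Gamma_{ij},$$ $$-\Delta \psi_{e,i}^k=0 \text{ in }\Omega_i,\quad \psi_{e,i}^k=0\text{ on }\partial\Omega_i^0,\quad \partial_{n_i}\psi_{e,i}^k=\partial_{n_i}u_{e,i}^k+\partial_{n_j}u_{e,j}^k\text{ on every nonempty }\Gamma_{ij},$$ where boundary values are traces and the normal derivatives are weak normal derivatives (given by Green's formula), compared as distributions on the open segments $\Gamma_{ij}$. Then, for every $\theta\in\mathbb R$, such a sequence of iterates exists and is unique. Its errors $e_{e,i}^k=u_e|_{\Omega_i}-u_{e,i}^k$ satisfy, for all $k\ge1$ and all $i$, $$e_{e,i}^k=(1-4\theta)^{k-1}e_{e,i}^1\quad\text{a.e.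 in }\Omega_i .$$ Let $e_e^k$ be the function on $\Omega\setminus\Gamma$ that is equal to $e_{e,i}^k$ in each $\Omega_i$. Its norm $\|e_e^k\|_{L^2(\Omega)}$ and its broken $H^1$ norm $\sum_{i}\|e_{e,i}^k\|_{H^1(\Omega_i)}$ are $|1-4\theta|^{k-1}$ times those of $e_e^1$. If $\theta=\frac14$, then $u_{e,i}^k=u_e$ a.e. in $\Omega_i$ for all $k\ge2$ and all $i$, so the method is a direct solver. Moreover there are constants $C,C'>0$, independent of $\theta$ and $k$, such that for all $\theta\in(0,\frac12)$ and $k\ge1$ $$\|e_e^k\|_{L^2(\Omega)}\le C|1-4\theta|^{k-1},\qquad \sum_{i}\|e_{e,i}^k\|_{H^1(\Omega_i)}\le C'|1-4\theta|^{k-1},$$ and for $\theta\in(0,\frac12)$ both norms tend to $0$ as $k\to\infty$. -/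

import Mathlib

open MeasureTheory Set Filter Topology
open scoped ContDiff

namespace NeumannNeumann

/-- The plane. Only its Lebesgue measure, its topology and its smooth structure are used. -/
abbrev Plane : Type := ℝ × ℝ

/-! ### Sobolev spaces on open subsets of the plane -/

/-- `φ` is a test function in `C_c^∞(U)`. -/
def IsTest (U : Set Plane) (φ : Plane → ℝ) : Prop :=
  ContDiff ℝ ∞ φ ∧ HasCompactSupport φ ∧ tsupport φ ⊆ U

/-- Classical partial derivatives of a smooth function. -/
noncomputable def dx (φ : Plane → ℝ) (p : Plane) : ℝ := fderiv ℝ φ p (1, 0)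

/-- Classical partial derivatives of a smooth function. -/
noncomputable def dy (φ : Plane → ℝ) (p : Plane) : ℝ := fderiv ℝ φ p (0, 1)

/-- `w` is the weak derivative of `v` in the direction `e` on the open set `U`. -/
def IsWeakPartial (U : Set Plane) (e : Plane) (v w : Plane → ℝ) : Prop :=
  ∀ φ : Plane → ℝ, IsTest U φ →
    ∫ p in U, v p * fderiv ℝ φ p e = -∫ p in U, w p * φ p

/-- `v` has a weak derivative in the direction `e` that belongs to `L²(U)`. -/
def HasL2WeakPartial (U : Set Plane) (e : Plane) (v : Plane → ℝ) : Prop :=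
  ∃ w : Plane → ℝ, MemLp w 2 (volume.restrict U) ∧ IsWeakPartial U e v w

open Classical in
/-- The square-integrable weak derivative of `v` in the direction `e` on `U`; it is unique up to
null sets (and set to `0` if there is none). -/
noncomputable def weakPartial (U : Set Plane) (e : Plane) (v : Plane → ℝ) : Plane → ℝ :=
  if h : HasL2WeakPartial U e v then h.choose else 0

/-- Weak derivative with respect to `x`. -/
noncomputable def wdx (U : Set Plane) (v : Plane → ℝ) : Plane → ℝ := weakPartial U (1, 0) v

/-- Weak derivative with respect to `y`. -/
noncomputable def wdy (U : Set Plane) (v : Plane → ℝ) : Plane → ℝ := weakPartial U (0, 1) v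

/-- `v ∈ H¹(U)`. -/
def MemH1 (U : Set Plane) (v : Plane → ℝ) : Prop :=
  MemLp v 2 (volume.restrict U) ∧ HasL2WeakPartial U (1, 0) v ∧ HasL2WeakPartial U (0, 1) v

/-- `v ∈ H²(U)`. -/
def MemH2 (U : Set Plane) (v : Plane → ℝ) : Prop :=
  MemH1 U v ∧ MemH1 U (wdx U v) ∧ MemH1 U (wdy U v)

/-- The norm of `L²(U)`. -/
noncomputable def l2Norm (U : Set Plane) (v : Plane → ℝ) : ℝ :=
  Real.sqrt (∫ p in U, v p ^ 2)

/-- The norm of `H¹(U)`. -/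
noncomputable def h1Norm (U : Set Plane) (v : Plane → ℝ) : ℝ :=
  Real.sqrt (∫ p in U, (v p ^ 2 + wdx U v p ^ 2 + wdy U v p ^ 2))

/-- `-Δ v = h` in `U`, in the weak sense. -/
def WeakPoisson (U : Set Plane) (v h : Plane → ℝ) : Prop :=
  ∀ φ : Plane → ℝ, IsTest U φ →
    ∫ p in U, (wdx U v p * dx φ p + wdy U v p * dy φ p) = ∫ p in U, h p * φ p

/-- The value at `φ` of the weak outward normal derivative on `∂U` of a function `v ∈ H¹(U)` with
`-Δ v = h ∈ L²(U)`: by Green's formula, `⟨∂ₙ v, φ⟩ = ∫_U (∇ v · ∇ φ + Δ v φ)`. -/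
noncomputable def normalDeriv (U : Set Plane) (v h φ : Plane → ℝ) : ℝ :=
  ∫ p in U, (wdx U v p * dx φ p + wdy U v p * dy φ p - h p * φ p)

/-! ### Rectangles, arc length and traces -/

/-- Data of the open rectangle `(a, b) × (c, d)`. -/
structure Rect where
  a : ℝ
  b : ℝ
  c : ℝ
  d : ℝ

/-- The open rectangle `(a, b) × (c, d)`. -/
def Rect.set (R : Rect) : Set Plane := Ioo R.a R.b ×ˢ Ioo R.c R.d

/-- Arc length on the vertical segment `{x} × (c, d)`. -/
noncomputable def vArc (x c d : ℝ) : Measure Plane :=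
  (volume.restrict (Ioo c d)).map fun y => (x, y)

/-- Arc length on the horizontal segment `(a, b) × {y}`. -/
noncomputable def hArc (y a b : ℝ) : Measure Plane :=
  (volume.restrict (Ioo a b)).map fun x => (x, y)

/-- Arc length on the boundary of a rectangle. -/
noncomputable def Rect.arc (R : Rect) : Measure Plane :=
  vArc R.a R.c R.d + vArc R.b R.c R.d + hArc R.c R.a R.b + hArc R.d R.a R.b

/-- `τ ∈ L²(∂R)` is the trace on `∂R` of `v ∈ H¹(R)`: the integration by parts formulas
`∫_R (v ∂φ + φ ∂v) = ∫_{∂R} τ φ n`, with `n` the outward unit normal, hold for every `φ` smooth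
up to the boundary. They determine `τ` almost everywhere on `∂R`. -/
def HasTrace (R : Rect) (v τ : Plane → ℝ) : Prop :=
  MemLp τ 2 R.arc ∧
  ∀ φ : Plane → ℝ, ContDiff ℝ ∞ φ →
    (∫ p in R.set, (v p * dx φ p + wdx R.set v p * φ p) =
      (∫ p, τ p * φ p ∂(vArc R.b R.c R.d)) - ∫ p, τ p * φ p ∂(vArc R.a R.c R.d)) ∧
    (∫ p in R.set, (v p * dy φ p + wdy R.set v p * φ p) =
      (∫ p, τ p * φ p ∂(hArc R.d R.a R.b)) - ∫ p, τ p * φ p ∂(hArc R.c R.a R.b))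

/-- `v ∈ H¹₀(R)`: `v ∈ H¹(R)` has zero trace. -/
def MemH10 (R : Rect) (v : Plane → ℝ) : Prop := MemH1 R.set v ∧ HasTrace R v 0

/-- The class `v` has the value `c` at the point `p` of the closed rectangle, that is, its
representative which is continuous on the closed rectangle takes the value `c` at `p`. Every
element of `H²(R)` has such a representative. -/
def HasPointValue (R : Rect) (v : Plane → ℝ) (p : Plane) (c : ℝ) : Prop :=
  ∃ w : Plane → ℝ, w =ᵐ[volume.restrict R.set] v ∧ ContinuousOn w (closure R.set) ∧ w p = c

/-- `g ∈ H^{3/2}(∂R)`, the space of boundary values of the elements of `H²(R)`; both `g` and the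
function it extends to are taken in their continuous versions. -/
def MemH32 (R : Rect) (g : Plane → ℝ) : Prop :=
  ∃ G : Plane → ℝ, MemH2 R.set G ∧ ContinuousOn G (closure R.set) ∧ ∀ p ∈ frontier R.set, G p = g p

/-- `u ∈ H¹(R)` is the weak solution of `-Δ u = f` in `R`, `u = g` on `∂R`. -/
def IsDirichletSolution (R : Rect) (f g u : Plane → ℝ) : Prop :=
  MemH1 R.set u ∧ WeakPoisson R.set u f ∧ HasTrace R u g

/-! ### The decomposition of the square -/

/-- The square `Ω = (-1, 1) × (-1, 1)`. -/
def square : Rect := ⟨-1, 1, -1, 1⟩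

/-- The four subsquares: bottom left, bottom right, top right, top left. -/
def subRect : Fin 4 → Rect :=
  ![⟨-1, 0, -1, 0⟩, ⟨0, 1, -1, 0⟩, ⟨0, 1, 0, 1⟩, ⟨-1, 0, 0, 1⟩]

/-- The square `Ω` as a set. -/
def Omega : Set Plane := square.set

/-- The `i`-th subsquare as a set. -/
def Subsq (i : Fin 4) : Set Plane := (subRect i).set

/-- The open interface between two different subsquares: the common boundary without its end points
(the end points on `∂Ω` and the interior cross-point). It is empty for opposite subsquares. -/
def interface (i j : Fin 4) : Set Plane :=
  (frontier (Subsq i) ∩ frontier (Subsq j) ∩ Omega) \ {(0, 0)}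

/-- The skeleton: the union of the closures of the interfaces. -/
def skeleton : Set Plane := ⋃ (i : Fin 4) (j : Fin 4) (_ : i ≠ j), closure (interface i j)

/-- The function on `Ω` (off the skeleton) made of four functions on the subsquares. -/
noncomputable def glue (v : Fin 4 → Plane → ℝ) (p : Plane) : ℝ :=
  ∑ i, (Subsq i).indicator (v i) p

/-- The even symmetric part of a function. -/
noncomputable def evenPart (h : Plane → ℝ) (p : Plane) : ℝ := (h p + h (-p)) / 2

/-- The broken `H¹` norm. -/
noncomputable def brokenH1Norm (v : Fin 4 → Plane → ℝ) : ℝ := ∑ i, h1Norm (Subsq i) (v i)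

/-! ### The Neumann-Neumann method -/

/-- Dirichlet step: `v i ∈ H¹(Ω_i)` with `-Δ (v i) = f` in `Ω_i`, `v i = g` on `∂Ω_i ∩ ∂Ω` and
`v i = u i - θ (ψ i + ψ j)` on each interface `Γ_ij`. Here `tv i`, `tu i`, `tψ i` are the traces of
`v i`, `u i`, `ψ i` on `∂Ω_i`. -/
def DirichletStep (θ : ℝ) (f g : Plane → ℝ) (u ψ v : Fin 4 → Plane → ℝ) : Prop :=
  (∀ i, MemH1 (Subsq i) (v i) ∧ WeakPoisson (Subsq i) (v i) f) ∧
  ∃ tv tu tψ : Fin 4 → Plane → ℝ,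
    (∀ i, HasTrace (subRect i) (v i) (tv i) ∧ HasTrace (subRect i) (u i) (tu i) ∧
      HasTrace (subRect i) (ψ i) (tψ i)) ∧
    (∀ i, ∀ᵐ p ∂(subRect i).arc, p ∈ frontier Omega → tv i p = g p) ∧
    (∀ i j, i ≠ j → (interface i j).Nonempty →
      ∀ᵐ p ∂(subRect i).arc, p ∈ interface i j → tv i p = tu i p - θ * (tψ i p + tψ j p))

/-- Neumann step: `ψ i ∈ H¹(Ω_i)` with `-Δ (ψ i) = 0` in `Ω_i`, `ψ i = 0` on `∂Ω_i ∩ ∂Ω` and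
`∂_{n_i} (ψ i) = ∂_{n_i} (u i) + ∂_{n_j} (u j)` on each interface `Γ_ij`, as distributions on the
open segment `Γ_ij`. Here `u` is the result of the Dirichlet step, so that `-Δ (u i) = f`. -/
def NeumannStep (f : Plane → ℝ) (u ψ : Fin 4 → Plane → ℝ) : Prop :=
  (∀ i, MemH1 (Subsq i) (ψ i) ∧ WeakPoisson (Subsq i) (ψ i) 0) ∧
  (∀ i, ∃ t : Plane → ℝ, HasTrace (subRect i) (ψ i) t ∧
    ∀ᵐ p ∂(subRect i).arc, p ∈ frontier Omega → t p = 0) ∧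
  (∀ i j, i ≠ j → (interface i j).Nonempty →
    ∀ φ : Plane → ℝ, IsTest (Subsq i ∪ interface i j ∪ Subsq j) φ →
      normalDeriv (Subsq i) (ψ i) 0 φ =
        normalDeriv (Subsq i) (u i) f φ + normalDeriv (Subsq j) (u j) f φ)

/-- `(u k, ψ k)`, `k ≥ 0`, is a sequence of iterates of the Neumann-Neumann method with relaxation
parameter `θ` for `-Δ u = f` in `Ω`, `u = g` on `∂Ω`, with initial couple `(u0, ψ0)`. -/
structure IsNNSequence (θ : ℝ) (f g u0 ψ0 : Plane → ℝ) (u ψ : ℕ → Fin 4 → Plane → ℝ) : Prop where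
  init_u : ∀ i, u 0 i =ᵐ[volume.restrict (Subsq i)] u0
  init_psi : ∀ i, ψ 0 i =ᵐ[volume.restrict (Subsq i)] ψ0
  dirichlet : ∀ k, DirichletStep θ f g (u k) (ψ k) (u (k + 1))
  neumann : ∀ k, NeumannStep f (u (k + 1)) (ψ (k + 1))

/-- The initial couple is compatible with the Dirichlet condition: `u0 ∈ H²(Ω)`,
`ψ0 ∈ H²(Ω) ∩ H¹₀(Ω)` and `u0 = g` at the boundary cross-points. -/
def Compatible (g u0 ψ0 : Plane → ℝ) : Prop :=
  MemH2 Omega u0 ∧ MemH2 Omega ψ0 ∧ MemH10 square ψ0 ∧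
    ∀ p ∈ frontier Omega ∩ skeleton, HasPointValue square u0 p (g p)

/-- The `L²(Ω)` norm of the error of the `k`-th iterate. -/
noncomputable def l2Error (ue : Plane → ℝ) (v : Fin 4 → Plane → ℝ) : ℝ :=
  l2Norm Omega fun p => ue p - glue v p

/-- The broken `H¹` norm of the error. -/
noncomputable def h1Error (ue : Plane → ℝ) (v : Fin 4 → Plane → ℝ) : ℝ :=
  brokenH1Norm fun i p => ue p - v i p

end NeumannNeumann

open NeumannNeumann

/-!
The iterates can be written down. Let `Q = (0, 1)²` and fold the square onto the closure of `Q` by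
`fold (x, y) = (|x|, |y|)`. Let `E` be harmonic in `Q`, zero on the sides of `Q` on `∂Ω`, and equal
to the values of `u_e - u⁰_e + 2 θ ψ⁰_e` on the two sides on the axes. All data are even, and on the
axes `fold` is the identity or the point reflection, so `E ∘ fold` has the boundary values of the
first error on *every* subsquare: one function describes the errors on all four of them. Since
`E ∘ fold` is symmetric in each coordinate, its two outward normal derivatives at an interface
agree (`integral_gradient_fold_eq`), while those of `u_e` cancel. If the error is `c E ∘ fold`, the
Neumann step therefore has the solution `ψ = -2 c E ∘ fold`, and the next Dirichlet step changes the
interface values of the error from `c E` to `c E + θ (ψ_i + ψ_j) = (1 - 4 θ) c E`. Thus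
`uᵏ = u_e - (1 - 4 θ)^(k - 1) E ∘ fold` and `ψᵏ = -2 (1 - 4 θ)^(k - 1) E ∘ fold` are iterates
(`ErrorProfile.isNNSequence`), and all claims can be read off, since the iterates are unique
(`IsNNSequence.unique`). The function `E = A + 2 θ B` is affine in `θ`, which gives
constants that do not depend on `θ`.

Existence of `E`. A harmonic function with the trace of a given `H¹` function is found by projecting
the gradient of that function on the closure of the gradients of test functions
(`exists_harmonic`). The values of `ψ⁰_e` on the axes, together with zero on the outer sides, are
the trace of `ψ⁰_e` itself on `∂Q`, as `ψ⁰_e` vanishes on `∂Ω`. For `u_e - u⁰_e` write `u_e = v + G`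
with `G ∈ H²(Ω)` an even extension of the boundary values and `v ∈ H¹₀(Ω)`; the trace of `v` needs
no change, and `W = G - u⁰_e` is continuous, vanishes at the four boundary cross-points, and has values
on the axes that lie in `H¹` of the axes, because `W ∈ H²`. Its values on the axes are therefore
lifted by linear interpolation (`HasMixedPartials.exists_lift`). This is where the `H²` regularity
and the compatibility of `u⁰` with `g` enter.

Uniqueness. The Dirichlet step needs uniqueness for the Dirichlet problem in a rectangle, the
Neumann step, reflected to `Q`, uniqueness for the mixed problem in `Q`, where the Neumann condition holds
only as distributions on the open sides. The corner between them is removable since a point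
has zero capacity (`integral_eq_zero_of_mixed`). In both cases a solution with zero data is
orthogonal to all products of eigenfunctions by Green's formula, hence zero by the Stone-Weierstrass
theorem (`ae_eq_zero_of_dirichlet`, `ae_eq_zero_of_mixed`).

Traces are handled one coordinate direction at a time (`HasXTrace`), and the other direction is
obtained by swapping the coordinates.
-/

namespace NeumannNeumann

/-! ### Calculus of smooth functions of two variables -/

/-- The open box `(a, b) × (c, d)`; `Rect.set` unfolds to it. -/
abbrev box (a b c d : ℝ) : Set Plane := Ioo a b ×ˢ Ioo c d

lemma isOpen_box (a b c d : ℝ) : IsOpen (box a b c d) := isOpen_Ioo.prod isOpen_Ioo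

lemma measurableSet_box (a b c d : ℝ) : MeasurableSet (box a b c d) :=
  (isOpen_box a b c d).measurableSet

lemma volume_box_lt_top (a b c d : ℝ) : volume (box a b c d) < ⊤ := by
  rw [Measure.volume_eq_prod, Measure.prod_prod]
  exact ENNReal.mul_lt_top measure_Ioo_lt_top measure_Ioo_lt_top

instance isFiniteMeasure_box (a b c d : ℝ) :
    IsFiniteMeasure ((volume : Measure Plane).restrict (box a b c d)) :=
  ⟨by rw [Measure.restrict_apply_univ]; exact volume_box_lt_top a b c d⟩

lemma restrict_box (a b c d : ℝ) : (volume : Measure Plane).restrict (box a b c d) =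
    ((volume : Measure ℝ).restrict (Ioo a b)).prod ((volume : Measure ℝ).restrict (Ioo c d)) := by
  rw [Measure.prod_restrict, ← Measure.volume_eq_prod]

lemma smooth_diff {φ : Plane → ℝ} (h : ContDiff ℝ ∞ φ) : Differentiable ℝ φ :=
  h.differentiable (by simp)

lemma smooth_dir {φ : Plane → ℝ} (h : ContDiff ℝ ∞ φ) (e : Plane) :
    ContDiff ℝ ∞ fun p => fderiv ℝ φ p e :=
  (h.fderiv_right (m := ∞) (by simp)).clm_apply contDiff_const

lemma smooth_dx {φ : Plane → ℝ} (h : ContDiff ℝ ∞ φ) : ContDiff ℝ ∞ (dx φ) := smooth_dir h _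

lemma smooth_dy {φ : Plane → ℝ} (h : ContDiff ℝ ∞ φ) : ContDiff ℝ ∞ (dy φ) := smooth_dir h _

lemma smooth_fst {χ : ℝ → ℝ} (h : ContDiff ℝ ∞ χ) : ContDiff ℝ ∞ fun p : Plane => χ p.1 :=
  h.comp contDiff_fst

lemma smooth_snd {χ : ℝ → ℝ} (h : ContDiff ℝ ∞ χ) : ContDiff ℝ ∞ fun p : Plane => χ p.2 :=
  h.comp contDiff_snd

lemma smooth_swap {φ : Plane → ℝ} (h : ContDiff ℝ ∞ φ) :
    ContDiff ℝ ∞ (φ ∘ (Prod.swap : Plane → Plane)) :=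
  h.comp (contDiff_snd.prodMk contDiff_fst)

lemma hasDerivAt_dx {φ : Plane → ℝ} (h : ContDiff ℝ ∞ φ) (x y : ℝ) :
    HasDerivAt (fun s => φ (s, y)) (dx φ (x, y)) x := by
  have h1 : HasFDerivAt φ (fderiv ℝ φ (x, y)) (x, y) := (smooth_diff h (x, y)).hasFDerivAt
  have h2 : HasDerivAt (fun s : ℝ => ((s, y) : Plane)) (1, 0) x :=
    (hasDerivAt_id x).prodMk (hasDerivAt_const x y)
  exact h1.comp_hasDerivAt x h2

lemma dx_eq_of_hasDerivAt {φ : Plane → ℝ} (h : ContDiff ℝ ∞ φ) {x y d : ℝ}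
    (hd : HasDerivAt (fun s => φ (s, y)) d x) : dx φ (x, y) = d :=
  (hasDerivAt_dx h x y).unique hd

lemma fderiv_swap {φ : Plane → ℝ} (h : ContDiff ℝ ∞ φ) (p e : Plane) :
    fderiv ℝ (φ ∘ Prod.swap) p e = fderiv ℝ φ p.swap e.swap := by
  have h1 : HasFDerivAt φ (fderiv ℝ φ p.swap) p.swap := (smooth_diff h _).hasFDerivAt
  have h2 : HasFDerivAt (Prod.swap : Plane → Plane)
      (ContinuousLinearEquiv.prodComm ℝ ℝ ℝ : Plane →L[ℝ] Plane) p :=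
    (ContinuousLinearEquiv.prodComm ℝ ℝ ℝ).hasFDerivAt
  rw [(h1.comp p h2).fderiv]
  rfl

lemma dx_swap {φ : Plane → ℝ} (h : ContDiff ℝ ∞ φ) (p : Plane) :
    dx (φ ∘ Prod.swap) p = dy φ p.swap := fderiv_swap h p (1, 0)

lemma dy_swap {φ : Plane → ℝ} (h : ContDiff ℝ ∞ φ) (p : Plane) :
    dy (φ ∘ Prod.swap) p = dx φ p.swap := by
  have := dx_swap (smooth_swap h) p.swap
  simp only [Function.comp_assoc, Prod.swap_swap_eq, Function.comp_id, Prod.swap_swap] at this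
  exact this.symm

lemma dx_mul {φ ψ : Plane → ℝ} (h : ContDiff ℝ ∞ φ) (h' : ContDiff ℝ ∞ ψ) (p : Plane) :
    dx (fun q => φ q * ψ q) p = dx φ p * ψ p + φ p * dx ψ p := by
  have := ((smooth_diff h p).hasFDerivAt.mul (smooth_diff h' p).hasFDerivAt).fderiv
  simp only [dx]
  erw [this]
  simp; ring

lemma dy_mul {φ ψ : Plane → ℝ} (h : ContDiff ℝ ∞ φ) (h' : ContDiff ℝ ∞ ψ) (p : Plane) :
    dy (fun q => φ q * ψ q) p = dy φ p * ψ p + φ p * dy ψ p := by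
  have := ((smooth_diff h p).hasFDerivAt.mul (smooth_diff h' p).hasFDerivAt).fderiv
  simp only [dy]
  erw [this]
  simp; ring

lemma dx_add {φ ψ : Plane → ℝ} (h : ContDiff ℝ ∞ φ) (h' : ContDiff ℝ ∞ ψ) (p : Plane) :
    dx (fun q => φ q + ψ q) p = dx φ p + dx ψ p := by
  simp only [dx]
  rw [fderiv_fun_add (smooth_diff h p) (smooth_diff h' p)]; rfl

lemma dy_add {φ ψ : Plane → ℝ} (h : ContDiff ℝ ∞ φ) (h' : ContDiff ℝ ∞ ψ) (p : Plane) :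
    dy (fun q => φ q + ψ q) p = dy φ p + dy ψ p := by
  simp only [dy]
  rw [fderiv_fun_add (smooth_diff h p) (smooth_diff h' p)]; rfl

lemma dx_sub {φ ψ : Plane → ℝ} (h : ContDiff ℝ ∞ φ) (h' : ContDiff ℝ ∞ ψ) (p : Plane) :
    dx (fun q => φ q - ψ q) p = dx φ p - dx ψ p := by
  simp only [dx]
  rw [fderiv_fun_sub (smooth_diff h p) (smooth_diff h' p)]; rfl

lemma dy_sub {φ ψ : Plane → ℝ} (h : ContDiff ℝ ∞ φ) (h' : ContDiff ℝ ∞ ψ) (p : Plane) :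
    dy (fun q => φ q - ψ q) p = dy φ p - dy ψ p := by
  simp only [dy]
  rw [fderiv_fun_sub (smooth_diff h p) (smooth_diff h' p)]; rfl

lemma dx_const_mul {φ : Plane → ℝ} (h : ContDiff ℝ ∞ φ) (k : ℝ) (p : Plane) :
    dx (fun q => k * φ q) p = k * dx φ p := by
  simp only [dx]
  rw [fderiv_const_mul (smooth_diff h p)]; rfl

lemma dy_const_mul {φ : Plane → ℝ} (h : ContDiff ℝ ∞ φ) (k : ℝ) (p : Plane) :
    dy (fun q => k * φ q) p = k * dy φ p := by
  simp only [dy]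
  rw [fderiv_const_mul (smooth_diff h p)]; rfl

lemma dx_fst {χ : ℝ → ℝ} (h : ContDiff ℝ ∞ χ) (p : Plane) :
    dx (fun q => χ q.1) p = deriv χ p.1 :=
  dx_eq_of_hasDerivAt (smooth_fst h) (y := p.2) (h.differentiable (by simp) p.1).hasDerivAt

lemma dx_snd {χ : ℝ → ℝ} (h : ContDiff ℝ ∞ χ) (p : Plane) : dx (fun q => χ q.2) p = 0 :=
  dx_eq_of_hasDerivAt (smooth_snd h) (y := p.2) (hasDerivAt_const p.1 (χ p.2))

lemma dy_fst {χ : ℝ → ℝ} (h : ContDiff ℝ ∞ χ) (p : Plane) : dy (fun q => χ q.1) p = 0 := by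
  have := dx_swap (smooth_fst h) p.swap
  rw [Prod.swap_swap] at this
  rw [← this]
  exact dx_snd h p.swap

lemma dy_snd {χ : ℝ → ℝ} (h : ContDiff ℝ ∞ χ) (p : Plane) :
    dy (fun q => χ q.2) p = deriv χ p.2 := by
  have := dx_swap (smooth_snd h) p.swap
  rw [Prod.swap_swap] at this
  rw [← this]
  exact dx_fst h p.swap

/-- The coordinate reflection `(x, y) ↦ (s x, t y)`, used with `s, t ∈ {1, -1}`. -/
def refl (s t : ℝ) (p : Plane) : Plane := (s * p.1, t * p.2)

lemma refl_refl {s t : ℝ} (hs : s * s = 1) (ht : t * t = 1) (p : Plane) :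
    refl s t (refl s t p) = p := by
  simp only [refl]; ext
  · simp only [← mul_assoc, hs, one_mul]
  · simp only [← mul_assoc, ht, one_mul]

lemma smooth_refl_map (s t : ℝ) : ContDiff ℝ ∞ (refl s t) :=
  (contDiff_const.mul contDiff_fst).prodMk (contDiff_const.mul contDiff_snd)

lemma smooth_refl {φ : Plane → ℝ} (h : ContDiff ℝ ∞ φ) (s t : ℝ) :
    ContDiff ℝ ∞ (φ ∘ refl s t) := h.comp (smooth_refl_map s t)

lemma dx_refl {φ : Plane → ℝ} (h : ContDiff ℝ ∞ φ) (s t : ℝ) (p : Plane) :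
    dx (φ ∘ refl s t) p = s * dx φ (refl s t p) := by
  refine dx_eq_of_hasDerivAt (smooth_refl h s t) (x := p.1) (y := p.2) ?_
  have h1 := hasDerivAt_dx h (s * p.1) (t * p.2)
  have h2 : HasDerivAt (fun r : ℝ => s * r) s p.1 := by
    simpa using (hasDerivAt_id p.1).const_mul s
  have := h1.comp p.1 h2
  rw [mul_comm]; exact this

lemma dy_refl {φ : Plane → ℝ} (h : ContDiff ℝ ∞ φ) (s t : ℝ) (p : Plane) :
    dy (φ ∘ refl s t) p = t * dy φ (refl s t p) := by
  have h1 := dx_refl (smooth_swap h) t s p.swap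
  have h2 := dx_swap (smooth_refl h s t) p.swap
  rw [dx_swap h] at h1
  rw [Prod.swap_swap] at h2
  rw [← h2]; exact h1

lemma measurePreserving_refl {s t : ℝ} (hs : s * s = 1) (ht : t * t = 1) :
    MeasurePreserving (refl s t) := by
  have key : ∀ r : ℝ, r * r = 1 → MeasurePreserving (fun x : ℝ => r * x) := by
    intro r hr
    rcases mul_self_eq_one_iff.1 hr with rfl | rfl
    · simp only [one_mul]; exact MeasurePreserving.id (volume : Measure ℝ)
    · simpa using Measure.measurePreserving_neg (volume : Measure ℝ)
  exact (key s hs).prod (key t ht)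

lemma measurableEmbedding_refl {s t : ℝ} (hs : s * s = 1) (ht : t * t = 1) :
    MeasurableEmbedding (refl s t) := by
  let e : Plane ≃ᵐ Plane :=
    { toFun := refl s t, invFun := refl s t, left_inv := refl_refl hs ht,
      right_inv := refl_refl hs ht,
      measurable_toFun := (smooth_refl_map s t).continuous.measurable
      measurable_invFun := (smooth_refl_map s t).continuous.measurable }
  exact e.measurableEmbedding

lemma setIntegral_refl {s t : ℝ} (hs : s * s = 1) (ht : t * t = 1) (F : Plane → ℝ)
    (U : Set Plane) : ∫ p in refl s t ⁻¹' U, F (refl s t p) = ∫ p in U, F p :=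
  (measurePreserving_refl hs ht).setIntegral_preimage_emb (measurableEmbedding_refl hs ht) F U

lemma measurePreserving_refl_restrict {s t : ℝ} (hs : s * s = 1) (ht : t * t = 1)
    (U : Set Plane) : MeasurePreserving (refl s t) (volume.restrict (refl s t ⁻¹' U))
      (volume.restrict U) :=
  (measurePreserving_refl hs ht).restrict_preimage_emb (measurableEmbedding_refl hs ht) U

lemma setIntegral_swap (F : Plane → ℝ) (a b c d : ℝ) :
    ∫ p in box c d a b, F p.swap = ∫ p in box a b c d, F p := by
  have := (Measure.measurePreserving_swap (μ := (volume : Measure ℝ))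
    (ν := (volume : Measure ℝ))).setIntegral_preimage_emb
    (MeasurableEquiv.prodComm.measurableEmbedding) F (box a b c d)
  rw [preimage_swap_prod] at this
  exact this

lemma measurePreserving_swap_box (a b c d : ℝ) :
    MeasurePreserving (Prod.swap : Plane → Plane) (volume.restrict (box c d a b))
      (volume.restrict (box a b c d)) := by
  have := (Measure.measurePreserving_swap (μ := (volume : Measure ℝ))
    (ν := (volume : Measure ℝ))).restrict_preimage_emb
    (MeasurableEquiv.prodComm.measurableEmbedding) (box a b c d)
  rw [preimage_swap_prod] at this
  exact this

lemma exists_bound_box {φ : Plane → ℝ} (h : Continuous φ) (a b c d : ℝ) :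
    ∃ M, 0 ≤ M ∧ ∀ p ∈ Icc a b ×ˢ Icc c d, |φ p| ≤ M := by
  obtain ⟨M, hM⟩ := (isCompact_Icc.prod isCompact_Icc).exists_bound_of_continuousOn
    (s := Icc a b ×ˢ Icc c d) h.continuousOn
  exact ⟨max M 0, le_max_right _ _, fun p hp => (hM p hp).trans (le_max_left _ _)⟩

lemma box_subset_Icc (a b c d : ℝ) : box a b c d ⊆ Icc a b ×ˢ Icc c d :=
  prod_mono Ioo_subset_Icc_self Ioo_subset_Icc_self

lemma memLp_box_of_continuous {φ : Plane → ℝ} (h : Continuous φ) (a b c d : ℝ) :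
    MemLp φ 2 (volume.restrict (box a b c d)) := by
  obtain ⟨M, -, hM⟩ := exists_bound_box h a b c d
  refine MemLp.of_bound h.aestronglyMeasurable M ?_
  filter_upwards [ae_restrict_mem (measurableSet_box a b c d)] with p hp
  exact hM p (box_subset_Icc _ _ _ _ hp)

lemma memLp_Ioo_of_continuousOn {η : ℝ → ℝ} {c d : ℝ} (h : ContinuousOn η (Icc c d)) :
    MemLp η 2 (volume.restrict (Ioo c d)) := by
  obtain ⟨M, hM⟩ := isCompact_Icc.exists_bound_of_continuousOn h
  refine MemLp.of_bound
    ((h.mono Ioo_subset_Icc_self).aestronglyMeasurable measurableSet_Ioo) M ?_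
  filter_upwards [ae_restrict_mem measurableSet_Ioo] with y hy
  exact hM y (Ioo_subset_Icc_self hy)

lemma memLp_Ioo_of_continuous {η : ℝ → ℝ} (h : Continuous η) (c d : ℝ) :
    MemLp η 2 (volume.restrict (Ioo c d)) :=
  memLp_Ioo_of_continuousOn h.continuousOn

lemma integrable_mul_of_memLp {α : Type*} [MeasurableSpace α] {μ : Measure α} {u v : α → ℝ}
    (hu : MemLp u 2 μ) (hv : MemLp v 2 μ) : Integrable (fun p => u p * v p) μ :=
  hu.integrable_mul hv

lemma integrable_mul_continuous {v φ : Plane → ℝ} {a b c d : ℝ}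
    (hv : MemLp v 2 (volume.restrict (box a b c d))) (h : Continuous φ) :
    Integrable (fun p => v p * φ p) (volume.restrict (box a b c d)) :=
  integrable_mul_of_memLp hv (memLp_box_of_continuous h a b c d)

/-- Dominated convergence for `∫ P F n` with uniformly bounded factors `F n`. -/
lemma tendsto_integral_mul {α : Type*} [MeasurableSpace α] {μ : Measure α} {P : α → ℝ}
    (hP : Integrable P μ) {F : ℕ → α → ℝ} {f : α → ℝ}
    (hF : ∀ n, AEStronglyMeasurable (F n) μ) (B : ℝ) (hB : ∀ n, ∀ᵐ x ∂μ, |F n x| ≤ B)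
    (hlim : ∀ᵐ x ∂μ, Tendsto (fun n => F n x) atTop (𝓝 (f x))) :
    Tendsto (fun n => ∫ x, P x * F n x ∂μ) atTop (𝓝 (∫ x, P x * f x ∂μ)) := by
  refine tendsto_integral_of_dominated_convergence (fun x => |P x| * B)
    (fun n => hP.aestronglyMeasurable.mul (hF n)) (hP.abs.mul_const B) (fun n => ?_) ?_
  · filter_upwards [hB n] with x hx
    rw [Real.norm_eq_abs, abs_mul]
    exact mul_le_mul_of_nonneg_left hx (abs_nonneg _)
  · filter_upwards [hlim] with x hx
    exact hx.const_mul _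

/-! ### Cutoff functions -/

/-- A smooth function that is `0` on `(-∞, 1 / n]` and `1` on `[2 / n, ∞)`. -/
noncomputable def step (n : ℕ) (x : ℝ) : ℝ := Real.smoothTransition (n * x - 1)

/-- A smooth cutoff of the interval `(a, b)`, supported in `[a + 1 / n, b - 1 / n]`. -/
noncomputable def cut (a b : ℝ) (n : ℕ) (x : ℝ) : ℝ := step n (x - a) * step n (b - x)

lemma smooth_step (n : ℕ) : ContDiff ℝ ∞ (step n) :=
  (Real.smoothTransition.contDiff (n := ⊤)).comp ((contDiff_const.mul contDiff_id).sub contDiff_const)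

lemma smooth_cut (a b : ℝ) (n : ℕ) : ContDiff ℝ ∞ (cut a b n) :=
  ((smooth_step n).comp (contDiff_id.sub contDiff_const)).mul
    ((smooth_step n).comp (contDiff_const.sub contDiff_id))

lemma step_nonneg (n : ℕ) (x : ℝ) : 0 ≤ step n x := Real.smoothTransition.nonneg _

lemma step_le_one (n : ℕ) (x : ℝ) : step n x ≤ 1 := Real.smoothTransition.le_one _

lemma cut_nonneg (a b : ℝ) (n : ℕ) (x : ℝ) : 0 ≤ cut a b n x :=
  mul_nonneg (step_nonneg _ _) (step_nonneg _ _)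

lemma cut_le_one (a b : ℝ) (n : ℕ) (x : ℝ) : cut a b n x ≤ 1 :=
  mul_le_one₀ (step_le_one _ _) (step_nonneg _ _) (step_le_one _ _)

lemma abs_cut_le_one (a b : ℝ) (n : ℕ) (x : ℝ) : |cut a b n x| ≤ 1 := by
  rw [abs_of_nonneg (cut_nonneg _ _ _ _)]; exact cut_le_one _ _ _ _

lemma step_eq_zero {n : ℕ} {x : ℝ} (h : n * x ≤ 1) : step n x = 0 :=
  Real.smoothTransition.zero_of_nonpos (by linarith)

lemma step_eq_one {n : ℕ} {x : ℝ} (h : 2 ≤ n * x) : step n x = 1 :=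
  Real.smoothTransition.one_of_one_le (by linarith)

lemma deriv_step_eq_zero {n : ℕ} {x : ℝ} (h : 2 < n * x) : deriv (step n) x = 0 := by
  have : step n =ᶠ[𝓝 x] fun _ => 1 := by
    have : ∀ᶠ y : ℝ in 𝓝 x, 2 < n * y :=
      (continuous_const.mul continuous_id).continuousAt.eventually_const_lt h
    filter_upwards [this] with y hy using step_eq_one hy.le
  rw [this.deriv_eq]; simp

/-- The derivative of `step n` is at most `C n`. -/
lemma exists_deriv_step_bound : ∃ C : ℝ, 0 ≤ C ∧ ∀ (n : ℕ) (x : ℝ), |deriv (step n) x| ≤ C * n := by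
  have hs : ContDiff ℝ ∞ Real.smoothTransition := Real.smoothTransition.contDiff (n := ⊤)
  have hd : Continuous (deriv Real.smoothTransition) := hs.continuous_deriv (by simp)
  obtain ⟨C, hC⟩ := isCompact_Icc.exists_bound_of_continuousOn (s := Icc (0 : ℝ) 1) hd.continuousOn
  have hall : ∀ x, |deriv Real.smoothTransition x| ≤ max C 0 := by
    intro x
    by_cases hx : x ∈ Icc (0 : ℝ) 1
    · exact (hC x hx).trans (le_max_left _ _)
    · have : deriv Real.smoothTransition x = 0 := by
        rcases lt_or_ge x 0 with h | h
        · have : Real.smoothTransition =ᶠ[𝓝 x] fun _ => 0 := by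
            filter_upwards [eventually_lt_nhds h] with y hy using
              Real.smoothTransition.zero_of_nonpos (le_of_lt hy)
          rw [this.deriv_eq]; simp
        · have h1 : 1 < x := by
            by_contra h'
            exact hx ⟨h, not_lt.1 h'⟩
          have : Real.smoothTransition =ᶠ[𝓝 x] fun _ => 1 := by
            filter_upwards [eventually_gt_nhds h1] with y hy using
              Real.smoothTransition.one_of_one_le (le_of_lt hy)
          rw [this.deriv_eq]; simp
      rw [this, abs_zero]; exact le_max_right _ _
  refine ⟨max C 0, le_max_right _ _, fun n x => ?_⟩
  have h1 : HasDerivAt (step n) (deriv Real.smoothTransition (n * x - 1) * n) x := by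
    have h2 : HasDerivAt (fun x : ℝ => (n : ℝ) * x - 1) n x := by
      simpa using ((hasDerivAt_id x).const_mul (n : ℝ)).sub_const 1
    exact ((hs.differentiable (by simp) _).hasDerivAt).comp x h2
  rw [h1.deriv, abs_mul, Nat.abs_cast]
  exact mul_le_mul_of_nonneg_right (hall _) (Nat.cast_nonneg n)

lemma deriv_cut (a b : ℝ) (n : ℕ) (x : ℝ) : deriv (cut a b n) x =
    deriv (step n) (x - a) * step n (b - x) - step n (x - a) * deriv (step n) (b - x) := by
  have hd : ∀ y, HasDerivAt (step n) (deriv (step n) y) y := fun y =>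
    ((smooth_step n).differentiable (by simp) y).hasDerivAt
  have h1 : HasDerivAt (fun x => step n (x - a)) (deriv (step n) (x - a)) x := by
    have := (hd (x - a)).comp x ((hasDerivAt_id x).sub_const a)
    rw [mul_one] at this; exact this
  have h2 : HasDerivAt (fun x => step n (b - x)) (-deriv (step n) (b - x)) x := by
    have := (hd (b - x)).comp x ((hasDerivAt_id x).const_sub b)
    rw [mul_neg_one] at this; exact this
  have := (h1.mul h2).deriv
  rw [show cut a b n = (fun x => step n (x - a)) * fun x => step n (b - x) from rfl, this]
  ring

lemma abs_mul_deriv_step_le {C : ℝ} (hC0 : 0 ≤ C)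
    (hC : ∀ (n : ℕ) (x : ℝ), |deriv (step n) x| ≤ C * n) (n : ℕ)
    {x : ℝ} (hx : 0 ≤ x) : x * |deriv (step n) x| ≤ 2 * C := by
  rcases lt_or_ge 2 ((n : ℝ) * x) with h | h
  · rw [deriv_step_eq_zero h]; simp; positivity
  · calc x * |deriv (step n) x| ≤ x * (C * n) := mul_le_mul_of_nonneg_left (hC n x) hx
      _ = C * (n * x) := by ring
      _ ≤ C * 2 := mul_le_mul_of_nonneg_left h hC0
      _ = 2 * C := by ring

lemma eventually_lt_nat_mul {x : ℝ} (hx : 0 < x) : ∀ᶠ n : ℕ in atTop, 2 < (n : ℝ) * x :=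
  (tendsto_natCast_atTop_atTop.atTop_mul_const hx).eventually_gt_atTop 2

lemma eventually_cut {a b x : ℝ} (hx : x ∈ Ioo a b) :
    ∀ᶠ n in atTop, cut a b n x = 1 ∧ deriv (cut a b n) x = 0 := by
  filter_upwards [eventually_lt_nat_mul (sub_pos.2 hx.1), eventually_lt_nat_mul (sub_pos.2 hx.2)]
    with n h1 h2
  rw [deriv_cut, cut, step_eq_one h1.le, step_eq_one h2.le, deriv_step_eq_zero h1,
    deriv_step_eq_zero h2]
  simp

lemma cut_eq_zero {a b : ℝ} {n : ℕ} {x : ℝ} (hn : 0 < n)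
    (hx : x ∉ Icc (a + 1 / n) (b - 1 / n)) : cut a b n x = 0 := by
  have hn' : (0 : ℝ) < n := Nat.cast_pos.2 hn
  rw [mem_Icc, not_and_or, not_le, not_le] at hx
  rcases hx with h | h
  · rw [cut, step_eq_zero, zero_mul]
    have : x - a < 1 / n := by linarith
    rw [lt_div_iff₀ hn'] at this; linarith
  · rw [cut, mul_comm, step_eq_zero, zero_mul]
    have : b - x < 1 / n := by linarith
    rw [lt_div_iff₀ hn'] at this; linarith

/-- A smooth function that vanishes outside a compact subset of `U` is a test function. -/
lemma isTest_of_eq_zero {U K : Set Plane} {φ : Plane → ℝ} (hφ : ContDiff ℝ ∞ φ) (hK : IsCompact K)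
    (hKU : K ⊆ U) (h0 : ∀ p, p ∉ K → φ p = 0) : IsTest U φ :=
  have hsub : tsupport φ ⊆ K := closure_minimal
    (fun p hp => by by_contra h; exact hp (h0 p h)) hK.isClosed
  ⟨hφ, hK.of_isClosed_subset (isClosed_tsupport φ) hsub, hsub.trans hKU⟩

lemma isTest_cut_mul {a b c d : ℝ} {n m : ℕ} (hn : 0 < n) (hm : 0 < m) {φ : Plane → ℝ}
    (hφ : ContDiff ℝ ∞ φ) :
    IsTest (box a b c d) fun p => cut a b n p.1 * (cut c d m p.2 * φ p) := by
  have hn' : (0 : ℝ) < 1 / n := by positivity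
  have hm' : (0 : ℝ) < 1 / m := by positivity
  refine isTest_of_eq_zero (K := Icc (a + 1 / n) (b - 1 / n) ×ˢ Icc (c + 1 / m) (d - 1 / m))
    ((smooth_fst (smooth_cut _ _ _)).mul ((smooth_snd (smooth_cut _ _ _)).mul hφ))
    (isCompact_Icc.prod isCompact_Icc) (prod_mono ?_ ?_) ?_
  · exact fun x hx => ⟨by linarith [hx.1], by linarith [hx.2]⟩
  · exact fun x hx => ⟨by linarith [hx.1], by linarith [hx.2]⟩
  · intro p hp
    rw [mem_prod, not_and_or] at hp
    rcases hp with h | h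
    · rw [cut_eq_zero hn h, zero_mul]
    · rw [cut_eq_zero hm h, zero_mul, mul_zero]

lemma dx_cut_mul {a b c d : ℝ} (n m : ℕ) {φ : Plane → ℝ} (hφ : ContDiff ℝ ∞ φ) (p : Plane) :
    dx (fun p => cut a b n p.1 * (cut c d m p.2 * φ p)) p =
      cut c d m p.2 * (deriv (cut a b n) p.1 * φ p + cut a b n p.1 * dx φ p) := by
  rw [dx_mul (smooth_fst (smooth_cut _ _ _)) ((smooth_snd (smooth_cut _ _ _)).mul hφ),
    dx_mul (smooth_snd (smooth_cut _ _ _)) hφ, dx_fst (smooth_cut _ _ _),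
    dx_snd (smooth_cut _ _ _)]
  ring

/-- A smooth function that vanishes on two vertical lines is bounded by the distance to them. -/
lemma exists_bound_dist {a b : ℝ} {φ : Plane → ℝ} (hφ : ContDiff ℝ ∞ φ) (c d : ℝ)
    (ha : ∀ y, φ (a, y) = 0) (hb : ∀ y, φ (b, y) = 0) :
    ∃ M, 0 ≤ M ∧ ∀ p ∈ box a b c d, |φ p| ≤ M * (p.1 - a) ∧ |φ p| ≤ M * (b - p.1) := by
  obtain ⟨M, hM0, hM⟩ := exists_bound_box (smooth_dx hφ).continuous a b c d
  refine ⟨M, hM0, ?_⟩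
  rintro ⟨x, y⟩ ⟨hx, hy⟩
  have key : ∀ u ∈ Icc a b, ∀ v ∈ Icc a b, |φ (v, y) - φ (u, y)| ≤ M * |v - u| := by
    intro u hu v hv
    exact (convex_Icc a b).norm_image_sub_le_of_norm_hasDerivWithin_le
      (f := fun s => φ (s, y)) (f' := fun s => dx φ (s, y))
      (fun s _ => (hasDerivAt_dx hφ s y).hasDerivWithinAt)
      (fun s hs => hM (s, y) ⟨hs, Ioo_subset_Icc_self hy⟩) hu hv
  have hab : a ≤ b := (hx.1.trans hx.2).le
  have hx' : x ∈ Icc a b := Ioo_subset_Icc_self hx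
  constructor
  · have := key a ⟨le_rfl, hab⟩ x hx'
    rwa [ha, sub_zero, abs_of_pos (sub_pos.2 hx.1)] at this
  · have := key b ⟨hab, le_rfl⟩ x hx'
    rwa [hb, sub_zero, abs_sub_comm, abs_of_pos (sub_pos.2 hx.2)] at this

/-- Cutting off a smooth function that vanishes on the vertical sides of a box keeps `∂ₓ` bounded:
near these sides the function is of the order of the distance, and the derivative of the cutoff of
the order of its inverse. -/
lemma exists_bound_dx_cut {a b c d : ℝ} {φ : Plane → ℝ} (hφ : ContDiff ℝ ∞ φ)
    (ha : ∀ y, φ (a, y) = 0) (hb : ∀ y, φ (b, y) = 0) :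
    ∃ B, 0 ≤ B ∧ ∀ (n : ℕ), ∀ p ∈ box a b c d,
      |dx (fun p => cut a b (n + 1) p.1 * (cut c d (n + 1) p.2 * φ p)) p| ≤ B := by
  obtain ⟨M, hM0, hM⟩ := exists_bound_dist hφ c d ha hb
  obtain ⟨N, hN0, hN⟩ := exists_bound_box (smooth_dx hφ).continuous a b c d
  obtain ⟨C, hC0, hC⟩ := exists_deriv_step_bound
  refine ⟨4 * M * C + N, by positivity, fun n p hp => ?_⟩
  rw [dx_cut_mul _ _ hφ, abs_mul]
  obtain ⟨h1, h2⟩ := hM p hp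
  have hx1 : 0 ≤ p.1 - a := by linarith [hp.1.1]
  have hx2 : 0 ≤ b - p.1 := by linarith [hp.1.2]
  have e1 : |deriv (step (n + 1)) (p.1 - a)| * |φ p| ≤ 2 * M * C := by
    have := abs_mul_deriv_step_le hC0 hC (n + 1) hx1
    calc _ ≤ |deriv (step (n + 1)) (p.1 - a)| * (M * (p.1 - a)) :=
          mul_le_mul_of_nonneg_left h1 (abs_nonneg _)
      _ = M * ((p.1 - a) * |deriv (step (n + 1)) (p.1 - a)|) := by ring
      _ ≤ M * (2 * C) := mul_le_mul_of_nonneg_left this hM0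
      _ = _ := by ring
  have e2 : |deriv (step (n + 1)) (b - p.1)| * |φ p| ≤ 2 * M * C := by
    have := abs_mul_deriv_step_le hC0 hC (n + 1) hx2
    calc _ ≤ |deriv (step (n + 1)) (b - p.1)| * (M * (b - p.1)) :=
          mul_le_mul_of_nonneg_left h2 (abs_nonneg _)
      _ = M * ((b - p.1) * |deriv (step (n + 1)) (b - p.1)|) := by ring
      _ ≤ M * (2 * C) := mul_le_mul_of_nonneg_left this hM0
      _ = _ := by ring
  have e3 : |deriv (cut a b (n + 1)) p.1 * φ p| ≤ 4 * M * C := by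
    rw [deriv_cut, abs_mul]
    have : |deriv (step (n + 1)) (p.1 - a) * step (n + 1) (b - p.1) -
        step (n + 1) (p.1 - a) * deriv (step (n + 1)) (b - p.1)| ≤
        |deriv (step (n + 1)) (p.1 - a)| + |deriv (step (n + 1)) (b - p.1)| := by
      refine (abs_sub _ _).trans (add_le_add ?_ ?_)
      · rw [abs_mul, abs_of_nonneg (step_nonneg _ (b - p.1))]
        exact mul_le_of_le_one_right (abs_nonneg _) (step_le_one _ _)
      · rw [abs_mul, abs_of_nonneg (step_nonneg _ (p.1 - a))]
        exact mul_le_of_le_one_left (abs_nonneg _) (step_le_one _ _)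
    calc _ ≤ (|deriv (step (n + 1)) (p.1 - a)| + |deriv (step (n + 1)) (b - p.1)|) * |φ p| :=
          mul_le_mul_of_nonneg_right this (abs_nonneg _)
      _ ≤ _ := by rw [add_mul]; linarith
  have e4 : |cut a b (n + 1) p.1 * dx φ p| ≤ N := by
    rw [abs_mul]
    exact (mul_le_of_le_one_left (abs_nonneg _) (abs_cut_le_one _ _ _ _)).trans
      (hN p (box_subset_Icc _ _ _ _ hp))
  calc _ ≤ |deriv (cut a b (n + 1)) p.1 * φ p + cut a b (n + 1) p.1 * dx φ p| :=
        mul_le_of_le_one_left (abs_nonneg _) (abs_cut_le_one _ _ _ _)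
    _ ≤ _ := (abs_add_le _ _).trans (add_le_add e3 e4)

lemma eventually_dx_cut {a b c d : ℝ} {φ : Plane → ℝ} (hφ : ContDiff ℝ ∞ φ) {p : Plane}
    (hp : p ∈ box a b c d) : ∀ᶠ n : ℕ in atTop,
      dx (fun p => cut a b (n + 1) p.1 * (cut c d (n + 1) p.2 * φ p)) p = dx φ p := by
  filter_upwards [(tendsto_add_atTop_nat 1).eventually (eventually_cut hp.1),
    (tendsto_add_atTop_nat 1).eventually (eventually_cut hp.2)] with n h1 h2
  rw [dx_cut_mul _ _ hφ, h1.1, h1.2, h2.1]; ring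

lemma tendsto_integral_dx_cut {a b c d : ℝ} {P φ : Plane → ℝ}
    (hP : Integrable P (volume.restrict (box a b c d))) (hφ : ContDiff ℝ ∞ φ)
    (ha : ∀ y, φ (a, y) = 0) (hb : ∀ y, φ (b, y) = 0) :
    Tendsto (fun n : ℕ => ∫ p in box a b c d,
      P p * dx (fun p => cut a b (n + 1) p.1 * (cut c d (n + 1) p.2 * φ p)) p) atTop
      (𝓝 (∫ p in box a b c d, P p * dx φ p)) := by
  obtain ⟨B, -, hB⟩ := exists_bound_dx_cut (c := c) (d := d) hφ ha hb
  refine tendsto_integral_mul hP (fun n => ?_) B (fun n => ?_) ?_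
  · exact (smooth_dx (isTest_cut_mul n.succ_pos n.succ_pos hφ).1).continuous.aestronglyMeasurable
  · exact (ae_restrict_mem (measurableSet_box a b c d)).mono (hB n)
  · exact (ae_restrict_mem (measurableSet_box a b c d)).mono fun p hp =>
      tendsto_const_nhds.congr' ((eventually_dx_cut hφ hp).mono fun n hn => hn.symm)

lemma tendsto_integral_cut {a b c d : ℝ} {P φ : Plane → ℝ}
    (hP : Integrable P (volume.restrict (box a b c d))) (hφ : ContDiff ℝ ∞ φ) :
    Tendsto (fun n : ℕ => ∫ p in box a b c d,
      P p * (cut a b (n + 1) p.1 * (cut c d (n + 1) p.2 * φ p))) atTop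
      (𝓝 (∫ p in box a b c d, P p * φ p)) := by
  obtain ⟨N, hN0, hN⟩ := exists_bound_box hφ.continuous a b c d
  refine tendsto_integral_mul hP (fun n => ?_) N (fun n => ?_) ?_
  · exact (isTest_cut_mul n.succ_pos n.succ_pos hφ).1.continuous.aestronglyMeasurable
  · filter_upwards [ae_restrict_mem (measurableSet_box a b c d)] with p hp
    rw [abs_mul, abs_mul]
    refine (mul_le_of_le_one_left (by positivity) (abs_cut_le_one _ _ _ _)).trans ?_
    exact (mul_le_of_le_one_left (by positivity) (abs_cut_le_one _ _ _ _)).trans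
        (hN p (box_subset_Icc _ _ _ _ hp))
  · filter_upwards [ae_restrict_mem (measurableSet_box a b c d)] with p hp
    refine tendsto_const_nhds.congr' ?_
    filter_upwards [(tendsto_add_atTop_nat 1).eventually (eventually_cut hp.1),
      (tendsto_add_atTop_nat 1).eventually (eventually_cut hp.2)] with n h1 h2
    rw [h1.1, h2.1]; ring

/-! ### Traces in one coordinate direction -/

/-- `v, w ∈ L²((a, b) × (c, d))`, `w` is the weak derivative `∂ₓv`, and `t` restricts to the
`L²` traces of `v` on the two vertical sides: integration by parts in `x` holds against every smooth
function, with boundary terms given by `t`. Traces on horizontal sides are handled by swapping the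
coordinates. -/
structure HasXTrace (a b c d : ℝ) (v w t : Plane → ℝ) : Prop where
  memLp : MemLp v 2 (volume.restrict (box a b c d))
  memLp_deriv : MemLp w 2 (volume.restrict (box a b c d))
  memLp_left : MemLp (fun y => t (a, y)) 2 (volume.restrict (Ioo c d))
  memLp_right : MemLp (fun y => t (b, y)) 2 (volume.restrict (Ioo c d))
  ibp : ∀ φ : Plane → ℝ, ContDiff ℝ ∞ φ → ∫ p in box a b c d, (v p * dx φ p + w p * φ p) =
    (∫ y in Ioo c d, t (b, y) * φ (b, y)) - ∫ y in Ioo c d, t (a, y) * φ (a, y)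

lemma memLp_bdd_mul {α : Type*} [MeasurableSpace α] {μ : Measure α} {v g : α → ℝ}
    (hv : MemLp v 2 μ) (hg : AEStronglyMeasurable g μ) {B : ℝ} (hB : ∀ᵐ x ∂μ, |g x| ≤ B) :
    MemLp (fun x => g x * v x) 2 μ := by
  refine hv.of_le_mul (c := B) (hg.mul hv.aestronglyMeasurable) ?_
  filter_upwards [hB] with x hx
  rw [norm_mul]
  exact mul_le_mul_of_nonneg_right hx (norm_nonneg _)

lemma memLp_continuous_mul {v φ : Plane → ℝ} {a b c d : ℝ}
    (hv : MemLp v 2 (volume.restrict (box a b c d))) (h : Continuous φ) :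
    MemLp (fun p => φ p * v p) 2 (volume.restrict (box a b c d)) := by
  obtain ⟨M, -, hM⟩ := exists_bound_box h a b c d
  refine memLp_bdd_mul hv h.aestronglyMeasurable (B := M) ?_
  filter_upwards [ae_restrict_mem (measurableSet_box a b c d)] with p hp
  exact hM p (box_subset_Icc _ _ _ _ hp)

lemma memLp_comp_snd {g : ℝ → ℝ} {c d : ℝ} (hg : MemLp g 2 (volume.restrict (Ioo c d)))
    (a b : ℝ) : MemLp (fun p : Plane => g p.2) 2 (volume.restrict (box a b c d)) := by
  rw [restrict_box]
  exact hg.comp_snd _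

lemma integral_box_symm {F : Plane → ℝ} {a b c d : ℝ}
    (hF : Integrable F (volume.restrict (box a b c d))) :
    ∫ p in box a b c d, F p = ∫ y in Ioo c d, ∫ x in Ioo a b, F (x, y) := by
  rw [restrict_box] at hF ⊢
  exact integral_prod_symm F hF

lemma integral_Ioo_mul_deriv {a b : ℝ} (hab : a ≤ b) {g g' : ℝ → ℝ}
    (h : ∀ x, HasDerivAt g (g' x) x) (hc : Continuous g') :
    ∫ x in Ioo a b, g' x = g b - g a := by
  rw [← integral_Ioc_eq_integral_Ioo, ← intervalIntegral.integral_of_le hab]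
  exact intervalIntegral.integral_eq_sub_of_hasDerivAt (fun x _ => h x)
    (hc.intervalIntegrable _ _)

/-- The integrals of a square-integrable function along horizontal lines are square-integrable. -/
lemma memLp_integral_fst {h : Plane → ℝ} {a b c d : ℝ} (hab : a < b)
    (hh : MemLp h 2 (volume.restrict (box a b c d))) :
    MemLp (fun y => ∫ x in Ioo a b, h (x, y)) 2 (volume.restrict (Ioo c d)) := by
  have hi : Integrable h (volume.restrict (box a b c d)) := hh.integrable (by norm_num)
  have hsq : Integrable (fun p => h p ^ 2) (volume.restrict (box a b c d)) := hh.integrable_sq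
  have hmeas := hh.aestronglyMeasurable
  rw [restrict_box] at hi hsq hmeas
  have hI := hi.integral_prod_right
  rw [memLp_two_iff_integrable_sq hI.aestronglyMeasurable]
  refine (hsq.integral_prod_right.const_mul (b - a)).mono' (hI.aestronglyMeasurable.pow 2) ?_
  filter_upwards [hi.prod_left_ae, hsq.prod_left_ae] with y h1 h2
  rw [Real.norm_eq_abs, abs_of_nonneg (sq_nonneg _)]
  set I := ∫ x in Ioo a b, h (x, y)
  have hL : 0 < b - a := sub_pos.2 hab
  -- the variance of `h (·, y)` is nonnegative
  have h0 : 0 ≤ ∫ x in Ioo a b, (h (x, y) - I / (b - a)) ^ 2 :=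
    integral_nonneg fun x => sq_nonneg _
  have h3 : ∫ x in Ioo a b, (h (x, y) - I / (b - a)) ^ 2 =
      (∫ x in Ioo a b, h (x, y) ^ 2) - I ^ 2 / (b - a) := by
    have : ∀ x, (h (x, y) - I / (b - a)) ^ 2 =
        (h (x, y) ^ 2 - 2 * (I / (b - a)) * h (x, y)) + (I / (b - a)) ^ 2 := fun x => by ring
    have i1 : Integrable (fun x => 2 * (I / (b - a)) * h (x, y)) (volume.restrict (Ioo a b)) :=
      h1.const_mul _
    have i2 : Integrable (fun x => h (x, y) ^ 2 - 2 * (I / (b - a)) * h (x, y))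
      (volume.restrict (Ioo a b)) := h2.sub i1
    simp_rw [this]
    rw [integral_add i2 (integrable_const _), integral_sub h2 i1, integral_const_mul,
      integral_const]
    simp only [MeasurableSet.univ, measureReal_restrict_apply, univ_inter, Real.volume_real_Ioo,
      max_eq_left hL.le, smul_eq_mul]
    change _ - 2 * (I / (b - a)) * I + _ = _
    field_simp
    ring
  rw [h3, sub_nonneg, div_le_iff₀ hL] at h0
  linarith

lemma integrable_mul_snd {h : Plane → ℝ} {η : ℝ → ℝ} {a b c d : ℝ}
    (hh : MemLp h 2 (volume.restrict (box a b c d))) (hη : Continuous η) :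
    Integrable (fun p => h p * η p.2) (volume.restrict (box a b c d)) :=
  integrable_mul_continuous hh (hη.comp continuous_snd)

lemma integrable_mul_dx_add {v w φ : Plane → ℝ} {a b c d : ℝ}
    (hv : MemLp v 2 (volume.restrict (box a b c d)))
    (hw : MemLp w 2 (volume.restrict (box a b c d))) (hφ : ContDiff ℝ ∞ φ) :
    Integrable (fun p => v p * dx φ p + w p * φ p) (volume.restrict (box a b c d)) :=
  (integrable_mul_continuous hv (smooth_dx hφ).continuous).add
    (integrable_mul_continuous hw hφ.continuous)

lemma integral_box_mul_snd {h : Plane → ℝ} {η : ℝ → ℝ} {a b c d : ℝ}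
    (hh : MemLp h 2 (volume.restrict (box a b c d))) (hη : Continuous η) :
    ∫ p in box a b c d, h p * η p.2 = ∫ y in Ioo c d, (∫ x in Ioo a b, h (x, y)) * η y := by
  rw [integral_box_symm (integrable_mul_snd hh hη)]
  simp_rw [integral_mul_const]

/-- A square-integrable function on an interval that is orthogonal to all smooth functions is
zero. -/
lemma ae_eq_zero_Ioo {h : ℝ → ℝ} {c d : ℝ} (hh : MemLp h 2 (volume.restrict (Ioo c d)))
    (H : ∀ η : ℝ → ℝ, ContDiff ℝ ∞ η → ∫ y in Ioo c d, h y * η y = 0) :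
    h =ᵐ[volume.restrict (Ioo c d)] 0 := by
  have hi : IntegrableOn h (Ioo c d) := hh.integrable (by norm_num)
  have := isOpen_Ioo.ae_eq_zero_of_integral_contDiff_smul_eq_zero (U := Ioo c d)
    hi.locallyIntegrableOn ?_
  · exact (ae_restrict_iff' measurableSet_Ioo).2 this
  · intro η hη _ hs
    rw [← H η hη, ← setIntegral_eq_integral_of_forall_compl_eq_zero (s := Ioo c d)]
    · simp_rw [smul_eq_mul, mul_comm]
    · intro y hy
      rw [image_eq_zero_of_notMem_tsupport fun h => hy (hs h), zero_smul]

lemma ae_eq_zero_box {h : Plane → ℝ} {a b c d : ℝ} (hh : MemLp h 2 (volume.restrict (box a b c d)))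
    (H : ∀ φ : Plane → ℝ, IsTest (box a b c d) φ → ∫ p in box a b c d, h p * φ p = 0) :
    h =ᵐ[volume.restrict (box a b c d)] 0 := by
  have hi : IntegrableOn h (box a b c d) := hh.integrable (by norm_num)
  have := (isOpen_box a b c d).ae_eq_zero_of_integral_contDiff_smul_eq_zero
    hi.locallyIntegrableOn ?_
  · exact (ae_restrict_iff' (measurableSet_box a b c d)).2 this
  · intro η hη hc hs
    rw [← H η ⟨hη, hc, hs⟩, ← setIntegral_eq_integral_of_forall_compl_eq_zero (s := box a b c d)]
    · simp_rw [smul_eq_mul, mul_comm]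
    · intro y hy
      rw [image_eq_zero_of_notMem_tsupport fun h => hy (hs h), zero_smul]

lemma IsTest.eq_zero {U : Set Plane} {φ : Plane → ℝ} (h : IsTest U φ) {p : Plane} (hp : p ∉ U) :
    φ p = 0 :=
  image_eq_zero_of_notMem_tsupport fun h' => hp (h.2.2 h')

namespace HasXTrace

variable {a b c d : ℝ} {v w t v' w' t' : Plane → ℝ}

lemma isWeakPartial (h : HasXTrace a b c d v w t) : IsWeakPartial (box a b c d) (1, 0) v w := by
  intro φ hφ
  have h1 := h.ibp φ hφ.1
  have hl : ∀ y, φ (a, y) = 0 := fun y => hφ.eq_zero fun hp => lt_irrefl _ hp.1.1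
  have hr : ∀ y, φ (b, y) = 0 := fun y => hφ.eq_zero fun hp => lt_irrefl _ hp.1.2
  simp only [hl, hr, mul_zero, integral_zero, sub_zero] at h1
  rw [integral_add (integrable_mul_continuous h.memLp (smooth_dx hφ.1).continuous)
    (integrable_mul_continuous h.memLp_deriv hφ.1.continuous)] at h1
  exact eq_neg_of_add_eq_zero_left h1

lemma congr (h : HasXTrace a b c d v w t) (hv : v =ᵐ[volume.restrict (box a b c d)] v')
    (hw : w =ᵐ[volume.restrict (box a b c d)] w')
    (hl : ∀ᵐ y ∂(volume.restrict (Ioo c d)), t (a, y) = t' (a, y))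
    (hr : ∀ᵐ y ∂(volume.restrict (Ioo c d)), t (b, y) = t' (b, y)) :
    HasXTrace a b c d v' w' t' where
  memLp := h.memLp.ae_eq hv
  memLp_deriv := h.memLp_deriv.ae_eq hw
  memLp_left := h.memLp_left.ae_eq hl
  memLp_right := h.memLp_right.ae_eq hr
  ibp φ hφ := by
    have e1 : ∫ p in box a b c d, (v' p * dx φ p + w' p * φ p) =
        ∫ p in box a b c d, (v p * dx φ p + w p * φ p) :=
      integral_congr_ae (by filter_upwards [hv, hw] with p h1 h2; rw [h1, h2])
    have e2 : ∫ y in Ioo c d, t' (b, y) * φ (b, y) = ∫ y in Ioo c d, t (b, y) * φ (b, y) :=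
      integral_congr_ae (by filter_upwards [hr] with p h1; rw [h1])
    have e3 : ∫ y in Ioo c d, t' (a, y) * φ (a, y) = ∫ y in Ioo c d, t (a, y) * φ (a, y) :=
      integral_congr_ae (by filter_upwards [hl] with p h1; rw [h1])
    rw [e1, e2, e3, h.ibp φ hφ]

lemma const_mul (h : HasXTrace a b c d v w t) (k : ℝ) :
    HasXTrace a b c d (fun p => k * v p) (fun p => k * w p) (fun p => k * t p) where
  memLp := h.memLp.const_mul k
  memLp_deriv := h.memLp_deriv.const_mul k
  memLp_left := h.memLp_left.const_mul k
  memLp_right := h.memLp_right.const_mul k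
  ibp φ hφ := by
    simp_rw [mul_assoc, ← mul_add, integral_const_mul, h.ibp φ hφ, mul_sub]

lemma add (h : HasXTrace a b c d v w t) (h' : HasXTrace a b c d v' w' t') :
    HasXTrace a b c d (fun p => v p + v' p) (fun p => w p + w' p) (fun p => t p + t' p) where
  memLp := h.memLp.add h'.memLp
  memLp_deriv := h.memLp_deriv.add h'.memLp_deriv
  memLp_left := h.memLp_left.add h'.memLp_left
  memLp_right := h.memLp_right.add h'.memLp_right
  ibp φ hφ := by
    have hc : ∀ x, Continuous fun y => φ (x, y) := fun x =>
      hφ.continuous.comp (continuous_const.prodMk continuous_id)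
    have i1 := integrable_mul_dx_add h.memLp h.memLp_deriv hφ
    have i2 := integrable_mul_dx_add h'.memLp h'.memLp_deriv hφ
    have e1 : ∫ p in box a b c d, ((v p + v' p) * dx φ p + (w p + w' p) * φ p) =
        (∫ p in box a b c d, (v p * dx φ p + w p * φ p)) +
        ∫ p in box a b c d, (v' p * dx φ p + w' p * φ p) := by
      rw [← integral_add i1 i2]
      congr 1; ext p; ring
    simp only [add_mul] at e1 ⊢
    rw [e1, h.ibp φ hφ, h'.ibp φ hφ,
      integral_add (integrable_mul_of_memLp h.memLp_right (memLp_Ioo_of_continuous (hc b) c d))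
        (integrable_mul_of_memLp h'.memLp_right (memLp_Ioo_of_continuous (hc b) c d)),
      integral_add (integrable_mul_of_memLp h.memLp_left (memLp_Ioo_of_continuous (hc a) c d))
        (integrable_mul_of_memLp h'.memLp_left (memLp_Ioo_of_continuous (hc a) c d))]
    ring

lemma sub (h : HasXTrace a b c d v w t) (h' : HasXTrace a b c d v' w' t') :
    HasXTrace a b c d (fun p => v p - v' p) (fun p => w p - w' p) (fun p => t p - t' p) := by
  have := h.add (h'.const_mul (-1))
  simpa only [neg_mul, one_mul, ← sub_eq_add_neg] using this

/-- Boundary terms that cancel for all smooth functions are zero: testing with `(x - a) η(y)` and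
`(x - b) η(y)` isolates the two sides. -/
lemma trace_eq_zero (hab : a < b) {l r : ℝ → ℝ} (hl : MemLp l 2 (volume.restrict (Ioo c d)))
    (hr : MemLp r 2 (volume.restrict (Ioo c d)))
    (H : ∀ φ : Plane → ℝ, ContDiff ℝ ∞ φ →
      (∫ y in Ioo c d, r y * φ (b, y)) - ∫ y in Ioo c d, l y * φ (a, y) = 0) :
    l =ᵐ[volume.restrict (Ioo c d)] 0 ∧ r =ᵐ[volume.restrict (Ioo c d)] 0 := by
  have hpoly : ∀ (z : ℝ) (η : ℝ → ℝ), ContDiff ℝ ∞ η →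
      ContDiff ℝ ∞ fun p : Plane => (p.1 - z) * η p.2 := fun z η hη =>
    (contDiff_fst.sub contDiff_const).mul (smooth_snd hη)
  constructor
  · refine ae_eq_zero_Ioo hl fun η hη => ?_
    have := H _ (hpoly b η hη)
    simp only [sub_self, zero_mul, mul_zero, integral_zero, zero_sub, neg_eq_zero] at this
    simp only [mul_left_comm _ (_ - _), integral_const_mul] at this
    exact (mul_eq_zero.1 this).resolve_left (sub_ne_zero.2 hab.ne)
  · refine ae_eq_zero_Ioo hr fun η hη => ?_
    have := H _ (hpoly a η hη)
    simp only [sub_self, zero_mul, mul_zero, integral_zero, sub_zero] at this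
    simp only [mul_left_comm _ (_ - _), integral_const_mul] at this
    exact (mul_eq_zero.1 this).resolve_left (sub_ne_zero.2 hab.ne')

/-- The weak derivative and the traces are determined by the class of the function. -/
lemma unique_zero (hab : a < b) (h : HasXTrace a b c d v w t)
    (hv : v =ᵐ[volume.restrict (box a b c d)] 0) :
    w =ᵐ[volume.restrict (box a b c d)] 0 ∧
    (∀ᵐ y ∂(volume.restrict (Ioo c d)), t (a, y) = 0) ∧
    ∀ᵐ y ∂(volume.restrict (Ioo c d)), t (b, y) = 0 := by
  have hw : w =ᵐ[volume.restrict (box a b c d)] 0 := by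
    refine ae_eq_zero_box h.memLp_deriv fun φ hφ => ?_
    rw [← neg_eq_zero, ← h.isWeakPartial φ hφ]
    refine integral_eq_zero_of_ae ?_
    filter_upwards [hv] with p hp
    rw [hp]; simp
  refine ⟨hw, trace_eq_zero hab h.memLp_left h.memLp_right fun φ hφ => ?_⟩
  rw [← h.ibp φ hφ]
  refine integral_eq_zero_of_ae ?_
  filter_upwards [hv, hw] with p hp hp'
  rw [hp, hp']; simp

lemma unique (hab : a < b) (h : HasXTrace a b c d v w t) (h' : HasXTrace a b c d v' w' t')
    (hv : v =ᵐ[volume.restrict (box a b c d)] v') :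
    w =ᵐ[volume.restrict (box a b c d)] w' ∧
    (∀ᵐ y ∂(volume.restrict (Ioo c d)), t (a, y) = t' (a, y)) ∧
    ∀ᵐ y ∂(volume.restrict (Ioo c d)), t (b, y) = t' (b, y) := by
  obtain ⟨h1, h2, h3⟩ := (h.sub h').unique_zero hab
    (by filter_upwards [hv] with p hp; simp [hp])
  refine ⟨?_, ?_, ?_⟩
  · filter_upwards [h1] with p hp using sub_eq_zero.1 hp
  · filter_upwards [h2] with p hp using sub_eq_zero.1 hp
  · filter_upwards [h3] with p hp using sub_eq_zero.1 hp

end HasXTrace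

/-- A weak derivative in `x` integrates by parts against smooth functions that vanish on the
vertical sides only. -/
lemma integral_eq_zero_of_isWeakPartial {a b c d : ℝ} {v w φ : Plane → ℝ}
    (hv : MemLp v 2 (volume.restrict (box a b c d)))
    (hw : MemLp w 2 (volume.restrict (box a b c d)))
    (h : IsWeakPartial (box a b c d) (1, 0) v w) (hφ : ContDiff ℝ ∞ φ)
    (ha : ∀ y, φ (a, y) = 0) (hb : ∀ y, φ (b, y) = 0) :
    ∫ p in box a b c d, (v p * dx φ p + w p * φ p) = 0 := by
  have h1 := (tendsto_integral_dx_cut (hv.integrable (by norm_num)) hφ ha hb).add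
    (tendsto_integral_cut (hw.integrable (by norm_num)) hφ)
  rw [← integral_add (integrable_mul_continuous hv (smooth_dx hφ).continuous)
    (integrable_mul_continuous hw hφ.continuous)] at h1
  refine tendsto_nhds_unique h1 (tendsto_const_nhds.congr fun n => ?_)
  exact (eq_neg_iff_add_eq_zero.1 (h _ (isTest_cut_mul n.succ_pos n.succ_pos hφ))).symm

/-- Trace theorem on a box: with `ℓ(x) = (x - a) / (b - a)`, the trace on the right side is
`∫ (v ℓ' + ∂ₓv ℓ) dx`, and similarly on the left side. -/
lemma exists_hasXTrace {a b c d : ℝ} (hab : a < b) {v w : Plane → ℝ}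
    (hv : MemLp v 2 (volume.restrict (box a b c d)))
    (hw : MemLp w 2 (volume.restrict (box a b c d)))
    (h : IsWeakPartial (box a b c d) (1, 0) v w) : ∃ t, HasXTrace a b c d v w t := by
  set k := (b - a)⁻¹ with hk
  have hne : b - a ≠ 0 := (sub_pos.2 hab).ne'
  let ℓ : ℝ → ℝ := fun x => k * (x - a)
  have hℓ : ContDiff ℝ ∞ ℓ := contDiff_const.mul (contDiff_id.sub contDiff_const)
  have hℓ' : ∀ x, deriv ℓ x = k := fun x => by simp [ℓ]
  have hR : MemLp (fun p : Plane => k * v p + ℓ p.1 * w p) 2 (volume.restrict (box a b c d)) :=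
    (hv.const_mul k).add (memLp_continuous_mul hw (smooth_fst hℓ).continuous)
  have hL : MemLp (fun p : Plane => k * v p + (ℓ p.1 - 1) * w p) 2
      (volume.restrict (box a b c d)) :=
    (hv.const_mul k).add (memLp_continuous_mul hw
      ((smooth_fst hℓ).continuous.sub continuous_const))
  let r : ℝ → ℝ := fun y => ∫ x in Ioo a b, (k * v (x, y) + ℓ x * w (x, y))
  let l : ℝ → ℝ := fun y => ∫ x in Ioo a b, (k * v (x, y) + (ℓ x - 1) * w (x, y))
  have hr : MemLp r 2 (volume.restrict (Ioo c d)) := memLp_integral_fst hab hR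
  have hl : MemLp l 2 (volume.restrict (Ioo c d)) := memLp_integral_fst hab hL
  refine ⟨fun p => if p.1 = a then l p.2 else r p.2, hv, hw, by simpa using hl,
    by simpa [hab.ne'] using hr, fun φ hφ => ?_⟩
  simp only [if_true, hab.ne', if_false]
  have hφs : ∀ x, ContDiff ℝ ∞ fun y => φ (x, y) := fun x =>
    hφ.comp (contDiff_const.prodMk contDiff_id)
  have s1 : ContDiff ℝ ∞ fun p : Plane => ℓ p.1 * φ (b, p.2) :=
    (smooth_fst hℓ).mul (smooth_snd (hφs b))
  have s2 : ContDiff ℝ ∞ fun p : Plane => (ℓ p.1 - 1) * φ (a, p.2) :=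
    ((smooth_fst hℓ).sub contDiff_const).mul (smooth_snd (hφs a))
  have s3 : ContDiff ℝ ∞ fun p : Plane => φ p - ℓ p.1 * φ (b, p.2) := hφ.sub s1
  have d1 : ∀ p, dx (fun p : Plane => φ p - ℓ p.1 * φ (b, p.2) + (ℓ p.1 - 1) * φ (a, p.2)) p =
      dx φ p - k * φ (b, p.2) + k * φ (a, p.2) := by
    intro p
    have e2 : dx (fun p : Plane => ℓ p.1 - 1) p = k := by
      rw [dx_fst (χ := fun x => ℓ x - 1) (hℓ.sub contDiff_const), deriv_sub_const, hℓ']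
    rw [dx_add s3 s2, dx_sub hφ s1, dx_mul (smooth_fst hℓ) (smooth_snd (hφs b)),
      dx_mul ((smooth_fst hℓ).sub contDiff_const) (smooth_snd (hφs a)), dx_fst hℓ, e2,
      dx_snd (hφs a), dx_snd (hφs b), hℓ']
    ring
  have key := integral_eq_zero_of_isWeakPartial hv hw h (s3.add s2) (by simp [ℓ])
    (by intro y; simp only [ℓ, hk]; rw [inv_mul_cancel₀ hne]; ring)
  have eR := integral_box_mul_snd hR (hφs b).continuous
  have eL := integral_box_mul_snd hL (hφs a).continuous
  change _ = ∫ y in Ioo c d, r y * φ (b, y) at eR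
  change _ = ∫ y in Ioo c d, l y * φ (a, y) at eL
  rw [← eR, ← eL, ← sub_eq_zero, ← key]
  have i0 := integrable_mul_dx_add hv hw hφ
  have iR := integrable_mul_snd hR (hφs b).continuous
  have iL := integrable_mul_snd hL (hφs a).continuous
  rw [← integral_sub iR iL]
  refine (integral_sub i0 (iR.sub iL)).symm.trans ?_
  refine integral_congr_ae (Eventually.of_forall fun p => ?_)
  simp only [d1, Pi.sub_apply]
  ring

/-- A product `α(x) g(y)` with `α` smooth has its own boundary values as traces. -/
lemma hasXTrace_mul {a b c d : ℝ} (hab : a ≤ b) {α g : ℝ → ℝ} (hα : ContDiff ℝ ∞ α)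
    (hg : MemLp g 2 (volume.restrict (Ioo c d))) :
    HasXTrace a b c d (fun p => α p.1 * g p.2) (fun p => deriv α p.1 * g p.2)
      (fun p => α p.1 * g p.2) where
  memLp := memLp_continuous_mul (memLp_comp_snd hg a b) (smooth_fst hα).continuous
  memLp_deriv := memLp_continuous_mul (memLp_comp_snd hg a b)
    ((hα.continuous_deriv (by simp)).comp continuous_fst)
  memLp_left := hg.const_mul (α a)
  memLp_right := hg.const_mul (α b)
  ibp φ hφ := by
    have hα' : ContDiff ℝ ∞ (deriv α) := hα.deriv'
    have hc : ∀ x, Continuous fun y => φ (x, y) := fun x =>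
      hφ.continuous.comp (continuous_const.prodMk continuous_id)
    have hG := memLp_comp_snd hg a b
    have e : ∀ p : Plane, α p.1 * g p.2 * dx φ p + deriv α p.1 * g p.2 * φ p =
        g p.2 * (deriv α p.1 * φ p + α p.1 * dx φ p) := fun p => by ring
    have hcont : Continuous fun p : Plane => deriv α p.1 * φ p + α p.1 * dx φ p :=
      ((smooth_fst hα').continuous.mul hφ.continuous).add
        ((smooth_fst hα).continuous.mul (smooth_dx hφ).continuous)
    simp_rw [e]
    rw [integral_box_symm (integrable_mul_continuous hG hcont),
      ← integral_sub (integrable_mul_of_memLp (hg.const_mul _) (memLp_Ioo_of_continuous (hc b) c d))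
        (integrable_mul_of_memLp (hg.const_mul _) (memLp_Ioo_of_continuous (hc a) c d))]
    refine integral_congr_ae (Eventually.of_forall fun y => ?_)
    simp only
    rw [integral_const_mul, integral_Ioo_mul_deriv hab (g := fun x => α x * φ (x, y))]
    · ring
    · exact fun x => ((hα.differentiable (by simp) x).hasDerivAt).mul (hasDerivAt_dx hφ x y)
    · exact hcont.comp (continuous_id.prodMk continuous_const)

namespace HasXTrace

variable {a b c d : ℝ} {v w t v' w' t' : Plane → ℝ}

/-- Reflection in the vertical axis. -/
lemma reflX (h : HasXTrace a b c d v w t) : HasXTrace (-b) (-a) c d (v ∘ refl (-1) 1)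
    (fun p => -w (refl (-1) 1 p)) (t ∘ refl (-1) 1) := by
  have hs : (-1 : ℝ) * -1 = 1 := by norm_num
  have ht : (1 : ℝ) * 1 = 1 := by norm_num
  have hbox : box (-b) (-a) c d = refl (-1) 1 ⁻¹' box a b c d := by
    ext p; simp only [mem_prod, mem_Ioo, refl, mem_preimage]
    constructor <;> rintro ⟨⟨h1, h2⟩, h3, h4⟩ <;> refine ⟨⟨?_, ?_⟩, ?_, ?_⟩ <;> linarith
  have hmp := measurePreserving_refl_restrict hs ht (box a b c d)
  rw [← hbox] at hmp
  refine ⟨h.memLp.comp_measurePreserving hmp, (h.memLp_deriv.comp_measurePreserving hmp).neg,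
    by simpa [refl, Function.comp_def] using h.memLp_right,
    by simpa [refl, Function.comp_def] using h.memLp_left, fun φ hφ => ?_⟩
  have h1 := h.ibp _ (smooth_refl hφ (-1) 1)
  rw [← setIntegral_refl hs ht, ← hbox] at h1
  simp only [dx_refl hφ, refl_refl hs ht, Function.comp_apply] at h1
  have e : ∀ p, v (refl (-1) 1 p) * dx φ p + -w (refl (-1) 1 p) * φ p =
      -(v (refl (-1) 1 p) * (-1 * dx φ p) + w (refl (-1) 1 p) * φ p) := fun p => by ring
  simp only [Function.comp_apply, e]
  rw [integral_neg, h1]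
  simp [refl]

/-- Reflection in the horizontal axis. -/
lemma reflY (h : HasXTrace a b c d v w t) : HasXTrace a b (-d) (-c) (v ∘ refl 1 (-1))
    (w ∘ refl 1 (-1)) (t ∘ refl 1 (-1)) := by
  have hs : (-1 : ℝ) * -1 = 1 := by norm_num
  have ht : (1 : ℝ) * 1 = 1 := by norm_num
  have hbox : box a b (-d) (-c) = refl 1 (-1) ⁻¹' box a b c d := by
    ext p; simp only [mem_prod, mem_Ioo, refl, mem_preimage]
    constructor <;> rintro ⟨⟨h1, h2⟩, h3, h4⟩ <;> refine ⟨⟨?_, ?_⟩, ?_, ?_⟩ <;> linarith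
  have hIoo : Ioo (-d) (-c) = Neg.neg ⁻¹' Ioo c d := by
    ext p; simp only [mem_Ioo, mem_preimage]
    constructor <;> rintro ⟨h1, h2⟩ <;> constructor <;> linarith
  have hneg := Measure.measurePreserving_neg (volume : Measure ℝ)
  have hmp := measurePreserving_refl_restrict ht hs (box a b c d)
  have hmp1 := hneg.restrict_preimage_emb (MeasurableEquiv.neg ℝ).measurableEmbedding (Ioo c d)
  rw [← hbox] at hmp
  rw [← hIoo] at hmp1
  have hint : ∀ F : ℝ → ℝ, ∫ y in Ioo (-d) (-c), F (-y) = ∫ y in Ioo c d, F y := fun F => by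
    rw [hIoo]
    exact hneg.setIntegral_preimage_emb (MeasurableEquiv.neg ℝ).measurableEmbedding F _
  refine ⟨h.memLp.comp_measurePreserving hmp, h.memLp_deriv.comp_measurePreserving hmp,
    ?_, ?_, fun φ hφ => ?_⟩
  · simpa [refl, Function.comp_def] using h.memLp_left.comp_measurePreserving hmp1
  · simpa [refl, Function.comp_def] using h.memLp_right.comp_measurePreserving hmp1
  have h1 := h.ibp _ (smooth_refl hφ 1 (-1))
  rw [← setIntegral_refl ht hs, ← hbox] at h1
  simp only [dx_refl hφ, refl_refl ht hs, Function.comp_apply, one_mul] at h1 ⊢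
  rw [h1, ← hint, ← hint fun y => t (a, y) * _]
  simp [refl]

/-- A trace restricts to shorter vertical sides. -/
lemma mono_snd (h : HasXTrace a b c d v w t) {c' d' : ℝ} (hc : c ≤ c') (hd : d' ≤ d) :
    HasXTrace a b c' d' v w t := by
  have hI : Ioo c' d' ⊆ Ioo c d := Ioo_subset_Ioo hc hd
  have hB : box a b c' d' ⊆ box a b c d := prod_mono subset_rfl hI
  have hle : (volume : Measure ℝ).restrict (Ioo c' d') ≤ volume.restrict (Ioo c d) :=
    Measure.restrict_mono hI le_rfl
  have hleB : (volume : Measure Plane).restrict (box a b c' d') ≤ volume.restrict (box a b c d) :=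
    Measure.restrict_mono hB le_rfl
  refine ⟨h.memLp.mono_measure hleB, h.memLp_deriv.mono_measure hleB,
    h.memLp_left.mono_measure hle, h.memLp_right.mono_measure hle, fun φ hφ => ?_⟩
  have hφc : ∀ x, Continuous fun y => φ (x, y) := fun x =>
      hφ.continuous.comp (continuous_const.prodMk continuous_id)
  -- test with `ρ n (y) φ` where `ρ n` are cutoffs of the shorter side
  let ρ : ℕ → ℝ → ℝ := fun n => cut c' d' (n + 1)
  have hρ0 : ∀ n y, y ∉ Ioo c' d' → ρ n y = 0 := fun n y hy => cut_eq_zero n.succ_pos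
    fun hy' => hy ⟨by have : (0 : ℝ) < 1 / ((n + 1 : ℕ) : ℝ) := by positivity
                      linarith [hy'.1],
                   by have : (0 : ℝ) < 1 / ((n + 1 : ℕ) : ℝ) := by positivity
                      linarith [hy'.2]⟩
  have hρ1 : ∀ y ∈ Ioo c' d', Tendsto (fun n => ρ n y) atTop (𝓝 1) := fun y hy =>
    tendsto_const_nhds.congr' (((tendsto_add_atTop_nat 1).eventually (eventually_cut hy)).mono
      fun n hn => hn.1.symm)
  have hedge : ∀ x, MemLp (fun y => t (x, y)) 2 (volume.restrict (Ioo c' d')) →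
      Tendsto (fun n => ∫ y in Ioo c d, t (x, y) * (ρ n y * φ (x, y))) atTop
        (𝓝 (∫ y in Ioo c' d', t (x, y) * φ (x, y))) := by
    intro x hx
    have h1 := tendsto_integral_mul (integrable_mul_of_memLp hx
      (memLp_Ioo_of_continuous (hφc x) c' d')) (F := ρ) (f := fun _ => 1)
      (fun n => (smooth_cut _ _ _).continuous.aestronglyMeasurable) 1
      (fun n => Eventually.of_forall fun y => abs_cut_le_one _ _ _ _)
      ((ae_restrict_mem measurableSet_Ioo).mono hρ1)
    simp only [mul_one] at h1
    refine h1.congr fun n => ?_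
    rw [setIntegral_eq_of_subset_of_forall_sdiff_eq_zero measurableSet_Ioo hI]
    · congr 1; ext y; ring
    · intro y hy; rw [hρ0 n y hy.2]; ring
  have hi := integrable_mul_dx_add (h.memLp.mono_measure hleB) (h.memLp_deriv.mono_measure hleB) hφ
  have hin := tendsto_integral_mul hi (F := fun n p => ρ n p.2) (f := fun _ => 1)
      (fun n => (smooth_snd (smooth_cut _ _ _)).continuous.aestronglyMeasurable) 1
      (fun n => Eventually.of_forall fun y => abs_cut_le_one _ _ _ _)
      ((ae_restrict_mem (measurableSet_box _ _ _ _)).mono fun p hp => hρ1 p.2 hp.2)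
  simp only [mul_one] at hin
  refine tendsto_nhds_unique hin (((hedge b (h.memLp_right.mono_measure hle)).sub
    (hedge a (h.memLp_left.mono_measure hle))).congr fun n => ?_)
  have hs := smooth_snd (smooth_cut c' d' (n + 1))
  have := h.ibp _ (hs.mul hφ)
  refine this.symm.trans ?_
  rw [← setIntegral_eq_of_subset_of_forall_sdiff_eq_zero (measurableSet_box a b c d) hB]
  · congr 1; ext p
    rw [dx_mul hs hφ, dx_snd (smooth_cut _ _ _)]
    simp only [ρ]
    ring
  · intro p hp
    have : p.2 ∉ Ioo c' d' := fun h' => hp.2 ⟨hp.1.1, h'⟩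
    rw [hρ0 n _ this, mul_zero]

end HasXTrace

lemma IsWeakPartial.mono {U V : Set Plane} {e : Plane} {v w : Plane → ℝ}
    (h : IsWeakPartial V e v w) (hV : MeasurableSet V) (hUV : U ⊆ V) : IsWeakPartial U e v w := by
  intro φ hφ
  have := h φ ⟨hφ.1, hφ.2.1, hφ.2.2.trans hUV⟩
  rw [setIntegral_eq_of_subset_of_forall_sdiff_eq_zero hV hUV,
    setIntegral_eq_of_subset_of_forall_sdiff_eq_zero hV hUV] at this
  · exact this
  · intro p hp; rw [hφ.eq_zero hp.2, mul_zero]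
  · intro p hp
    rw [image_eq_zero_of_notMem_tsupport (f := fun p => fderiv ℝ φ p e), mul_zero]
    exact fun h' => hp.2 (hφ.2.2 (tsupport_fderiv_apply_subset ℝ e h'))

namespace HasXTrace

variable {a b c d : ℝ} {v w t v' w' t' : Plane → ℝ}

/-- Cutting a box in two along a vertical line: both halves have the same trace on that line. -/
lemma split (h : HasXTrace a b c d v w t) {m : ℝ} (ham : a < m) (hmb : m < b) :
    ∃ s : ℝ → ℝ, ∀ t' : Plane → ℝ, (∀ᵐ y ∂(volume.restrict (Ioo c d)), t' (m, y) = s y) →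
      (∀ᵐ y ∂(volume.restrict (Ioo c d)), t' (a, y) = t (a, y)) →
      (∀ᵐ y ∂(volume.restrict (Ioo c d)), t' (b, y) = t (b, y)) →
      HasXTrace a m c d v w t' ∧ HasXTrace m b c d v w t' := by
  have hB1 : box a m c d ⊆ box a b c d := prod_mono (Ioo_subset_Ioo le_rfl hmb.le) subset_rfl
  have hB2 : box m b c d ⊆ box a b c d := prod_mono (Ioo_subset_Ioo ham.le le_rfl) subset_rfl
  have hle1 := Measure.restrict_mono hB1 (le_refl (volume : Measure Plane))
  have hle2 := Measure.restrict_mono hB2 (le_refl (volume : Measure Plane))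
  obtain ⟨t1, h1⟩ := exists_hasXTrace ham (h.memLp.mono_measure hle1)
    (h.memLp_deriv.mono_measure hle1) (h.isWeakPartial.mono (measurableSet_box _ _ _ _) hB1)
  obtain ⟨t2, h2⟩ := exists_hasXTrace hmb (h.memLp.mono_measure hle2)
    (h.memLp_deriv.mono_measure hle2) (h.isWeakPartial.mono (measurableSet_box _ _ _ _) hB2)
  -- compare the three boundary terms by testing with quadratic polynomials in `x`
  have hsum : ∀ φ : Plane → ℝ, ContDiff ℝ ∞ φ →
      (∫ y in Ioo c d, t (b, y) * φ (b, y)) - ∫ y in Ioo c d, t (a, y) * φ (a, y) =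
      ((∫ y in Ioo c d, t1 (m, y) * φ (m, y)) - ∫ y in Ioo c d, t1 (a, y) * φ (a, y)) +
      ((∫ y in Ioo c d, t2 (b, y) * φ (b, y)) - ∫ y in Ioo c d, t2 (m, y) * φ (m, y)) := by
    intro φ hφ
    rw [← h.ibp φ hφ, ← h1.ibp φ hφ, ← h2.ibp φ hφ]
    have hdisj : Disjoint (box a m c d) (box m b c d) :=
      disjoint_left.2 fun p hp hp' => absurd hp.1.2 (not_lt.2 hp'.1.1.le)
    have i0 : IntegrableOn (fun p => v p * dx φ p + w p * φ p) (box a b c d) :=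
      integrable_mul_dx_add h.memLp h.memLp_deriv hφ
    rw [← setIntegral_union hdisj (measurableSet_box _ _ _ _) (i0.mono_set hB1)
      (i0.mono_set hB2)]
    refine setIntegral_congr_set ?_
    have hline : ∀ᵐ p : Plane, p.1 ≠ m := by
      have : ∀ᵐ x : ℝ, x ≠ m := by simp [ae_iff]
      exact Measure.quasiMeasurePreserving_fst.ae this
    filter_upwards [hline] with p hp
    refine propext ⟨fun h' => ?_, fun h' => ?_⟩
    · rcases lt_or_gt_of_ne hp with h'' | h''
      · exact Or.inl ⟨⟨h'.1.1, h''⟩, h'.2⟩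
      · exact Or.inr ⟨⟨h'', h'.1.2⟩, h'.2⟩
    · rcases h' with h' | h'
      · exact hB1 h'
      · exact hB2 h'
  have hpoly : ∀ (z z' : ℝ) (η : ℝ → ℝ), ContDiff ℝ ∞ η →
      ContDiff ℝ ∞ fun p : Plane => ((p.1 - z) * (p.1 - z')) * η p.2 := fun z z' η hη =>
    ((contDiff_fst.sub contDiff_const).mul (contDiff_fst.sub contDiff_const)).mul (smooth_snd hη)
  have hab := ham.trans hmb
  have key : ∀ {k : ℝ} {f g : ℝ → ℝ} {η : ℝ → ℝ}, k ≠ 0 → ContDiff ℝ ∞ η →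
      MemLp f 2 (volume.restrict (Ioo c d)) → MemLp g 2 (volume.restrict (Ioo c d)) →
      k * ∫ y in Ioo c d, f y * η y = k * ∫ y in Ioo c d, g y * η y →
      ∫ y in Ioo c d, (f y - g y) * η y = 0 := by
    intro k f g η hk hη hf hg he
    simp_rw [sub_mul]
    rw [integral_sub (integrable_mul_of_memLp hf (memLp_Ioo_of_continuous hη.continuous c d))
      (integrable_mul_of_memLp hg (memLp_Ioo_of_continuous hη.continuous c d)),
      mul_left_cancel₀ hk he, sub_self]
  have ea := ae_eq_zero_Ioo (h.memLp_left.sub h1.memLp_left) fun η hη => by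
    have := hsum _ (hpoly m b η hη)
    simp only [sub_self, zero_mul, mul_zero, integral_zero, zero_sub, add_zero,
      mul_left_comm _ (_ * (_ : ℝ)), integral_const_mul, neg_inj] at this
    exact key (mul_ne_zero (sub_ne_zero.2 ham.ne) (sub_ne_zero.2 hab.ne)) hη h.memLp_left
      h1.memLp_left this
  have eb := ae_eq_zero_Ioo (h.memLp_right.sub h2.memLp_right) fun η hη => by
    have := hsum _ (hpoly a m η hη)
    simp only [sub_self, zero_mul, mul_zero, integral_zero, sub_zero, zero_add,
      mul_left_comm _ (_ * (_ : ℝ)), integral_const_mul] at this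
    exact key (mul_ne_zero (sub_ne_zero.2 hab.ne') (sub_ne_zero.2 hmb.ne')) hη h.memLp_right
      h2.memLp_right this
  have em := ae_eq_zero_Ioo (h1.memLp_right.sub h2.memLp_left) fun η hη => by
    have := hsum _ (hpoly a b η hη)
    simp only [sub_self, zero_mul, mul_zero, integral_zero, zero_sub, sub_zero,
      mul_left_comm _ (_ * (_ : ℝ)), integral_const_mul] at this
    exact key (mul_ne_zero (sub_ne_zero.2 ham.ne') (sub_ne_zero.2 hmb.ne)) hη h1.memLp_right
      h2.memLp_left (by linarith)
  refine ⟨fun y => t1 (m, y), fun t' hm ha hb => ⟨?_, ?_⟩⟩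
  · refine h1.congr ae_eq_rfl ae_eq_rfl ?_ (hm.mono fun y hy => hy.symm)
    filter_upwards [ea, ha] with y hy hay
    rw [hay]; exact (sub_eq_zero.1 hy).symm
  · refine h2.congr ae_eq_rfl ae_eq_rfl ?_ ?_
    · filter_upwards [em, hm] with y hy hmy
      rw [hmy]; exact (sub_eq_zero.1 hy).symm
    · filter_upwards [eb, hb] with y hy hby
      rw [hby]; exact (sub_eq_zero.1 hy).symm

/-- If `v` is continuous up to the closed box and vanishes on the right side, so does its trace:
test with `ℓ(x) η(y)` where `ℓ` rises from `0` to `1` in a strip of width `2 / n` at that side. -/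
lemma right_eq_zero_of_continuousOn (h : HasXTrace a b c d v w t) (hab : a < b) (hcd : c < d)
    (hv : ContinuousOn v (Icc a b ×ˢ Icc c d)) (h0 : ∀ y ∈ Ioo c d, v (b, y) = 0) :
    ∀ᵐ y ∂(volume.restrict (Ioo c d)), t (b, y) = 0 := by
  have h0' : ∀ y ∈ Icc c d, v (b, y) = 0 := by
    have hc1 : ContinuousOn (fun y => v (b, y)) (closure (Ioo c d)) := by
      rw [closure_Ioo hcd.ne]
      exact hv.comp (continuousOn_const.prodMk continuousOn_id) fun y hy => ⟨⟨hab.le, le_rfl⟩, hy⟩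
    intro y hy
    rw [← closure_Ioo hcd.ne] at hy
    exact (show EqOn (fun y => v (b, y)) (fun _ => 0) (closure (Ioo c d)) from
      EqOn.of_subset_closure (fun y hy => h0 y hy) hc1 continuousOn_const subset_closure
        subset_rfl) hy
  refine ae_eq_zero_Ioo h.memLp_right fun η hη => ?_
  obtain ⟨C, hC0, hC⟩ := exists_deriv_step_bound
  obtain ⟨M, hM0, hM⟩ := exists_bound_box (smooth_snd hη).continuous a b c d
  let ℓ : ℕ → ℝ → ℝ := fun n x => 1 - step n (b - x)
  have hℓ : ∀ n, ContDiff ℝ ∞ (ℓ n) := fun n =>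
    contDiff_const.sub ((smooth_step n).comp (contDiff_const.sub contDiff_id))
  have hℓ' : ∀ n x, deriv (ℓ n) x = deriv (step n) (b - x) := by
    intro n x
    have h1 := (((smooth_step n).differentiable (by simp) (b - x)).hasDerivAt).comp x
      ((hasDerivAt_id x).const_sub b)
    have := (h1.const_sub 1).deriv
    rw [mul_neg_one, neg_neg] at this; exact this
  have hℓb : ∀ n, ℓ n b = 1 := fun n => by simp [ℓ, step_eq_zero]
  have hℓ01 : ∀ n x, |ℓ n x| ≤ 1 := fun n x =>
    abs_le.2 ⟨by linarith [step_le_one n (b - x)], by linarith [step_nonneg n (b - x)]⟩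
  have hF : ∀ n, ContDiff ℝ ∞ fun p : Plane => ℓ n p.1 * η p.2 := fun n =>
    (smooth_fst (hℓ n)).mul (smooth_snd hη)
  have hdF : ∀ n p, dx (fun p : Plane => ℓ n p.1 * η p.2) p =
      deriv (step n) (b - p.1) * η p.2 := fun n p => by
    rw [dx_mul (smooth_fst (hℓ n)) (smooth_snd hη), dx_fst (hℓ n), dx_snd hη, hℓ']; ring
  -- the term with `∂ₓ v` tends to zero by dominated convergence
  have lim2 : Tendsto (fun n => ∫ p in box a b c d, w p * (ℓ n p.1 * η p.2)) atTop (𝓝 0) := by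
    have := tendsto_integral_mul (h.memLp_deriv.integrable (by norm_num))
      (F := fun n p => ℓ n p.1 * η p.2) (f := fun _ => 0)
      (fun n => (hF n).continuous.aestronglyMeasurable) M (fun n => ?_) ?_
    · simpa using this
    · filter_upwards [ae_restrict_mem (measurableSet_box a b c d)] with p hp
      rw [abs_mul]
      exact (mul_le_of_le_one_left (abs_nonneg _) (hℓ01 _ _)).trans
        (hM p (box_subset_Icc _ _ _ _ hp))
    · filter_upwards [ae_restrict_mem (measurableSet_box a b c d)] with p hp
      refine tendsto_const_nhds.congr' ?_
      filter_upwards [eventually_lt_nat_mul (sub_pos.2 hp.1.2)] with n hn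
      simp [ℓ, step_eq_one hn.le]
  -- the term with `v` tends to zero since `v` is small near the right side
  have lim1 : Tendsto (fun n => ∫ p in box a b c d, v p * (deriv (step n) (b - p.1) * η p.2))
      atTop (𝓝 0) := by
    rw [Metric.tendsto_atTop]
    intro ε hε
    set K := 2 * C * M * (d - c) + 1 with hK
    have hK0 : 0 < K := by
      have : 0 ≤ 2 * C * M * (d - c) := by have := sub_pos.2 hcd; positivity
      linarith
    have huc := (isCompact_Icc.prod isCompact_Icc).uniformContinuousOn_of_continuous hv
    rw [Metric.uniformContinuousOn_iff] at huc
    obtain ⟨δ, hδ, hδv⟩ := huc (ε / K) (by positivity)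
    obtain ⟨N, hN⟩ := eventually_atTop.1
      ((eventually_lt_nat_mul hδ).and (eventually_lt_nat_mul (sub_pos.2 hab)))
    refine ⟨N, fun n hn => ?_⟩
    obtain ⟨hn1, hn2⟩ := hN n hn
    have hn0 : (0 : ℝ) < n := by
      by_contra hneg
      have : (n : ℝ) = 0 := le_antisymm (not_lt.1 hneg) (Nat.cast_nonneg n)
      rw [this] at hn1; linarith
    have hn3 : 2 / n < δ := by rw [div_lt_iff₀ hn0]; linarith
    have hn4 : 2 / n < b - a := by rw [div_lt_iff₀ hn0]; linarith
    have hsub : box (b - 2 / n) b c d ⊆ box a b c d :=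
      prod_mono (Ioo_subset_Ioo (by linarith) le_rfl) subset_rfl
    have hzero : ∀ p ∈ box a b c d \ box (b - 2 / n) b c d,
        v p * (deriv (step n) (b - p.1) * η p.2) = 0 ∨ p.1 = b - 2 / n := by
      intro p hp
      have h1 : ¬ (b - 2 / n < p.1) := fun h' => hp.2 ⟨⟨h', hp.1.1.2⟩, hp.1.2⟩
      rcases eq_or_lt_of_le (not_lt.1 h1) with h2 | h2
      · exact Or.inr h2
      · left
        rw [deriv_step_eq_zero, zero_mul, mul_zero]
        have : 2 / n < b - p.1 := by linarith
        rw [div_lt_iff₀ hn0] at this; linarith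
    have hsplit : ∫ p in box a b c d, v p * (deriv (step n) (b - p.1) * η p.2) =
        ∫ p in box (b - 2 / n) b c d, v p * (deriv (step n) (b - p.1) * η p.2) := by
      refine setIntegral_eq_of_subset_of_ae_sdiff_eq_zero
        (measurableSet_box a b c d).nullMeasurableSet hsub ?_
      have hline : ∀ᵐ p : Plane, p.1 ≠ b - 2 / n := by
        have : ∀ᵐ x : ℝ, x ≠ b - 2 / n := by simp [ae_iff]
        exact Measure.quasiMeasurePreserving_fst.ae this
      filter_upwards [hline] with p hp hp'
      exact (hzero p hp').resolve_right hp
    rw [dist_zero_right, hsplit]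
    have hbound : ∀ p ∈ box (b - 2 / n) b c d,
        ‖v p * (deriv (step n) (b - p.1) * η p.2)‖ ≤ ε / K * (C * n * M) := by
      intro p hp
      have hp' := box_subset_Icc _ _ _ _ (hsub hp)
      have h1 : |v p| ≤ ε / K := by
        have := hδv p hp' (b, p.2) ⟨⟨hab.le, le_rfl⟩, hp'.2⟩ (by
          rw [Prod.dist_eq, dist_self, max_eq_left dist_nonneg, Real.dist_eq, abs_sub_comm,
            abs_of_pos (by linarith [hp.1.2])]
          linarith [hp.1.1])
        rw [h0' _ hp'.2, dist_zero_right] at this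
        exact this.le
      rw [norm_mul, norm_mul]
      exact mul_le_mul h1 (mul_le_mul (hC _ _) (hM p hp') (norm_nonneg _) (by positivity))
        (by positivity) (by positivity)
    have hvol : (volume : Measure Plane).real (box (b - 2 / n) b c d) = 2 / n * (d - c) := by
      rw [Measure.volume_eq_prod, measureReal_prod_prod, Real.volume_real_Ioo,
        Real.volume_real_Ioo, max_eq_left (sub_pos.2 hcd).le, max_eq_left]
      · ring
      · have : 0 < 2 / (n : ℝ) := by positivity
        linarith
    refine (norm_setIntegral_le_of_norm_le_const (volume_box_lt_top _ _ _ _) hbound).trans_lt ?_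
    rw [hvol]
    have : ε / K * (C * n * M) * (2 / n * (d - c)) = ε * ((K - 1) / K) := by
      rw [hK]; field_simp; ring
    rw [this]
    refine mul_lt_of_lt_one_right hε ?_
    rw [div_lt_one hK0]; linarith
  have lim := lim1.add lim2
  rw [add_zero] at lim
  refine tendsto_nhds_unique (tendsto_const_nhds.congr' ?_) lim
  filter_upwards [eventually_lt_nat_mul (sub_pos.2 hab)] with n hn
  have := h.ibp _ (hF n)
  have ha : ℓ n a = 0 := by simp [ℓ, step_eq_one hn.le]
  simp only [hdF, hℓb, ha, one_mul, zero_mul, mul_zero, integral_zero, sub_zero] at this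
  rw [← this, ← integral_add]
  · refine integrable_mul_continuous h.memLp (Continuous.mul ?_ (smooth_snd hη).continuous)
    exact ((smooth_step n).continuous_deriv (by simp)).comp (continuous_const.sub continuous_fst)
  · exact integrable_mul_continuous h.memLp_deriv (hF n).continuous

/-- The trace on the right side of a function that is continuous up to the closed box. -/
lemma right_eq_of_continuousOn (h : HasXTrace a b c d v w t) (hab : a < b) (hcd : c < d)
    (hv : ContinuousOn v (Icc a b ×ˢ Icc c d)) :
    ∀ᵐ y ∂(volume.restrict (Ioo c d)), t (b, y) = v (b, y) := by
  have hg : ContinuousOn (fun y => v (b, y)) (Icc c d) :=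
    hv.comp (continuousOn_const.prodMk continuousOn_id) fun y hy => ⟨⟨hab.le, le_rfl⟩, hy⟩
  have h1 := h.sub (hasXTrace_mul hab.le (α := fun _ => 1) contDiff_const
    (memLp_Ioo_of_continuousOn hg))
  have := h1.right_eq_zero_of_continuousOn hab hcd ?_ (fun y _ => by simp)
  · filter_upwards [this] with y hy
    simpa using sub_eq_zero.1 hy
  · refine hv.sub (continuousOn_const.mul ?_)
    exact hg.comp continuousOn_snd fun p hp => hp.2

end HasXTrace

/-- A function that is continuous up to the closed box and has a square-integrable weak derivative
is its own trace. -/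
lemma hasXTrace_of_continuousOn {a b c d : ℝ} (hab : a < b) (hcd : c < d) {v w : Plane → ℝ}
    (hv : ContinuousOn v (Icc a b ×ˢ Icc c d)) (hw : MemLp w 2 (volume.restrict (box a b c d)))
    (h : IsWeakPartial (box a b c d) (1, 0) v w) : HasXTrace a b c d v w v := by
  have hmem : MemLp v 2 (volume.restrict (box a b c d)) := by
    obtain ⟨M, hM⟩ := (isCompact_Icc.prod isCompact_Icc).exists_bound_of_continuousOn hv
    refine MemLp.of_bound ((hv.mono (box_subset_Icc _ _ _ _)).aestronglyMeasurable
      (measurableSet_box _ _ _ _)) M ?_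
    filter_upwards [ae_restrict_mem (measurableSet_box _ _ _ _)] with y hy
    exact hM y (box_subset_Icc _ _ _ _ hy)
  obtain ⟨t, ht⟩ := exists_hasXTrace hab hmem hw h
  refine ht.congr ae_eq_rfl ae_eq_rfl ?_ (ht.right_eq_of_continuousOn hab hcd hv)
  have := ht.reflX.right_eq_of_continuousOn (neg_lt_neg hab) hcd (hv.comp
    (smooth_refl_map _ _).continuous.continuousOn fun p hp => ?_)
  · simpa [refl] using this
  · exact ⟨⟨by simp only [refl]; linarith [hp.1.2], by simp only [refl]; linarith [hp.1.1]⟩,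
      by simpa [refl] using hp.2⟩

/-! ### Weakly divergence-free fields -/

/-- The vector field `(P, Q)` on `U` is weakly divergence-free in the open set `V`: it is orthogonal
in `L²(U)` to the gradients of the test functions of `V`. With `V` larger than `U` this includes a
homogeneous Neumann condition on `∂U ∩ V`. -/
def IsDivFree (U V : Set Plane) (P Q : Plane → ℝ) : Prop :=
  ∀ φ : Plane → ℝ, IsTest V φ → ∫ p in U, (P p * dx φ p + Q p * dy φ p) = 0

lemma IsTest.refl {V : Set Plane} {s t : ℝ} (hs : s * s = 1) (ht : t * t = 1) {φ : Plane → ℝ}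
    (h : IsTest (refl s t ⁻¹' V) φ) : IsTest V (φ ∘ refl s t) := by
  refine isTest_of_eq_zero (K := NeumannNeumann.refl s t '' tsupport φ) (smooth_refl h.1 s t)
    (h.2.1.isCompact.image (smooth_refl_map s t).continuous) ?_ ?_
  · rintro _ ⟨p, hp, rfl⟩; exact h.2.2 hp
  · intro p hp
    exact image_eq_zero_of_notMem_tsupport (f := φ)
      fun h' => hp ⟨_, h', refl_refl hs ht p⟩

lemma integral_gradient_refl {U : Set Plane} {s t : ℝ} (hs : s * s = 1) (ht : t * t = 1)
    {P Q φ : Plane → ℝ} (hφ : ContDiff ℝ ∞ φ) :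
    ∫ p in refl s t ⁻¹' U, (s * P (refl s t p) * dx φ p + t * Q (refl s t p) * dy φ p) =
      ∫ p in U, (P p * dx (φ ∘ refl s t) p + Q p * dy (φ ∘ refl s t) p) := by
  rw [← setIntegral_refl hs ht (fun p => P p * dx (φ ∘ refl s t) p + Q p * dy (φ ∘ refl s t) p)]
  refine integral_congr_ae (Eventually.of_forall fun p => ?_)
  simp only [dx_refl hφ, dy_refl hφ, refl_refl hs ht]; ring

lemma IsDivFree.refl {U V : Set Plane} {P Q : Plane → ℝ} (h : IsDivFree U V P Q) {s t : ℝ}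
    (hs : s * s = 1) (ht : t * t = 1) :
    IsDivFree (refl s t ⁻¹' U) (refl s t ⁻¹' V) (fun p => s * P (refl s t p))
      (fun p => t * Q (refl s t p)) := fun φ hφ => by
  rw [integral_gradient_refl hs ht hφ.1]
  exact h _ (hφ.refl hs ht)

lemma integrable_gradient {P Q φ : Plane → ℝ} {a b c d : ℝ}
    (hP : MemLp P 2 (volume.restrict (box a b c d)))
    (hQ : MemLp Q 2 (volume.restrict (box a b c d))) (hφ : ContDiff ℝ ∞ φ) :
    Integrable (fun p => P p * dx φ p + Q p * dy φ p) (volume.restrict (box a b c d)) :=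
  (integrable_mul_continuous hP (smooth_dx hφ).continuous).add
    (integrable_mul_continuous hQ (smooth_dy hφ).continuous)

lemma integral_gradient {P Q φ : Plane → ℝ} {a b c d : ℝ}
    (hP : MemLp P 2 (volume.restrict (box a b c d)))
    (hQ : MemLp Q 2 (volume.restrict (box a b c d))) (hφ : ContDiff ℝ ∞ φ) :
    ∫ p in box a b c d, (P p * dx φ p + Q p * dy φ p) =
      (∫ p in box a b c d, P p * dx φ p) +
        ∫ p in box c d a b, (Q ∘ Prod.swap) p * dx (φ ∘ Prod.swap) p := by
  rw [integral_add (integrable_mul_continuous hP (smooth_dx hφ).continuous)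
    (integrable_mul_continuous hQ (smooth_dy hφ).continuous), ← setIntegral_swap (fun p => Q p * dy φ p)]
  simp only [dx_swap hφ, Function.comp_apply]

lemma memLp_swap {Q : Plane → ℝ} {a b c d : ℝ} (hQ : MemLp Q 2 (volume.restrict (box a b c d))) :
    MemLp (Q ∘ Prod.swap) 2 (volume.restrict (box c d a b)) :=
  hQ.comp_measurePreserving (measurePreserving_swap_box a b c d)

/-- A weakly divergence-free field on a box is orthogonal to the gradients of all smooth functions
that vanish on the boundary. -/
lemma IsDivFree.integral_eq_zero {a b c d : ℝ} {P Q φ : Plane → ℝ}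
    (h : IsDivFree (box a b c d) (box a b c d) P Q)
    (hP : MemLp P 2 (volume.restrict (box a b c d)))
    (hQ : MemLp Q 2 (volume.restrict (box a b c d))) (hφ : ContDiff ℝ ∞ φ)
    (ha : ∀ y, φ (a, y) = 0) (hb : ∀ y, φ (b, y) = 0) (hc : ∀ x, φ (x, c) = 0)
    (hd : ∀ x, φ (x, d) = 0) : ∫ p in box a b c d, (P p * dx φ p + Q p * dy φ p) = 0 := by
  have h1 := (tendsto_integral_dx_cut (hP.integrable (by norm_num)) hφ ha hb).add
    (tendsto_integral_dx_cut ((memLp_swap hQ).integrable (by norm_num)) (smooth_swap hφ) hc hd)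
  rw [← integral_gradient hP hQ hφ] at h1
  refine tendsto_nhds_unique h1 (tendsto_const_nhds.congr fun n => ?_)
  have ht := isTest_cut_mul (a := a) (b := b) (c := c) (d := d) n.succ_pos n.succ_pos hφ
  rw [← h _ ht, integral_gradient hP hQ ht.1]
  congr 1
  simp only [Function.comp_def, Prod.fst_swap, Prod.snd_swap, mul_left_comm]

/-- Functions of size `n` supported in a square of size `2 / n` at a corner tend weakly to `0` in
`L²`. -/
lemma tendsto_integral_corner {P : Plane → ℝ} (hP : MemLp P 2 (volume.restrict (box 0 1 0 1)))
    {F : ℕ → Plane → ℝ} (hF : ∀ n, Continuous (F n)) {K : ℝ}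
    (hK : ∀ n, ∀ p ∈ box 0 1 0 1, |F n p| ≤ K * (n + 1))
    (h0 : ∀ (n : ℕ), ∀ p ∈ box 0 1 0 1,
      2 / ((n : ℝ) + 1) < p.1 ∨ 2 / ((n : ℝ) + 1) < p.2 → F n p = 0) :
    Tendsto (fun n => ∫ p in box 0 1 0 1, P p * F n p) atTop (𝓝 0) := by
  let B : ℕ → Set Plane := fun n => Ioc 0 (2 / ((n : ℝ) + 1)) ×ˢ Ioc 0 (2 / ((n : ℝ) + 1))
  have hB : ∀ n, MeasurableSet (B n) := fun n => measurableSet_Ioc.prod measurableSet_Ioc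
  have hsq := hP.integrable_sq
  -- the energy of `P` near the corner tends to zero
  have lim : Tendsto (fun n => ∫ p in box 0 1 0 1, P p ^ 2 * (B n).indicator 1 p) atTop (𝓝 0) := by
    have := tendsto_integral_mul hsq (F := fun n => (B n).indicator 1) (f := fun _ => 0)
      (fun n => (measurable_one.indicator (hB n)).aestronglyMeasurable) 1
      (fun n => Eventually.of_forall fun p => by
        by_cases h : p ∈ B n <;> simp [h]) ?_
    · simpa using this
    · filter_upwards [ae_restrict_mem (measurableSet_box 0 1 0 1)] with p hp
      refine tendsto_const_nhds.congr' ?_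
      filter_upwards [(tendsto_add_atTop_nat 1).eventually (eventually_lt_nat_mul hp.1.1)] with n hn
      have : p ∉ B n := fun h' => by
        have h1 := h'.1.2
        have hn0 : (0 : ℝ) < (n : ℝ) + 1 := by positivity
        rw [le_div_iff₀ hn0] at h1
        push_cast at hn
        linarith
      simp [this]
  rw [Metric.tendsto_atTop]
  intro ε hε
  set δ := ε / (4 * (K ^ 2 + 1)) with hδ
  have hK1 : 0 < K ^ 2 + 1 := by positivity
  have hδ0 : 0 < δ := by positivity
  obtain ⟨N, hN⟩ := (Metric.tendsto_atTop.1 lim) (δ * ε) (by positivity)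
  refine ⟨N, fun n hn => ?_⟩
  have h1 := hN n hn
  rw [dist_zero_right, Real.norm_eq_abs] at h1 ⊢
  have hn0 : (0 : ℝ) < (n : ℝ) + 1 := by positivity
  have iP : Integrable (fun p => P p ^ 2 * (B n).indicator 1 p)
      (volume.restrict (box 0 1 0 1)) := by
    refine hsq.mono' (hsq.aestronglyMeasurable.mul
      (measurable_one.indicator (hB n)).aestronglyMeasurable) (Eventually.of_forall fun p => ?_)
    by_cases h : p ∈ B n <;> simp [h, sq_nonneg]
  have iB : Integrable (fun p => (B n).indicator (1 : Plane → ℝ) p)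
      (volume.restrict (box 0 1 0 1)) := (integrable_const (1 : ℝ)).indicator (hB n)
  have hvol : ∫ p in box 0 1 0 1, (B n).indicator (1 : Plane → ℝ) p ≤ (2 / ((n : ℝ) + 1)) ^ 2 := by
    rw [integral_indicator_one (hB n)]
    rw [measureReal_restrict_apply (hB n)]
    have hfin : volume (B n) ≠ ⊤ := by
      rw [Measure.volume_eq_prod, Measure.prod_prod]
      exact ENNReal.mul_ne_top measure_Ioc_lt_top.ne measure_Ioc_lt_top.ne
    refine (measureReal_mono inter_subset_left hfin).trans ?_
    rw [Measure.volume_eq_prod, measureReal_prod_prod, Real.volume_real_Ioc, sub_zero,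
      max_eq_left (by positivity), sq]
  have hle : |∫ p in box 0 1 0 1, P p * F n p| ≤ ∫ p in box 0 1 0 1,
      ((2 * δ)⁻¹ * (P p ^ 2 * (B n).indicator 1 p) +
        δ * (K * (n + 1)) ^ 2 / 2 * (B n).indicator 1 p) := by
    refine (abs_integral_le_integral_abs).trans (integral_mono_ae ?_ ?_ ?_)
    · exact (integrable_mul_continuous hP (hF n)).abs
    · exact (iP.const_mul _).add (iB.const_mul _)
    · filter_upwards [ae_restrict_mem (measurableSet_box 0 1 0 1)] with p hp
      by_cases h : p ∈ B n
      · simp only [indicator_of_mem h, Pi.one_apply, mul_one]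
        rw [abs_mul]
        have := hK n p hp
        have e1 : |P p| * |F n p| ≤ |P p| * (K * (n + 1)) :=
          mul_le_mul_of_nonneg_left this (abs_nonneg _)
        have e2 : 0 ≤ (2 * δ)⁻¹ * (|P p| - δ * (K * (n + 1))) ^ 2 := by positivity
        have e3 : (2 * δ)⁻¹ * (|P p| - δ * (K * (n + 1))) ^ 2 =
            (2 * δ)⁻¹ * P p ^ 2 + δ * (K * (n + 1)) ^ 2 / 2 - |P p| * (K * (n + 1)) := by
          rw [← sq_abs (P p)]; field_simp; ring
        linarith
      · rw [h0 n p hp, mul_zero, abs_zero]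
        · simp [h]
        · by_contra hcon
          push Not at hcon
          exact h ⟨⟨hp.1.1, hcon.1⟩, hp.2.1, hcon.2⟩
  refine hle.trans_lt ?_
  rw [integral_add (iP.const_mul _) (iB.const_mul _), integral_const_mul, integral_const_mul]
  have h2 := (abs_lt.1 h1).2
  have e1 : (2 * δ)⁻¹ * ∫ p in box 0 1 0 1, P p ^ 2 * (B n).indicator 1 p < ε / 2 := by
    rw [inv_mul_lt_iff₀ (by positivity)]; linarith
  have e2 : δ * (K * (n + 1)) ^ 2 / 2 * ∫ p in box 0 1 0 1, (B n).indicator (1 : Plane → ℝ) p ≤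
      ε / 2 := by
    refine (mul_le_mul_of_nonneg_left hvol (by positivity)).trans ?_
    have : δ * (K * (n + 1)) ^ 2 / 2 * (2 / ((n : ℝ) + 1)) ^ 2 = ε / 2 * (K ^ 2 / (K ^ 2 + 1)) := by
      rw [hδ]; field_simp; ring
    rw [this]
    refine mul_le_of_le_one_right (by positivity) ?_
    rw [div_le_one hK1]; linarith
  linarith

/-- A cutoff that vanishes near the origin and equals `1` away from it, on the first quadrant. -/
noncomputable def cornerCut (n : ℕ) (p : Plane) : ℝ :=
  step n p.1 + (1 - step n p.1) * step n p.2

lemma smooth_cornerCut (n : ℕ) : ContDiff ℝ ∞ (cornerCut n) :=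
  (smooth_fst (smooth_step n)).add
    ((contDiff_const.sub (smooth_fst (smooth_step n))).mul (smooth_snd (smooth_step n)))

lemma cornerCut_swap (n : ℕ) (p : Plane) : cornerCut n p.swap = cornerCut n p := by
  simp only [cornerCut, Prod.fst_swap, Prod.snd_swap]; ring

/-- The corner cutoff has derivatives of size `n` in a square of size `2 / n`, which are bounded in
`L²`, so that cutting off the corner is harmless in the limit. -/
lemma tendsto_integral_dx_cornerCut {P φ : Plane → ℝ}
    (hP : MemLp P 2 (volume.restrict (box 0 1 0 1))) (hφ : ContDiff ℝ ∞ φ)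
    (ha : ∀ y, φ (-1, y) = 0) (hb : ∀ y, φ (1, y) = 0) :
    Tendsto (fun n : ℕ => ∫ p in box 0 1 0 1, P p * dx (fun p => cornerCut (n + 1) p *
      (cut (-1) 1 (n + 1) p.1 * (cut (-1) 1 (n + 1) p.2 * φ p))) p) atTop
      (𝓝 (∫ p in box 0 1 0 1, P p * dx φ p)) := by
  have hsub : box 0 1 0 1 ⊆ box (-1) 1 (-1) 1 :=
    prod_mono (Ioo_subset_Ioo (by norm_num) le_rfl) (Ioo_subset_Ioo (by norm_num) le_rfl)
  obtain ⟨B, hB0, hB⟩ := exists_bound_dx_cut (c := -1) (d := 1) hφ ha hb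
  obtain ⟨M, hM0, hM⟩ := exists_bound_box hφ.continuous 0 1 0 1
  obtain ⟨C, hC0, hC⟩ := exists_deriv_step_bound
  let g : ℕ → Plane → ℝ := fun n p => cut (-1) 1 (n + 1) p.1 * (cut (-1) 1 (n + 1) p.2 * φ p)
  have hg : ∀ n, ContDiff ℝ ∞ (g n) := fun n => (isTest_cut_mul n.succ_pos n.succ_pos hφ).1
  have hgM : ∀ n, ∀ p ∈ box 0 1 0 1, |g n p| ≤ M := fun n p hp => by
    simp only [g, abs_mul]
    refine (mul_le_of_le_one_left (by positivity) (abs_cut_le_one _ _ _ _)).trans ?_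
    exact (mul_le_of_le_one_left (by positivity) (abs_cut_le_one _ _ _ _)).trans
        (hM p (box_subset_Icc _ _ _ _ hp))
  have hκ : ∀ n p, |cornerCut n p| ≤ 1 := fun n p => by
    have h1 := step_nonneg n p.1
    have h2 := step_le_one n p.1
    have h3 := step_nonneg n p.2
    have h4 := step_le_one n p.2
    rw [cornerCut, abs_le]; constructor <;> nlinarith
  have hdκ : ∀ n p, dx (cornerCut n) p = deriv (step n) p.1 * (1 - step n p.2) := fun n p => by
    have hs := smooth_step n
    have e := dx_add (smooth_fst hs)
      ((contDiff_const (c := (1 : ℝ)).sub (smooth_fst hs)).mul (smooth_snd hs)) p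
    rw [dx_mul (contDiff_const.sub (smooth_fst hs)) (smooth_snd hs),
      dx_sub contDiff_const (smooth_fst hs), dx_fst hs, dx_snd hs] at e
    refine e.trans ?_
    have : dx (fun _ : Plane => (1 : ℝ)) p = 0 := by simp [dx]
    rw [this]; ring
  have l1 : Tendsto (fun n => ∫ p in box 0 1 0 1, P p * (cornerCut (n + 1) p * dx (g n) p)) atTop
      (𝓝 (∫ p in box 0 1 0 1, P p * dx φ p)) := by
    refine tendsto_integral_mul (hP.integrable (by norm_num)) (fun n => ?_) B (fun n => ?_) ?_
    · exact ((smooth_cornerCut _).continuous.mul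
        (smooth_dx (hg n)).continuous).aestronglyMeasurable
    · filter_upwards [ae_restrict_mem (measurableSet_box 0 1 0 1)] with p hp
      rw [abs_mul]
      exact (mul_le_of_le_one_left (abs_nonneg _) (hκ _ _)).trans (hB n p (hsub hp))
    · filter_upwards [ae_restrict_mem (measurableSet_box 0 1 0 1)] with p hp
      refine tendsto_const_nhds.congr' ?_
      filter_upwards [eventually_dx_cut hφ (hsub hp),
        (tendsto_add_atTop_nat 1).eventually (eventually_lt_nat_mul hp.1.1)] with n h1 h2
      simp only [g, h1, cornerCut, step_eq_one h2.le]; ring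
  have l2 : Tendsto (fun n : ℕ => ∫ p in box 0 1 0 1, P p *
      (deriv (step (n + 1)) p.1 * (1 - step (n + 1) p.2) * g n p)) atTop (𝓝 0) := by
    refine tendsto_integral_corner hP (fun n => ?_) (K := C * M) (fun n p hp => ?_)
      (fun n p hp h => ?_)
    · exact ((((smooth_step _).continuous_deriv (by simp)).comp continuous_fst).mul
        (continuous_const.sub (smooth_snd (smooth_step _)).continuous)).mul (hg n).continuous
    · rw [abs_mul, abs_mul]
      have h1 := hC (n + 1) p.1
      have h2 : |1 - step (n + 1) p.2| ≤ 1 := abs_le.2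
        ⟨by linarith [step_le_one (n + 1) p.2], by linarith [step_nonneg (n + 1) p.2]⟩
      calc _ ≤ (C * ((n + 1 : ℕ) : ℝ) * 1) * M :=
            mul_le_mul (mul_le_mul h1 h2 (abs_nonneg _) (by positivity)) (hgM n p hp)
              (abs_nonneg _) (by positivity)
        _ = _ := by push_cast; ring
    · have hn0 : (0 : ℝ) < (n : ℝ) + 1 := by positivity
      rw [div_lt_iff₀ hn0, div_lt_iff₀ hn0] at h
      rcases h with h | h
      · rw [deriv_step_eq_zero (by push_cast; linarith), zero_mul, zero_mul]
      · rw [step_eq_one (by push_cast; linarith), sub_self, mul_zero, zero_mul]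
  have := l1.add l2
  rw [add_zero] at this
  refine this.congr fun n => ?_
  rw [← integral_add]
  · congr 1; ext p
    rw [dx_mul (smooth_cornerCut _) (hg n), hdκ]; ring
  · exact integrable_mul_continuous hP ((smooth_cornerCut _).continuous.mul
      (smooth_dx (hg n)).continuous)
  · exact integrable_mul_continuous hP (((((smooth_step _).continuous_deriv (by simp)).comp
      continuous_fst).mul (continuous_const.sub (smooth_snd (smooth_step _)).continuous)).mul
      (hg n).continuous)

/-- A field on the unit square that is weakly divergence-free across the two sides on the axes, with
test functions that vanish near the origin, is orthogonal to the gradients of all smooth functions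
that vanish on the outer sides: a point has zero capacity in the plane. -/
lemma integral_eq_zero_of_mixed {P Q φ : Plane → ℝ}
    (h1 : IsDivFree (box 0 1 0 1) (box 0 1 (-1) 1) P Q)
    (h2 : IsDivFree (box 0 1 0 1) (box (-1) 1 0 1) P Q)
    (hP : MemLp P 2 (volume.restrict (box 0 1 0 1)))
    (hQ : MemLp Q 2 (volume.restrict (box 0 1 0 1))) (hφ : ContDiff ℝ ∞ φ)
    (ha : ∀ y, φ (-1, y) = 0) (hb : ∀ y, φ (1, y) = 0) (hc : ∀ x, φ (x, -1) = 0)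
    (hd : ∀ x, φ (x, 1) = 0) : ∫ p in box 0 1 0 1, (P p * dx φ p + Q p * dy φ p) = 0 := by
  have l := (tendsto_integral_dx_cornerCut hP hφ ha hb).add
    (tendsto_integral_dx_cornerCut (memLp_swap hQ) (smooth_swap hφ) hc hd)
  rw [← integral_gradient hP hQ hφ] at l
  refine tendsto_nhds_unique l (tendsto_const_nhds.congr fun n => ?_)
  let g : Plane → ℝ := fun p => cut (-1) 1 (n + 1) p.1 * (cut (-1) 1 (n + 1) p.2 * φ p)
  have hg : ContDiff ℝ ∞ g := (isTest_cut_mul n.succ_pos n.succ_pos hφ).1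
  have hs := smooth_step (n + 1)
  have hn0 : (0 : ℝ) < ((n + 1 : ℕ) : ℝ) := by positivity
  set r : ℝ := 1 / ((n + 1 : ℕ) : ℝ) with hr
  have hr0 : 0 < r := by positivity
  have hg0 : ∀ p : Plane, p ∉ Icc (-1 + r) (1 - r) ×ˢ Icc (-1 + r) (1 - r) → g p = 0 := by
    intro p hp
    rw [mem_prod, not_and_or] at hp
    rcases hp with h | h
    · simp only [g, cut_eq_zero n.succ_pos h, zero_mul]
    · simp only [g, cut_eq_zero n.succ_pos h, zero_mul, mul_zero]
  have hstep0 : ∀ x : ℝ, x < r → step (n + 1) x = 0 := fun x hx => by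
    refine step_eq_zero ?_
    rw [hr, lt_div_iff₀ hn0] at hx; linarith
  -- split the cutoff into a part supported off the `y`-axis and a part supported off the `x`-axis
  have t1 : IsTest (box 0 1 (-1) 1) fun p => step (n + 1) p.1 * g p := by
    refine isTest_of_eq_zero (K := Icc r (1 - r) ×ˢ Icc (-1 + r) (1 - r))
      ((smooth_fst hs).mul hg) (isCompact_Icc.prod isCompact_Icc) ?_ ?_
    · exact fun p hp => ⟨⟨by linarith [hp.1.1], by linarith [hp.1.2]⟩,
        by linarith [hp.2.1], by linarith [hp.2.2]⟩
    · intro p hp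
      by_cases hx : p.1 < r
      · rw [hstep0 _ hx, zero_mul]
      · rw [hg0, mul_zero]
        exact fun h => hp ⟨⟨not_lt.1 hx, h.1.2⟩, h.2⟩
  have t2 : IsTest (box (-1) 1 0 1) fun p => (1 - step (n + 1) p.1) * (step (n + 1) p.2 * g p) := by
    refine isTest_of_eq_zero (K := Icc (-1 + r) (1 - r) ×ˢ Icc r (1 - r))
      ((contDiff_const.sub (smooth_fst hs)).mul ((smooth_snd hs).mul hg))
      (isCompact_Icc.prod isCompact_Icc) ?_ ?_
    · exact fun p hp => ⟨⟨by linarith [hp.1.1], by linarith [hp.1.2]⟩,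
        by linarith [hp.2.1], by linarith [hp.2.2]⟩
    · intro p hp
      by_cases hx : p.2 < r
      · rw [hstep0 _ hx, zero_mul, mul_zero]
      · rw [hg0, mul_zero, mul_zero]
        exact fun h => hp ⟨h.1, ⟨not_lt.1 hx, h.2.2⟩⟩
  have hκ : (fun p => cornerCut (n + 1) p * g p) = fun p => step (n + 1) p.1 * g p +
      (1 - step (n + 1) p.1) * (step (n + 1) p.2 * g p) := by
    funext p; simp only [cornerCut]; ring
  have hzero : ∫ p in box 0 1 0 1, (P p * dx (fun p => cornerCut (n + 1) p * g p) p +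
      Q p * dy (fun p => cornerCut (n + 1) p * g p) p) = 0 := by
    rw [hκ]
    have := congrArg₂ (· + ·) (h1 _ t1) (h2 _ t2)
    simp only [add_zero] at this
    rw [← integral_add (integrable_gradient hP hQ t1.1) (integrable_gradient hP hQ t2.1)] at this
    refine Eq.trans (integral_congr_ae (Eventually.of_forall fun p => ?_)) this
    simp only [dx_add t1.1 t2.1, dy_add t1.1 t2.1]; ring
  refine hzero.symm.trans ?_
  rw [integral_gradient hP hQ ((smooth_cornerCut _).mul hg)]
  have : ((fun p => cornerCut (n + 1) p * g p) ∘ Prod.swap) = fun p => cornerCut (n + 1) p *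
      (cut (-1) 1 (n + 1) p.1 * (cut (-1) 1 (n + 1) p.2 * (φ ∘ Prod.swap) p)) := by
    funext p
    simp only [Function.comp_apply, cornerCut_swap, g, Prod.fst_swap, Prod.snd_swap]
    ring
  rw [this]

/-! ### Completeness of trigonometric products and uniqueness -/

/-- Functions `p j` with `2 e (p j) = p (j + 1) + p (j - 1)`, as `sin (j x)` or
`cos ((j + 1 / 2) x)` with `e = cos x`, span a space that is stable under multiplication by `e`, and
similarly for `q k` and `f`. By the Stone-Weierstrass theorem for the algebra generated by `e(x)`
and `f(y)`, a function orthogonal to all products `p j (x) q k (y)` is zero. -/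
lemma ae_eq_zero_of_integral_mul_eq_zero {a b c d : ℝ} {h : Plane → ℝ}
    (hh : MemLp h 2 (volume.restrict (box a b c d))) {p q : ℤ → C(ℝ, ℝ)} {e f : C(ℝ, ℝ)}
    (hp : ∀ j x, e x * p j x = (p (j + 1) x + p (j - 1) x) / 2)
    (hq : ∀ j x, f x * q j x = (q (j + 1) x + q (j - 1) x) / 2)
    (he : InjOn e (Icc a b)) (hf : InjOn f (Icc c d)) {j₀ k₀ : ℤ}
    (hp₀ : ∀ x ∈ Ioo a b, p j₀ x ≠ 0) (hq₀ : ∀ x ∈ Ioo c d, q k₀ x ≠ 0)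
    (H : ∀ j k, ∫ z in box a b c d, h z * (p j z.1 * q k z.2) = 0) :
    h =ᵐ[volume.restrict (box a b c d)] 0 := by
  let X : C(Plane, ℝ) := ⟨fun z => e z.1, e.continuous.comp continuous_fst⟩
  let Y : C(Plane, ℝ) := ⟨fun z => f z.2, f.continuous.comp continuous_snd⟩
  let m : ℤ → ℤ → C(Plane, ℝ) := fun j k =>
    ⟨fun z => p j z.1 * q k z.2,
      ((p j).continuous.comp continuous_fst).mul ((q k).continuous.comp continuous_snd)⟩
  let S : Submodule ℝ C(Plane, ℝ) := Submodule.span ℝ (range fun i : ℤ × ℤ => m i.1 i.2)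
  have hmS : ∀ j k, m j k ∈ S := fun j k => Submodule.subset_span ⟨(j, k), rfl⟩
  -- the functions that multiply the span into itself
  let A : Subalgebra ℝ C(Plane, ℝ) :=
    { carrier := {F | ∀ s ∈ S, F * s ∈ S}
      mul_mem' := fun {F G} hF hG s hs => by rw [mul_assoc]; exact hF _ (hG _ hs)
      add_mem' := fun {F G} hF hG s hs => by rw [add_mul]; exact S.add_mem (hF _ hs) (hG _ hs)
      algebraMap_mem' := fun r s hs => by rw [← Algebra.smul_def]; exact S.smul_mem r hs }
  have hmul : ∀ F : C(Plane, ℝ), (∀ j k, F * m j k ∈ S) → F ∈ A := by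
    intro F hF s hs
    induction hs using Submodule.span_induction with
    | mem x hx => obtain ⟨i, rfl⟩ := hx; exact hF i.1 i.2
    | zero => rw [mul_zero]; exact S.zero_mem
    | add x y _ _ hx hy => rw [mul_add]; exact S.add_mem hx hy
    | smul r x _ hx => rw [mul_smul_comm]; exact S.smul_mem r hx
  have hX : X ∈ A := by
    refine hmul X fun j k => ?_
    have : X * m j k = (1 / 2 : ℝ) • (m (j + 1) k + m (j - 1) k) := by
      ext z
      change e z.1 * (p j z.1 * q k z.2) =
        (1 / 2 : ℝ) * (p (j + 1) z.1 * q k z.2 + p (j - 1) z.1 * q k z.2)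
      rw [← mul_assoc, hp]; ring
    rw [this]
    exact S.smul_mem _ (S.add_mem (hmS _ _) (hmS _ _))
  have hY : Y ∈ A := by
    refine hmul Y fun j k => ?_
    have : Y * m j k = (1 / 2 : ℝ) • (m j (k + 1) + m j (k - 1)) := by
      ext z
      change f z.2 * (p j z.1 * q k z.2) =
        (1 / 2 : ℝ) * (p j z.1 * q (k + 1) z.2 + p j z.1 * q (k - 1) z.2)
      rw [mul_left_comm, hq]; ring
    rw [this]
    exact S.smul_mem _ (S.add_mem (hmS _ _) (hmS _ _))
  have hzero : ∀ s ∈ S, ∫ z in box a b c d, h z * s z = 0 := by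
    intro s hs
    induction hs using Submodule.span_induction with
    | mem x hx => obtain ⟨i, rfl⟩ := hx; exact H i.1 i.2
    | zero => simp
    | add x y _ _ hx hy =>
      simp only [ContinuousMap.add_apply, mul_add]
      rw [integral_add (integrable_mul_continuous hh x.continuous)
        (integrable_mul_continuous hh y.continuous), hx, hy, add_zero]
    | smul r x _ hx =>
      simp only [ContinuousMap.smul_apply, smul_eq_mul, mul_left_comm _ r]
      rw [integral_const_mul, hx, mul_zero]
  let K : Set Plane := Icc a b ×ˢ Icc c d
  have hK : IsCompact K := isCompact_Icc.prod isCompact_Icc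
  have : CompactSpace K := isCompact_iff_compactSpace.1 hK
  let ρ : C(K, Plane) := ⟨Subtype.val, continuous_subtype_val⟩
  let A' : Subalgebra ℝ C(K, ℝ) := A.map (ContinuousMap.compRightAlgHom ℝ ℝ ρ)
  have hsep : A'.SeparatesPoints := by
    intro z z' hne
    by_cases hx : e z.1.1 = e z'.1.1
    · refine ⟨_, ⟨_, ⟨Y, hY, rfl⟩, rfl⟩, fun hy => hne ?_⟩
      exact Subtype.ext (Prod.ext (he z.2.1 z'.2.1 hx) (hf z.2.2 z'.2.2 hy))
    · exact ⟨_, ⟨_, ⟨X, hX, rfl⟩, rfl⟩, hx⟩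
  have hprod : MemLp (fun z => m j₀ k₀ z * h z) 2 (volume.restrict (box a b c d)) :=
    memLp_continuous_mul hh (m j₀ k₀).continuous
  have key : (fun z => m j₀ k₀ z * h z) =ᵐ[volume.restrict (box a b c d)] 0 := by
    refine ae_eq_zero_box hprod fun φ hφ => ?_
    set I := ∫ z in box a b c d, |m j₀ k₀ z * h z| with hI
    have hI0 : 0 ≤ I := integral_nonneg fun _ => abs_nonneg _
    have hsmall : ∀ ε : ℝ, 0 < ε → |∫ z in box a b c d, m j₀ k₀ z * h z * φ z| ≤ ε * I := by
      intro ε hε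
      obtain ⟨⟨F', F, hF, rfl⟩, hFε⟩ :=
        ContinuousMap.exists_mem_subalgebra_near_continuousMap_of_separatesPoints A' hsep
          ((⟨φ, hφ.1.continuous⟩ : C(Plane, ℝ)).comp ρ) ε hε
      have hclose : ∀ z ∈ K, |F z - φ z| ≤ ε := fun z hz =>
        ((ContinuousMap.norm_coe_le_norm _ (⟨z, hz⟩ : K)).trans hFε.le)
      have h0 : ∫ z in box a b c d, m j₀ k₀ z * h z * F z = 0 := by
        rw [← hzero _ (hF _ (hmS j₀ k₀))]
        refine integral_congr_ae (Eventually.of_forall fun z => ?_)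
        simp only [ContinuousMap.mul_apply]; ring
      rw [← sub_zero (∫ z in box a b c d, m j₀ k₀ z * h z * φ z), ← h0,
        ← integral_sub (integrable_mul_continuous hprod hφ.1.continuous)
          (integrable_mul_continuous hprod F.continuous), hI, ← integral_const_mul]
      refine abs_integral_le_integral_abs.trans (integral_mono_ae ?_ ?_ ?_)
      · exact ((integrable_mul_continuous hprod hφ.1.continuous).sub
          (integrable_mul_continuous hprod F.continuous)).abs
      · exact (hprod.integrable (by norm_num)).abs.const_mul _
      · filter_upwards [ae_restrict_mem (measurableSet_box a b c d)] with z hz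
        rw [← mul_sub, abs_mul, mul_comm, abs_sub_comm]
        exact mul_le_mul_of_nonneg_right (hclose z (box_subset_Icc _ _ _ _ hz)) (abs_nonneg _)
    by_contra hne
    have hpos : 0 < |∫ z in box a b c d, m j₀ k₀ z * h z * φ z| := abs_pos.2 hne
    have := hsmall (|∫ z in box a b c d, m j₀ k₀ z * h z * φ z| / (2 * (I + 1))) (by positivity)
    rw [div_mul_eq_mul_div, le_div_iff₀ (by positivity)] at this
    nlinarith
  filter_upwards [key, ae_restrict_mem (measurableSet_box a b c d)] with z hz hzb
  exact (mul_eq_zero.1 hz).resolve_left (mul_ne_zero (hp₀ _ hzb.1) (hq₀ _ hzb.2))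

/-- Green's formula with a product of one-dimensional eigenfunctions. -/
lemma integral_mul_eigenfunction {a b c d : ℝ} {v vx vy t t' : Plane → ℝ}
    (hx : HasXTrace a b c d v vx t)
    (hy : HasXTrace c d a b (v ∘ Prod.swap) (vy ∘ Prod.swap) t') {p q : ℝ → ℝ} {A B : ℝ}
    (hp : ContDiff ℝ ∞ p) (hq : ContDiff ℝ ∞ q) (hpA : ∀ x, deriv (deriv p) x = -A * p x)
    (hqB : ∀ x, deriv (deriv q) x = -B * q x)
    (ha : (∀ᵐ y ∂(volume.restrict (Ioo c d)), t (a, y) = 0) ∨ deriv p a = 0)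
    (hb : (∀ᵐ y ∂(volume.restrict (Ioo c d)), t (b, y) = 0) ∨ deriv p b = 0)
    (hc : (∀ᵐ y ∂(volume.restrict (Ioo a b)), t' (c, y) = 0) ∨ deriv q c = 0)
    (hd : (∀ᵐ y ∂(volume.restrict (Ioo a b)), t' (d, y) = 0) ∨ deriv q d = 0)
    (h0 : ∫ z in box a b c d, (vx z * dx (fun z => p z.1 * q z.2) z +
      vy z * dy (fun z => p z.1 * q z.2) z) = 0) :
    (A + B) * ∫ z in box a b c d, v z * (p z.1 * q z.2) = 0 := by
  have edge : ∀ {c d r k : ℝ} {t : Plane → ℝ} {g : ℝ → ℝ},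
      ((∀ᵐ y ∂(volume.restrict (Ioo c d)), t (r, y) = 0) ∨ k = 0) →
      ∫ y in Ioo c d, t (r, y) * (k * g y) = 0 := by
    intro c d r k t g h
    rcases h with h | h
    · refine integral_eq_zero_of_ae ?_
      filter_upwards [h] with y hy
      rw [hy]; simp
    · simp [h]
  have s1 : ContDiff ℝ ∞ fun z : Plane => deriv p z.1 * q z.2 :=
    (smooth_fst hp.deriv').mul (smooth_snd hq)
  have s2 : ContDiff ℝ ∞ fun z : Plane => deriv q z.1 * p z.2 :=
    (smooth_fst hq.deriv').mul (smooth_snd hp)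
  have s3 : ContDiff ℝ ∞ fun z : Plane => p z.1 * deriv q z.2 :=
    (smooth_fst hp).mul (smooth_snd hq.deriv')
  have s0 : ContDiff ℝ ∞ fun z : Plane => p z.1 * q z.2 := (smooth_fst hp).mul (smooth_snd hq)
  have d0 : ∀ z, dx (fun z : Plane => p z.1 * q z.2) z = deriv p z.1 * q z.2 := fun z => by
    rw [dx_mul (smooth_fst hp) (smooth_snd hq), dx_fst hp, dx_snd hq]; ring
  have d0' : ∀ z, dy (fun z : Plane => p z.1 * q z.2) z = p z.1 * deriv q z.2 := fun z => by
    rw [dy_mul (smooth_fst hp) (smooth_snd hq), dy_fst hp, dy_snd hq]; ring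
  have e1 := hx.ibp _ s1
  rw [edge ha, edge hb] at e1
  have e2 := hy.ibp _ s2
  rw [edge hc, edge hd, ← setIntegral_swap] at e2
  have d1 : ∀ z, dx (fun z : Plane => deriv p z.1 * q z.2) z = -A * p z.1 * q z.2 := fun z => by
    rw [dx_mul (smooth_fst hp.deriv') (smooth_snd hq), dx_fst hp.deriv', dx_snd hq, hpA]; ring
  have d2 : ∀ z, dx (fun z : Plane => deriv q z.1 * p z.2) z = -B * q z.1 * p z.2 := fun z => by
    rw [dx_mul (smooth_fst hq.deriv') (smooth_snd hp), dx_fst hq.deriv', dx_snd hp, hqB]; ring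
  simp only [d1, d2, d0, d0', Function.comp_apply, Prod.swap_swap, Prod.fst_swap, Prod.snd_swap,
    sub_self] at e1 e2 h0
  have i1 : Integrable (fun z => v z * (-A * p z.1 * q z.2) + vx z * (deriv p z.1 * q z.2))
      (volume.restrict (box a b c d)) := by
    have := integrable_mul_dx_add hx.memLp hx.memLp_deriv s1
    simpa only [d1] using this
  have hvy : MemLp vy 2 (volume.restrict (box a b c d)) := memLp_swap hy.memLp_deriv
  have i3 := integrable_mul_continuous hx.memLp s0.continuous
  have i2 : Integrable (fun z => v z * (-B * q z.2 * p z.1) + vy z * (deriv q z.2 * p z.1))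
      (volume.restrict (box a b c d)) := by
    refine ((i3.const_mul (-B)).add (integrable_mul_continuous hvy s3.continuous)).congr
      (Eventually.of_forall fun z => ?_)
    simp only [Pi.add_apply]; ring
  have i0 : Integrable (fun z => vx z * (deriv p z.1 * q z.2) + vy z * (p z.1 * deriv q z.2))
      (volume.restrict (box a b c d)) :=
    (integrable_mul_continuous hx.memLp_deriv s1.continuous).add
      (integrable_mul_continuous hvy s3.continuous)
  rw [← integral_const_mul]
  have : ∫ z in box a b c d, ((vx z * (deriv p z.1 * q z.2) + vy z * (p z.1 * deriv q z.2)) -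
      ((v z * (-A * p z.1 * q z.2) + vx z * (deriv p z.1 * q z.2)) +
        (v z * (-B * q z.2 * p z.1) + vy z * (deriv q z.2 * p z.1)))) = 0 := by
    have i4 : Integrable (fun z => (v z * (-A * p z.1 * q z.2) + vx z * (deriv p z.1 * q z.2)) +
        (v z * (-B * q z.2 * p z.1) + vy z * (deriv q z.2 * p z.1)))
        (volume.restrict (box a b c d)) := i1.add i2
    rw [integral_sub i0 i4, integral_add i1 i2, e1, e2, h0]; simp
  rw [← this]
  refine integral_congr_ae (Eventually.of_forall fun z => ?_)
  simp only; ring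

lemma deriv_deriv_sin (w s : ℝ) (x : ℝ) :
    deriv (deriv fun x => Real.sin (w * x + s)) x = -w ^ 2 * Real.sin (w * x + s) := by
  have hl : ∀ x : ℝ, HasDerivAt (fun x => w * x + s) w x := fun x => by
    simpa using ((hasDerivAt_id x).const_mul w).add_const s
  have h1 : (deriv fun x => Real.sin (w * x + s)) = fun x => Real.cos (w * x + s) * w :=
    funext fun x => ((Real.hasDerivAt_sin _).comp x (hl x)).deriv
  rw [h1]
  have := ((Real.hasDerivAt_cos _).comp x (hl x)).mul_const w
  rw [show (fun x => Real.cos (w * x + s) * w) = fun x => (Real.cos ∘ fun x => w * x + s) x * w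
    from rfl, this.deriv]
  ring

lemma smooth_sin (w s : ℝ) : ContDiff ℝ ∞ fun x => Real.sin (w * x + s) :=
  Real.contDiff_sin.comp ((contDiff_const.mul contDiff_id).add contDiff_const)

/-- The functions `sin (j κ (x - a))` for integers `j`. -/
noncomputable def sinFamily (κ a : ℝ) (j : ℤ) : C(ℝ, ℝ) :=
  ⟨fun x => Real.sin (j * κ * x + -(j * κ * a)), (smooth_sin _ _).continuous⟩

/-- The function `cos (κ (x - a))`. -/
noncomputable def cosShift (κ a : ℝ) : C(ℝ, ℝ) :=
  ⟨fun x => Real.cos (κ * (x - a)), by fun_prop⟩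

/-- The functions `cos ((j + 1 / 2) π x)` for integers `j`. -/
noncomputable def cosFamily (j : ℤ) : C(ℝ, ℝ) :=
  ⟨fun x => Real.sin ((j + 1 / 2) * Real.pi * x + Real.pi / 2), (smooth_sin _ _).continuous⟩

lemma cosShift_mul_sinFamily (κ a : ℝ) (j : ℤ) (x : ℝ) : cosShift κ a x * sinFamily κ a j x =
    (sinFamily κ a (j + 1) x + sinFamily κ a (j - 1) x) / 2 := by
  simp only [cosShift, sinFamily, ContinuousMap.coe_mk]
  have e0 : (j : ℝ) * κ * x + -(j * κ * a) = j * κ * (x - a) := by ring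
  have e1 : ((j + 1 : ℤ) : ℝ) * κ * x + -((j + 1 : ℤ) * κ * a) =
      j * κ * (x - a) + κ * (x - a) := by push_cast; ring
  have e2 : ((j - 1 : ℤ) : ℝ) * κ * x + -((j - 1 : ℤ) * κ * a) =
      j * κ * (x - a) - κ * (x - a) := by push_cast; ring
  rw [e0, e1, e2, Real.sin_add, Real.sin_sub]; ring

lemma cosShift_mul_cosFamily (j : ℤ) (x : ℝ) : cosShift Real.pi 0 x * cosFamily j x =
    (cosFamily (j + 1) x + cosFamily (j - 1) x) / 2 := by
  simp only [cosShift, cosFamily, ContinuousMap.coe_mk, Real.sin_add_pi_div_two, sub_zero]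
  have e1 : (((j + 1 : ℤ) : ℝ) + 1 / 2) * Real.pi * x =
      (j + 1 / 2) * Real.pi * x + Real.pi * x := by push_cast; ring
  have e2 : (((j - 1 : ℤ) : ℝ) + 1 / 2) * Real.pi * x =
      (j + 1 / 2) * Real.pi * x - Real.pi * x := by push_cast; ring
  rw [e1, e2, Real.cos_add, Real.cos_sub]; ring

lemma injOn_cosShift {a b : ℝ} (hab : a < b) :
    InjOn (cosShift (Real.pi / (b - a)) a) (Icc a b) := by
  intro x hx y hy h
  have hb : 0 < b - a := sub_pos.2 hab
  have hmem : ∀ z ∈ Icc a b, Real.pi / (b - a) * (z - a) ∈ Icc 0 Real.pi := fun z hz => by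
    have h1 : 0 ≤ z - a := sub_nonneg.2 hz.1
    have h2 : z - a ≤ b - a := by linarith [hz.2]
    refine ⟨by positivity, ?_⟩
    rw [div_mul_eq_mul_div, div_le_iff₀ hb]
    exact mul_le_mul_of_nonneg_left h2 Real.pi_pos.le
  have := Real.injOn_cos (hmem x hx) (hmem y hy) h
  have h3 := mul_left_cancel₀ (div_pos Real.pi_pos hb).ne' this
  linarith

lemma sinFamily_one_ne_zero {a b : ℝ} (hab : a < b) :
    ∀ x ∈ Ioo a b, sinFamily (Real.pi / (b - a)) a 1 x ≠ 0 := by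
  intro x hx
  have hb : 0 < b - a := sub_pos.2 hab
  have h1 : 0 < x - a := sub_pos.2 hx.1
  have e : sinFamily (Real.pi / (b - a)) a 1 x = Real.sin (Real.pi / (b - a) * (x - a)) := by
    simp only [sinFamily, ContinuousMap.coe_mk]; congr 1; push_cast; ring
  rw [e]
  refine (Real.sin_pos_of_pos_of_lt_pi (by positivity) ?_).ne'
  rw [div_mul_eq_mul_div, div_lt_iff₀ hb]
  exact mul_lt_mul_of_pos_left (by linarith [hx.2]) Real.pi_pos

lemma sinFamily_left (κ a : ℝ) (j : ℤ) : sinFamily κ a j a = 0 := by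
  simp [sinFamily]

lemma sinFamily_right {a b : ℝ} (hab : a < b) (j : ℤ) :
    sinFamily (Real.pi / (b - a)) a j b = 0 := by
  have hb : b - a ≠ 0 := (sub_pos.2 hab).ne'
  have e : (j : ℝ) * (Real.pi / (b - a)) * b + -(j * (Real.pi / (b - a)) * a) = j * Real.pi := by
    field_simp; ring
  simp only [sinFamily, ContinuousMap.coe_mk, e, Real.sin_int_mul_pi]

/-- Uniqueness for the Dirichlet problem on a box. -/
theorem ae_eq_zero_of_dirichlet {a b c d : ℝ} (hab : a < b) (hcd : c < d) {v vx vy t t' : Plane → ℝ}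
    (hx : HasXTrace a b c d v vx t)
    (hy : HasXTrace c d a b (v ∘ Prod.swap) (vy ∘ Prod.swap) t')
    (ha : ∀ᵐ y ∂(volume.restrict (Ioo c d)), t (a, y) = 0)
    (hb : ∀ᵐ y ∂(volume.restrict (Ioo c d)), t (b, y) = 0)
    (hc : ∀ᵐ y ∂(volume.restrict (Ioo a b)), t' (c, y) = 0)
    (hd : ∀ᵐ y ∂(volume.restrict (Ioo a b)), t' (d, y) = 0)
    (h : IsDivFree (box a b c d) (box a b c d) vx vy) :
    v =ᵐ[volume.restrict (box a b c d)] 0 := by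
  set κ := Real.pi / (b - a) with hκ
  set ξ := Real.pi / (d - c) with hξ
  have hκ0 : κ ≠ 0 := (div_pos Real.pi_pos (sub_pos.2 hab)).ne'
  refine ae_eq_zero_of_integral_mul_eq_zero hx.memLp (cosShift_mul_sinFamily κ a)
    (cosShift_mul_sinFamily ξ c) (injOn_cosShift hab) (injOn_cosShift hcd) (j₀ := 1) (k₀ := 1)
    (sinFamily_one_ne_zero hab) (sinFamily_one_ne_zero hcd) fun j k => ?_
  rcases eq_or_ne j 0 with rfl | hj
  · simp [sinFamily]
  have s1 : ContDiff ℝ ∞ (sinFamily κ a j) := smooth_sin _ _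
  have s2 : ContDiff ℝ ∞ (sinFamily ξ c k) := smooth_sin _ _
  have h0 := h.integral_eq_zero (φ := fun z => sinFamily κ a j z.1 * sinFamily ξ c k z.2)
    hx.memLp_deriv (memLp_swap hy.memLp_deriv) ((smooth_fst s1).mul (smooth_snd s2))
    (by simp [sinFamily_left]) (by simp [hκ, sinFamily_right hab]) (by simp [sinFamily_left])
    (by simp [hξ, sinFamily_right hcd])
  have := integral_mul_eigenfunction hx hy s1 s2 (deriv_deriv_sin _ _) (deriv_deriv_sin _ _)
    (Or.inl ha) (Or.inl hb) (Or.inl hc) (Or.inl hd) h0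
  refine (mul_eq_zero.1 this).resolve_left ?_
  have h1 : (j : ℝ) * κ ≠ 0 := mul_ne_zero (Int.cast_ne_zero.2 hj) hκ0
  positivity

lemma smooth_cosFamily (j : ℤ) : ContDiff ℝ ∞ (cosFamily j) := smooth_sin _ _

lemma cosFamily_apply (j : ℤ) (x : ℝ) : cosFamily j x = Real.cos ((j + 1 / 2) * Real.pi * x) :=
  Real.sin_add_pi_div_two _

lemma cosFamily_neg (j : ℤ) (x : ℝ) : cosFamily j (-x) = cosFamily j x := by
  rw [cosFamily_apply, cosFamily_apply, mul_neg, Real.cos_neg]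

lemma cosFamily_one (j : ℤ) : cosFamily j 1 = 0 := by
  rw [cosFamily_apply, Real.cos_eq_zero_iff]
  exact ⟨j, by ring⟩

lemma deriv_cosFamily_zero (j : ℤ) : deriv (cosFamily j) 0 = 0 := by
  have h1 : HasDerivAt (cosFamily j) (deriv (cosFamily j) 0) 0 :=
    ((smooth_cosFamily j).differentiable (by simp) 0).hasDerivAt
  have h2 : HasDerivAt (fun x => cosFamily j (-x)) (-deriv (cosFamily j) 0) 0 := by
    have h3 : HasDerivAt (cosFamily j) (deriv (cosFamily j) 0) (-0) := by rwa [neg_zero]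
    have := h3.comp (0 : ℝ) (hasDerivAt_neg 0)
    rw [mul_neg_one] at this; exact this
  simp only [cosFamily_neg] at h2
  have := h1.unique h2
  linarith

/-- Uniqueness for the mixed problem on the unit square: homogeneous Dirichlet condition on the
outer sides, homogeneous Neumann condition, in the sense of distributions on the open sides, on the
sides that lie on the axes. -/
theorem ae_eq_zero_of_mixed {v vx vy t t' : Plane → ℝ} (hx : HasXTrace 0 1 0 1 v vx t)
    (hy : HasXTrace 0 1 0 1 (v ∘ Prod.swap) (vy ∘ Prod.swap) t')
    (hb : ∀ᵐ y ∂(volume.restrict (Ioo (0 : ℝ) 1)), t (1, y) = 0)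
    (hd : ∀ᵐ y ∂(volume.restrict (Ioo (0 : ℝ) 1)), t' (1, y) = 0)
    (h1 : IsDivFree (box 0 1 0 1) (box 0 1 (-1) 1) vx vy)
    (h2 : IsDivFree (box 0 1 0 1) (box (-1) 1 0 1) vx vy) :
    v =ᵐ[volume.restrict (box 0 1 0 1)] 0 := by
  have hinj : InjOn (cosShift Real.pi 0) (Icc 0 1) := by
    have := injOn_cosShift (zero_lt_one' ℝ)
    rwa [sub_zero, div_one] at this
  have hne : ∀ x ∈ Ioo (0 : ℝ) 1, cosFamily 0 x ≠ 0 := by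
    intro x hx
    rw [cosFamily_apply]
    refine (Real.cos_pos_of_mem_Ioo ⟨?_, ?_⟩).ne' <;>
    · push_cast; nlinarith [hx.1, hx.2, Real.pi_pos]
  refine ae_eq_zero_of_integral_mul_eq_zero hx.memLp cosShift_mul_cosFamily
    cosShift_mul_cosFamily hinj hinj (j₀ := 0) (k₀ := 0) hne hne fun j k => ?_
  have s1 := smooth_cosFamily j
  have s2 := smooth_cosFamily k
  have h0 := integral_eq_zero_of_mixed (φ := fun z => cosFamily j z.1 * cosFamily k z.2) h1 h2
    hx.memLp_deriv (memLp_swap hy.memLp_deriv) ((smooth_fst s1).mul (smooth_snd s2))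
    (by simp [cosFamily_neg, cosFamily_one]) (by simp [cosFamily_one])
    (by simp [cosFamily_neg, cosFamily_one]) (by simp [cosFamily_one])
  have := integral_mul_eigenfunction hx hy s1 s2 (deriv_deriv_sin _ _) (deriv_deriv_sin _ _)
    (Or.inr (deriv_cosFamily_zero j)) (Or.inl hb) (Or.inr (deriv_cosFamily_zero k)) (Or.inl hd) h0
  refine (mul_eq_zero.1 this).resolve_left ?_
  have hj : (j : ℝ) + 1 / 2 ≠ 0 := fun h => by
    have : (2 * j + 1 : ℤ) = 0 := by
      have : ((2 * j + 1 : ℤ) : ℝ) = 0 := by push_cast; linarith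
      exact_mod_cast this
    omega
  have h3 : ((j : ℝ) + 1 / 2) * Real.pi ≠ 0 := mul_ne_zero hj Real.pi_ne_zero
  positivity

/-! ### Functions in `H¹` of a rectangle with their derivatives and traces -/

lemma IsTest.swap {a b c d : ℝ} {φ : Plane → ℝ} (h : IsTest (box c d a b) φ) :
    IsTest (box a b c d) (φ ∘ Prod.swap) := by
  refine isTest_of_eq_zero (K := Prod.swap '' tsupport φ) (smooth_swap h.1)
    (h.2.1.isCompact.image continuous_swap) ?_ ?_
  · rintro _ ⟨p, hp, rfl⟩; exact (h.2.2 hp).symm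
  · intro p hp
    exact image_eq_zero_of_notMem_tsupport (f := φ) fun h' => hp ⟨_, h', Prod.swap_swap p⟩

lemma IsWeakPartial.swap {a b c d : ℝ} {e : Plane} {v w : Plane → ℝ}
    (h : IsWeakPartial (box a b c d) e v w) :
    IsWeakPartial (box c d a b) e.swap (v ∘ Prod.swap) (w ∘ Prod.swap) := by
  intro φ hφ
  have := h _ hφ.swap
  rw [← setIntegral_swap fun p => v p * fderiv ℝ (φ ∘ Prod.swap) p e,
    ← setIntegral_swap fun p => w p * (φ ∘ Prod.swap) p] at this
  simpa only [fderiv_swap hφ.1, Function.comp_apply, Prod.swap_swap] using this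

lemma IsWeakPartial.ae_unique {a b c d : ℝ} {e : Plane} {v w w' : Plane → ℝ}
    (h : IsWeakPartial (box a b c d) e v w) (h' : IsWeakPartial (box a b c d) e v w')
    (hw : MemLp w 2 (volume.restrict (box a b c d)))
    (hw' : MemLp w' 2 (volume.restrict (box a b c d))) :
    w =ᵐ[volume.restrict (box a b c d)] w' := by
  have := ae_eq_zero_box (hw.sub hw') fun φ hφ => by
    simp only [Pi.sub_apply, sub_mul]
    rw [integral_sub (integrable_mul_continuous hw hφ.1.continuous)
      (integrable_mul_continuous hw' hφ.1.continuous)]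
    have := (h φ hφ).symm.trans (h' φ hφ)
    linarith
  filter_upwards [this] with p hp using sub_eq_zero.1 hp

lemma weakPartial_spec {U : Set Plane} {e : Plane} {v : Plane → ℝ} (h : HasL2WeakPartial U e v) :
    MemLp (weakPartial U e v) 2 (volume.restrict U) ∧ IsWeakPartial U e v (weakPartial U e v) := by
  rw [weakPartial, dif_pos h]
  exact h.choose_spec

lemma weakPartial_ae_eq {a b c d : ℝ} {e : Plane} {v w : Plane → ℝ}
    (h : IsWeakPartial (box a b c d) e v w) (hw : MemLp w 2 (volume.restrict (box a b c d))) :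
    weakPartial (box a b c d) e v =ᵐ[volume.restrict (box a b c d)] w := by
  have := weakPartial_spec ⟨w, hw, h⟩
  exact this.2.ae_unique h this.1 hw

lemma ae_arc_iff {R : Rect} {P : Plane → Prop} : (∀ᵐ p ∂(R.arc), P p) ↔
    ((∀ᵐ y ∂(volume.restrict (Ioo R.c R.d)), P (R.a, y)) ∧
      ∀ᵐ y ∂(volume.restrict (Ioo R.c R.d)), P (R.b, y)) ∧
    (∀ᵐ x ∂(volume.restrict (Ioo R.a R.b)), P (x, R.c)) ∧
      ∀ᵐ x ∂(volume.restrict (Ioo R.a R.b)), P (x, R.d) := by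
  rw [Rect.arc, ae_add_measure_iff, ae_add_measure_iff, ae_add_measure_iff, vArc, vArc, hArc, hArc,
    (measurableEmbedding_prodMk_left _).ae_map_iff, (measurableEmbedding_prodMk_left _).ae_map_iff,
    (measurableEmbedding_prod_mk_right _).ae_map_iff,
    (measurableEmbedding_prod_mk_right _).ae_map_iff, and_assoc]

lemma memLp_arc_iff {R : Rect} {t : Plane → ℝ} : MemLp t 2 R.arc ↔
    (MemLp (fun y => t (R.a, y)) 2 (volume.restrict (Ioo R.c R.d)) ∧
      MemLp (fun y => t (R.b, y)) 2 (volume.restrict (Ioo R.c R.d))) ∧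
    MemLp (fun x => t (x, R.c)) 2 (volume.restrict (Ioo R.a R.b)) ∧
      MemLp (fun x => t (x, R.d)) 2 (volume.restrict (Ioo R.a R.b)) := by
  have hadd : ∀ μ ν : Measure Plane, MemLp t 2 (μ + ν) ↔ MemLp t 2 μ ∧ MemLp t 2 ν := by
    intro μ ν
    refine ⟨fun h => ⟨h.left_of_add_measure, h.right_of_add_measure⟩, fun h => ?_⟩
    have hm := h.1.aestronglyMeasurable.add_measure h.2.aestronglyMeasurable
    rw [memLp_two_iff_integrable_sq hm]
    exact h.1.integrable_sq.add_measure h.2.integrable_sq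
  rw [Rect.arc, hadd, hadd, hadd, vArc, vArc, hArc, hArc,
    (measurableEmbedding_prodMk_left _).memLp_map_measure_iff,
    (measurableEmbedding_prodMk_left _).memLp_map_measure_iff,
    (measurableEmbedding_prod_mk_right _).memLp_map_measure_iff,
    (measurableEmbedding_prod_mk_right _).memLp_map_measure_iff, and_assoc]
  rfl

/-- `v ∈ H¹(R)` has the weak gradient `(vx, vy)` and the trace `t` on `∂R`. -/
structure TracedH1 (R : Rect) (v vx vy t : Plane → ℝ) : Prop where
  x : HasXTrace R.a R.b R.c R.d v vx t
  y : HasXTrace R.c R.d R.a R.b (v ∘ Prod.swap) (vy ∘ Prod.swap) (t ∘ Prod.swap)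

lemma ae_swap {a b c d : ℝ} {v w : Plane → ℝ} (h : v =ᵐ[volume.restrict (box a b c d)] w) :
    v ∘ Prod.swap =ᵐ[volume.restrict (box c d a b)] w ∘ Prod.swap :=
  (measurePreserving_swap_box a b c d).quasiMeasurePreserving.ae_eq_comp h

lemma ae_of_swap {a b c d : ℝ} {v w : Plane → ℝ}
    (h : v ∘ Prod.swap =ᵐ[volume.restrict (box c d a b)] w ∘ Prod.swap) :
    v =ᵐ[volume.restrict (box a b c d)] w := ae_swap h

namespace TracedH1

variable {R R' : Rect} {v vx vy t v' vx' vy' t' : Plane → ℝ}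

lemma memLp (h : TracedH1 R v vx vy t) : MemLp v 2 (volume.restrict R.set) := h.x.memLp

lemma memLp_x (h : TracedH1 R v vx vy t) : MemLp vx 2 (volume.restrict R.set) := h.x.memLp_deriv

lemma memLp_y (h : TracedH1 R v vx vy t) : MemLp vy 2 (volume.restrict R.set) :=
  memLp_swap h.y.memLp_deriv

lemma isWeakPartial_x (h : TracedH1 R v vx vy t) : IsWeakPartial R.set (1, 0) v vx :=
  h.x.isWeakPartial

lemma isWeakPartial_y (h : TracedH1 R v vx vy t) : IsWeakPartial R.set (0, 1) v vy :=
  h.y.isWeakPartial.swap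

lemma memH1 (h : TracedH1 R v vx vy t) : MemH1 R.set v :=
  ⟨h.memLp, ⟨vx, h.memLp_x, h.isWeakPartial_x⟩, ⟨vy, h.memLp_y, h.isWeakPartial_y⟩⟩

lemma wdx_ae (h : TracedH1 R v vx vy t) : wdx R.set v =ᵐ[volume.restrict R.set] vx :=
  weakPartial_ae_eq h.isWeakPartial_x h.memLp_x

lemma wdy_ae (h : TracedH1 R v vx vy t) : wdy R.set v =ᵐ[volume.restrict R.set] vy :=
  weakPartial_ae_eq h.isWeakPartial_y h.memLp_y

lemma hasTrace (h : TracedH1 R v vx vy t) : HasTrace R v t := by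
  refine ⟨memLp_arc_iff.2 ⟨⟨h.x.memLp_left, h.x.memLp_right⟩, h.y.memLp_left, h.y.memLp_right⟩,
    fun φ hφ => ⟨?_, ?_⟩⟩
  · rw [vArc, vArc, (measurableEmbedding_prodMk_left _).integral_map,
      (measurableEmbedding_prodMk_left _).integral_map, ← h.x.ibp φ hφ]
    refine integral_congr_ae ?_
    filter_upwards [h.wdx_ae] with p hp
    rw [hp]
  · have := h.y.ibp _ (smooth_swap hφ)
    rw [← setIntegral_swap] at this
    simp only [dx_swap hφ, Function.comp_apply, Prod.swap_swap, Prod.swap_prod_mk] at this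
    rw [hArc, hArc, (measurableEmbedding_prod_mk_right _).integral_map,
      (measurableEmbedding_prod_mk_right _).integral_map, ← this]
    refine integral_congr_ae ?_
    filter_upwards [h.wdy_ae] with p hp
    rw [hp]

lemma of_hasTrace (hv : MemH1 R.set v) (h : HasTrace R v t) :
    TracedH1 R v (wdx R.set v) (wdy R.set v) t := by
  obtain ⟨⟨h1, h2⟩, h3, h4⟩ := memLp_arc_iff.1 h.1
  refine ⟨⟨hv.1, (weakPartial_spec hv.2.1).1, h1, h2, fun φ hφ => ?_⟩,
    ⟨memLp_swap hv.1, memLp_swap (weakPartial_spec hv.2.2).1, h3, h4, fun φ hφ => ?_⟩⟩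
  · have := (h.2 φ hφ).1
    rwa [vArc, vArc, (measurableEmbedding_prodMk_left _).integral_map,
      (measurableEmbedding_prodMk_left _).integral_map] at this
  · have := (h.2 _ (smooth_swap hφ)).2
    rw [hArc, hArc, (measurableEmbedding_prod_mk_right _).integral_map,
      (measurableEmbedding_prod_mk_right _).integral_map] at this
    simp only [dy_swap hφ, Function.comp_apply, Prod.swap_prod_mk] at this ⊢
    rw [← this, Rect.set, ← setIntegral_swap]
    simp only [Prod.swap_swap]

lemma congr (h : TracedH1 R v vx vy t) (hv : v =ᵐ[volume.restrict R.set] v')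
    (hx : vx =ᵐ[volume.restrict R.set] vx') (hy : vy =ᵐ[volume.restrict R.set] vy')
    (ht : ∀ᵐ p ∂(R.arc), t p = t' p) : TracedH1 R v' vx' vy' t' := by
  obtain ⟨⟨h1, h2⟩, h3, h4⟩ := ae_arc_iff.1 ht
  exact ⟨h.x.congr hv hx h1 h2, h.y.congr (ae_swap hv) (ae_swap hy) h3 h4⟩

lemma add (h : TracedH1 R v vx vy t) (h' : TracedH1 R v' vx' vy' t') :
    TracedH1 R (fun p => v p + v' p) (fun p => vx p + vx' p) (fun p => vy p + vy' p)
      (fun p => t p + t' p) := ⟨h.x.add h'.x, h.y.add h'.y⟩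

lemma sub (h : TracedH1 R v vx vy t) (h' : TracedH1 R v' vx' vy' t') :
    TracedH1 R (fun p => v p - v' p) (fun p => vx p - vx' p) (fun p => vy p - vy' p)
      (fun p => t p - t' p) := ⟨h.x.sub h'.x, h.y.sub h'.y⟩

lemma const_mul (h : TracedH1 R v vx vy t) (k : ℝ) :
    TracedH1 R (fun p => k * v p) (fun p => k * vx p) (fun p => k * vy p)
      (fun p => k * t p) := ⟨h.x.const_mul k, h.y.const_mul k⟩

lemma unique (hab : R.a < R.b) (hcd : R.c < R.d) (h : TracedH1 R v vx vy t)
    (h' : TracedH1 R v' vx' vy' t') (hv : v =ᵐ[volume.restrict R.set] v') :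
    vx =ᵐ[volume.restrict R.set] vx' ∧ vy =ᵐ[volume.restrict R.set] vy' ∧
      ∀ᵐ p ∂(R.arc), t p = t' p := by
  obtain ⟨h1, h2, h3⟩ := h.x.unique hab h'.x hv
  obtain ⟨h4, h5, h6⟩ := h.y.unique hcd h'.y (ae_swap hv)
  exact ⟨h1, ae_of_swap h4, ae_arc_iff.2 ⟨⟨h2, h3⟩, h5, h6⟩⟩

/-- Uniqueness for the Dirichlet problem. -/
lemma ae_eq_zero (hab : R.a < R.b) (hcd : R.c < R.d) (h : TracedH1 R v vx vy t)
    (hd : IsDivFree R.set R.set vx vy) (ht : ∀ᵐ p ∂(R.arc), t p = 0) :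
    v =ᵐ[volume.restrict R.set] 0 := by
  obtain ⟨⟨h1, h2⟩, h3, h4⟩ := ae_arc_iff.1 ht
  exact ae_eq_zero_of_dirichlet hab hcd h.x h.y h1 h2 h3 h4 hd

end TracedH1

/-- A function that is continuous up to the closed rectangle is its own trace. -/
lemma tracedH1_of_continuousOn {R : Rect} (hab : R.a < R.b) (hcd : R.c < R.d)
    {v vx vy : Plane → ℝ} (hv : ContinuousOn v (Icc R.a R.b ×ˢ Icc R.c R.d))
    (hx : MemLp vx 2 (volume.restrict R.set)) (hy : MemLp vy 2 (volume.restrict R.set))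
    (hwx : IsWeakPartial R.set (1, 0) v vx) (hwy : IsWeakPartial R.set (0, 1) v vy) :
    TracedH1 R v vx vy v :=
  ⟨hasXTrace_of_continuousOn hab hcd hv hx hwx,
    hasXTrace_of_continuousOn hcd hab (hv.comp continuous_swap.continuousOn fun _ hp => hp.symm)
      (memLp_swap hy) hwy.swap⟩

/-- The rectangle `R'` is the image of `R` under the reflection with the signs `s` and `t`. -/
def Rect.IsRefl (s t : ℝ) (R R' : Rect) : Prop :=
  (s = 1 ∧ R'.a = R.a ∧ R'.b = R.b ∨ s = -1 ∧ R'.a = -R.b ∧ R'.b = -R.a) ∧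
  (t = 1 ∧ R'.c = R.c ∧ R'.d = R.d ∨ t = -1 ∧ R'.c = -R.d ∧ R'.d = -R.c)

namespace Rect.IsRefl

variable {s t : ℝ} {R R' : Rect}

lemma symm (h : R.IsRefl s t R') : R'.IsRefl s t R := by
  obtain ⟨⟨rfl, h1, h2⟩ | ⟨rfl, h1, h2⟩, ⟨rfl, h3, h4⟩ | ⟨rfl, h3, h4⟩⟩ := h <;>
  simp [Rect.IsRefl, h1, h2, h3, h4]

lemma sq_left (h : R.IsRefl s t R') : s * s = 1 := by
  rcases h.1 with ⟨rfl, -⟩ | ⟨rfl, -⟩ <;> norm_num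

lemma sq_right (h : R.IsRefl s t R') : t * t = 1 := by
  rcases h.2 with ⟨rfl, -⟩ | ⟨rfl, -⟩ <;> norm_num

lemma set_eq (h : R.IsRefl s t R') : R'.set = refl s t ⁻¹' R.set := by
  obtain ⟨⟨rfl, h1, h2⟩ | ⟨rfl, h1, h2⟩, ⟨rfl, h3, h4⟩ | ⟨rfl, h3, h4⟩⟩ := h <;>
  · ext p
    simp only [Rect.set, mem_prod, mem_Ioo, refl, mem_preimage, h1, h2, h3, h4]
    constructor <;> rintro ⟨⟨h1, h2⟩, h3, h4⟩ <;> refine ⟨⟨?_, ?_⟩, ?_, ?_⟩ <;> linarith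

lemma ae_comp (h : R.IsRefl s t R') {v w : Plane → ℝ} (hv : v =ᵐ[volume.restrict R.set] w) :
    v ∘ refl s t =ᵐ[volume.restrict R'.set] w ∘ refl s t := by
  rw [h.set_eq]
  exact (measurePreserving_refl_restrict h.sq_left h.sq_right _).quasiMeasurePreserving.ae_eq_comp hv

end Rect.IsRefl

lemma refl_one_one : refl 1 1 = id := by
  funext p; simp [refl]

namespace TracedH1

variable {R R' : Rect} {v vx vy t : Plane → ℝ}

lemma reflect {σ τ : ℝ} (hR : R.IsRefl σ τ R') (h : TracedH1 R v vx vy t) :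
    TracedH1 R' (v ∘ refl σ τ) (fun p => σ * vx (refl σ τ p)) (fun p => τ * vy (refl σ τ p))
      (t ∘ refl σ τ) := by
  have hX : ∀ {R : Rect} {v vx vy t : Plane → ℝ}, TracedH1 R v vx vy t →
      TracedH1 ⟨-R.b, -R.a, R.c, R.d⟩ (v ∘ refl (-1) 1) (fun p => -vx (refl (-1) 1 p))
        (fun p => vy (refl (-1) 1 p)) (t ∘ refl (-1) 1) := fun h =>
    ⟨h.x.reflX, h.y.reflY⟩
  have hY : ∀ {R : Rect} {v vx vy t : Plane → ℝ}, TracedH1 R v vx vy t →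
      TracedH1 ⟨R.a, R.b, -R.d, -R.c⟩ (v ∘ refl 1 (-1)) (fun p => vx (refl 1 (-1) p))
        (fun p => -vy (refl 1 (-1) p)) (t ∘ refl 1 (-1)) := fun h =>
    ⟨h.x.reflY, h.y.reflX⟩
  have hcomp : refl (-1) 1 ∘ refl 1 (-1) = refl (-1) (-1) := by funext p; simp [refl]
  obtain ⟨a, b, c, d⟩ := R'
  obtain ⟨⟨rfl, h1, h2⟩ | ⟨rfl, h1, h2⟩, ⟨rfl, h3, h4⟩ | ⟨rfl, h3, h4⟩⟩ := hR <;>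
    simp only at h1 h2 h3 h4 <;> subst h1 h2 h3 h4
  · simpa [refl_one_one] using h
  · simpa using hY h
  · simpa using hX h
  · have := hY (hX h)
    simp only [Function.comp_assoc, hcomp] at this
    simpa [refl] using this

end TracedH1

/-! ### The four subsquares -/

/-- The sign of the first coordinate in the `i`-th subsquare. -/
def signX : Fin 4 → ℝ := ![-1, 1, 1, -1]

/-- The sign of the second coordinate in the `i`-th subsquare. -/
def signY : Fin 4 → ℝ := ![-1, -1, 1, 1]

lemma isRefl_subRect (i : Fin 4) : (subRect 2).IsRefl (signX i) (signY i) (subRect i) := by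
  fin_cases i <;> simp [Rect.IsRefl, subRect, signX, signY]

lemma isRefl_subRect_add_two (i : Fin 4) : (subRect (i + 2)).IsRefl (-1) (-1) (subRect i) := by
  fin_cases i <;> simp [Rect.IsRefl, subRect, Fin.add_def]

lemma isRefl_square : square.IsRefl (-1) (-1) square := by
  simp [Rect.IsRefl, square]

lemma subRect_lt (i : Fin 4) : (subRect i).a < (subRect i).b ∧ (subRect i).c < (subRect i).d := by
  fin_cases i <;> simp [subRect]

lemma refl_neg_neg : refl (-1) (-1) = fun p : Plane => -p := by
  funext p; simp only [refl, neg_one_mul]; rfl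

/-- An `H¹₀(Ω)` function that is even has one even function as its trace on all four subsquares. -/
lemma exists_even_trace {v vx vy : Plane → ℝ} (h : TracedH1 square v vx vy 0)
    (heven : (fun p => v (-p)) =ᵐ[volume.restrict Omega] v) :
    ∃ t : Plane → ℝ, (∀ p, t (-p) = t p) ∧ (∀ p : Plane, |p.1| = 1 ∨ |p.2| = 1 → t p = 0) ∧
      ∀ i, TracedH1 (subRect i) v vx vy t := by
  obtain ⟨s, hs⟩ := h.x.split (m := 0) (by simp [square]) (by simp [square])
  obtain ⟨s', hs'⟩ := h.y.split (m := 0) (by simp [square]) (by simp [square])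
  classical
  let t : Plane → ℝ := fun p => if |p.1| = 1 ∨ |p.2| = 1 then 0 else
    if p.1 = 0 then s p.2 else if p.2 = 0 then s' p.1 else 0
  have hne : ∀ᵐ x : ℝ, x ≠ 0 := by simp [ae_iff]
  have habs : ∀ x ∈ Ioo (-1 : ℝ) 1, |x| ≠ 1 := fun x hx => (abs_lt.2 hx).ne
  obtain ⟨hL, hR⟩ := hs t (by
      filter_upwards [ae_restrict_mem measurableSet_Ioo] with y hy
      simp [t, habs y hy])
    (Eventually.of_forall fun y => by simp [t, square])
    (Eventually.of_forall fun y => by simp [t, square])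
  obtain ⟨hL', hR'⟩ := hs' (t ∘ Prod.swap) (by
      filter_upwards [ae_restrict_mem measurableSet_Ioo, ae_restrict_of_ae hne] with y hy hy0
      simp [t, habs y hy, hy0])
    (Eventually.of_forall fun y => by simp [t, square])
    (Eventually.of_forall fun y => by simp [t, square])
  have ht : ∀ i, TracedH1 (subRect i) v vx vy t := by
    intro i
    fin_cases i
    · exact ⟨hL.mono_snd (c' := -1) (d' := 0) (by simp [square]) (by simp [square]),
        hL'.mono_snd (c' := -1) (d' := 0) (by simp [square]) (by simp [square])⟩
    · exact ⟨hR.mono_snd (c' := -1) (d' := 0) (by simp [square]) (by simp [square]),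
        hL'.mono_snd (c' := 0) (d' := 1) (by simp [square]) (by simp [square])⟩
    · exact ⟨hR.mono_snd (c' := 0) (d' := 1) (by simp [square]) (by simp [square]),
        hR'.mono_snd (c' := 0) (d' := 1) (by simp [square]) (by simp [square])⟩
    · exact ⟨hL.mono_snd (c' := 0) (d' := 1) (by simp [square]) (by simp [square]),
        hR'.mono_snd (c' := -1) (d' := 0) (by simp [square]) (by simp [square])⟩
  have hsub : ∀ i, (subRect i).set ⊆ Omega := by
    intro i
    fin_cases i <;> refine prod_mono (Ioo_subset_Ioo ?_ ?_) (Ioo_subset_Ioo ?_ ?_) <;>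
      simp [subRect, square]
  refine ⟨fun p => 1 / 2 * (t p + t (-p)), fun p => by simp only [neg_neg, add_comm],
    fun p hp => ?_,
    fun i => ?_⟩
  · have hp' : |(-p).1| = 1 ∨ |(-p).2| = 1 := by simpa using hp
    simp only [t, if_pos hp, if_pos hp']; simp
  · have h1 := (ht (i + 2)).reflect (isRefl_subRect_add_two i)
    rw [refl_neg_neg] at h1
    have hvi : v =ᵐ[volume.restrict (subRect i).set] fun p => v (-p) :=
      (ae_restrict_of_ae_restrict_of_subset (hsub i) heven).mono fun p hp => hp.symm
    obtain ⟨hx, hy, -⟩ := (ht i).unique (subRect_lt i).1 (subRect_lt i).2 h1 hvi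
    refine (((ht i).add h1).const_mul (1 / 2)).congr ?_ ?_ ?_
      (Eventually.of_forall fun p => rfl)
    · filter_upwards [hvi] with p hp
      simp only [Function.comp_apply, ← hp]; ring
    · filter_upwards [hx] with p hp
      rw [← hp]; ring
    · filter_upwards [hy] with p hp
      rw [← hp]; ring

/-! ### Harmonic functions with given traces -/

lemma IsTest.hasXTrace {a b c d : ℝ} {φ : Plane → ℝ} (hφ : IsTest (box a b c d) φ) :
    HasXTrace a b c d φ (dx φ) 0 where
  memLp := memLp_box_of_continuous hφ.1.continuous a b c d
  memLp_deriv := memLp_box_of_continuous (smooth_dx hφ.1).continuous a b c d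
  memLp_left := MemLp.zero
  memLp_right := MemLp.zero
  ibp ψ hψ := by
    have hcs : HasCompactSupport (dx φ) := hφ.2.1.fderiv_apply ℝ (1, 0)
    have i1 : Integrable (fun p => φ p * dx ψ p) :=
      (hφ.1.continuous.mul (smooth_dx hψ).continuous).integrable_of_hasCompactSupport
        hφ.2.1.mul_right
    have i2 : Integrable (fun p => dx φ p * ψ p) :=
      ((smooth_dx hφ.1).continuous.mul hψ.continuous).integrable_of_hasCompactSupport
        hcs.mul_right
    have i3 : Integrable (fun p => φ p * ψ p) :=
      (hφ.1.continuous.mul hψ.continuous).integrable_of_hasCompactSupport hφ.2.1.mul_right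
    have h := integral_mul_fderiv_eq_neg_fderiv_mul_of_integrable (μ := (volume : Measure Plane))
      (v := ((1, 0) : Plane)) i2 i1 i3 (fun x _ => smooth_diff hφ.1 x)
      (fun x _ => smooth_diff hψ x)
    have h0 : ∫ p, (φ p * dx ψ p + dx φ p * ψ p) = 0 := by
      rw [integral_add i1 i2]
      exact eq_neg_iff_add_eq_zero.1 h
    simp only [Pi.zero_apply, zero_mul, integral_zero, sub_zero]
    rw [← h0]
    refine setIntegral_eq_integral_of_forall_compl_eq_zero fun p hp => ?_
    have hp' : dx φ p = 0 := image_eq_zero_of_notMem_tsupport (f := dx φ)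
      fun h' => hp (hφ.2.2 (tsupport_fderiv_apply_subset ℝ (1, 0) h'))
    rw [hφ.eq_zero hp, hp', zero_mul, zero_mul, zero_add]

/-- Poincaré inequality for test functions, from `∫ φ² = -2 ∫ (x - a) φ ∂ₓφ`. -/
lemma IsTest.poincare {a b c d : ℝ} {φ : Plane → ℝ} (hφ : IsTest (box a b c d) φ) :
    ∫ p in box a b c d, φ p ^ 2 ≤ (2 * (b - a)) ^ 2 * ∫ p in box a b c d, dx φ p ^ 2 := by
  have hs : ContDiff ℝ ∞ fun p : Plane => (p.1 - a) * φ p :=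
    (contDiff_fst.sub contDiff_const).mul hφ.1
  have hd : ∀ p, dx (fun p : Plane => (p.1 - a) * φ p) p = φ p + (p.1 - a) * dx φ p := fun p => by
    rw [dx_mul (contDiff_fst.sub contDiff_const) hφ.1,
      dx_fst (χ := fun x => x - a) (contDiff_id.sub contDiff_const)]
    simp
  have h := hφ.hasXTrace.ibp _ hs
  simp only [hd, Pi.zero_apply, zero_mul, integral_zero, sub_zero] at h
  have i1 : Integrable (fun p => φ p ^ 2) (volume.restrict (box a b c d)) :=
    hφ.hasXTrace.memLp.integrable_sq
  have i2 : Integrable (fun p => dx φ p ^ 2) (volume.restrict (box a b c d)) :=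
    hφ.hasXTrace.memLp_deriv.integrable_sq
  have i3 : Integrable (fun p : Plane => φ p * ((p.1 - a) * dx φ p))
      (volume.restrict (box a b c d)) := integrable_mul_continuous hφ.hasXTrace.memLp
    ((continuous_fst.sub continuous_const).mul (smooth_dx hφ.1).continuous)
  have e : ∫ p in box a b c d, φ p ^ 2 =
      -2 * ∫ p in box a b c d, φ p * ((p.1 - a) * dx φ p) := by
    have : ∀ p : Plane, φ p * (φ p + (p.1 - a) * dx φ p) + dx φ p * ((p.1 - a) * φ p) =
        φ p ^ 2 + 2 * (φ p * ((p.1 - a) * dx φ p)) := fun p => by ring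
    simp only [this] at h
    rw [integral_add i1 (i3.const_mul 2), integral_const_mul] at h
    linarith
  have hle : -2 * ∫ p in box a b c d, φ p * ((p.1 - a) * dx φ p) ≤
      (1 / 2) * (∫ p in box a b c d, φ p ^ 2) +
        2 * (b - a) ^ 2 * ∫ p in box a b c d, dx φ p ^ 2 := by
    rw [← integral_const_mul, ← integral_const_mul, ← integral_const_mul,
      ← integral_add (i1.const_mul _) (i2.const_mul _)]
    refine integral_mono_ae (i3.const_mul _) ((i1.const_mul _).add (i2.const_mul _)) ?_
    filter_upwards [ae_restrict_mem (measurableSet_box a b c d)] with p hp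
    have h1 : 0 ≤ p.1 - a := by linarith [hp.1.1]
    have h2 : p.1 - a ≤ b - a := by linarith [hp.1.2]
    have h3 : (p.1 - a) ^ 2 * dx φ p ^ 2 ≤ (b - a) ^ 2 * dx φ p ^ 2 :=
      mul_le_mul_of_nonneg_right (pow_le_pow_left₀ h1 h2 2) (sq_nonneg _)
    nlinarith [sq_nonneg (φ p + 2 * ((p.1 - a) * dx φ p))]
  rw [← e] at hle
  linarith

lemma norm_sq_L2 {α : Type*} [MeasurableSpace α] {μ : Measure α} (f : Lp ℝ 2 μ) :
    ‖f‖ ^ 2 = ∫ p, f p ^ 2 ∂μ := by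
  rw [← real_inner_self_eq_norm_sq, L2.inner_def]
  simp [sq]

lemma tendsto_integral_of_tendsto_L2 {α : Type*} [MeasurableSpace α] {μ : Measure α}
    {f : ℕ → Lp ℝ 2 μ} {f₀ : Lp ℝ 2 μ} (hf : Tendsto f atTop (𝓝 f₀)) {g : α → ℝ}
    (hg : MemLp g 2 μ) :
    Tendsto (fun n => ∫ p, f n p * g p ∂μ) atTop (𝓝 (∫ p, f₀ p * g p ∂μ)) := by
  have key : ∀ f : Lp ℝ 2 μ, ∫ p, f p * g p ∂μ = inner ℝ (hg.toLp g) f := by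
    intro f
    rw [L2.inner_def]
    refine integral_congr_ae ?_
    filter_upwards [hg.coeFn_toLp] with p hp
    simp [hp]
  simp only [key]
  exact tendsto_const_nhds.inner hf

lemma integral_pairing_eq_zero_of_tendsto {α : Type*} [MeasurableSpace α] {μ : Measure α}
    {f g : ℕ → Lp ℝ 2 μ} {f₀ g₀ : Lp ℝ 2 μ} {φ ψ : ℕ → α → ℝ} (hf : ∀ n, f n =ᵐ[μ] φ n)
    (hg : ∀ n, g n =ᵐ[μ] ψ n) (hf₀ : Tendsto f atTop (𝓝 f₀)) (hg₀ : Tendsto g atTop (𝓝 g₀))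
    {A B : α → ℝ} (hA : MemLp A 2 μ) (hB : MemLp B 2 μ)
    (H : ∀ n, ∫ p, (φ n p * A p + ψ n p * B p) ∂μ = 0) :
    ∫ p, (f₀ p * A p + g₀ p * B p) ∂μ = 0 := by
  have lim := (tendsto_integral_of_tendsto_L2 hf₀ hA).add (tendsto_integral_of_tendsto_L2 hg₀ hB)
  rw [integral_add (integrable_mul_of_memLp (Lp.memLp f₀) hA)
    (integrable_mul_of_memLp (Lp.memLp g₀) hB)]
  refine tendsto_nhds_unique lim (tendsto_const_nhds.congr fun n => ?_)
  rw [← integral_add (integrable_mul_of_memLp (Lp.memLp _) hA)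
    (integrable_mul_of_memLp (Lp.memLp _) hB), ← H n]
  refine integral_congr_ae ?_
  filter_upwards [hf n, hg n] with p hp hp'
  rw [hp, hp']

/-- A function `L ∈ H¹(R)` can be changed by an element of `H¹₀(R)` into a harmonic function: remove
from `∇L` its projection on the closure of the gradients of test functions. By the Poincaré
inequality this projection is the gradient of an element of `H¹₀(R)`. -/
theorem exists_harmonic {R : Rect} {v vx vy t : Plane → ℝ} (h : TracedH1 R v vx vy t) :
    ∃ u ux uy : Plane → ℝ, TracedH1 R u ux uy t ∧ IsDivFree R.set R.set ux uy := by
  set μ : Measure Plane := volume.restrict R.set with hμ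
  let H := WithLp 2 (Lp ℝ 2 μ × Lp ℝ 2 μ)
  have hmem : ∀ {φ : Plane → ℝ}, Continuous φ → MemLp φ 2 μ := fun hφ =>
    memLp_box_of_continuous hφ _ _ _ _
  let D : Submodule ℝ H :=
    { carrier := {u | ∃ φ, IsTest R.set φ ∧ u.fst =ᵐ[μ] dx φ ∧ u.snd =ᵐ[μ] dy φ}
      add_mem' := by
        rintro u u' ⟨φ, hφ, h1, h2⟩ ⟨φ', hφ', h1', h2'⟩
        refine ⟨fun p => φ p + φ' p, ⟨hφ.1.add hφ'.1, hφ.2.1.add hφ'.2.1,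
          (tsupport_add φ φ').trans (union_subset hφ.2.2 hφ'.2.2)⟩, ?_, ?_⟩
        · filter_upwards [h1, h1', Lp.coeFn_add u.fst u'.fst] with p e1 e2 e3
          rw [dx_add hφ.1 hφ'.1, ← e1, ← e2]; exact e3
        · filter_upwards [h2, h2', Lp.coeFn_add u.snd u'.snd] with p e1 e2 e3
          rw [dy_add hφ.1 hφ'.1, ← e1, ← e2]; exact e3
      zero_mem' := by
        refine ⟨fun _ => 0, ⟨contDiff_const, HasCompactSupport.zero, by simp [tsupport]⟩, ?_, ?_⟩
        · filter_upwards [Lp.coeFn_zero ℝ 2 μ] with p hp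
          rw [show dx (fun _ => (0 : ℝ)) p = 0 by simp [dx]]; exact hp
        · filter_upwards [Lp.coeFn_zero ℝ 2 μ] with p hp
          rw [show dy (fun _ => (0 : ℝ)) p = 0 by simp [dy]]; exact hp
      smul_mem' := by
        rintro k u ⟨φ, hφ, h1, h2⟩
        refine ⟨fun p => k * φ p, ⟨contDiff_const.mul hφ.1, hφ.2.1.mul_left,
          (tsupport_mul_subset_right).trans hφ.2.2⟩, ?_, ?_⟩
        · filter_upwards [h1, Lp.coeFn_smul k u.fst] with p e1 e3
          rw [dx_const_mul hφ.1, ← e1]; exact e3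
        · filter_upwards [h2, Lp.coeFn_smul k u.snd] with p e1 e3
          rw [dy_const_mul hφ.1, ← e1]; exact e3 }
  let K : Submodule ℝ H := D.topologicalClosure
  have : CompleteSpace K := D.isClosed_topologicalClosure.completeSpace_coe
  let G : H := WithLp.toLp 2 (h.memLp_x.toLp vx, h.memLp_y.toLp vy)
  obtain ⟨k, hk, z, hz, hG⟩ := K.exists_add_mem_mem_orthogonal G
  have hk' : k ∈ closure (D : Set H) := hk
  obtain ⟨u, huD, hu⟩ := mem_closure_iff_seq_limit.1 hk'
  choose φ hφ hφx hφy using huD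
  -- by the Poincaré inequality, the test functions `φ n` converge with their gradients
  let f : ℕ → Lp ℝ 2 μ := fun n => (hmem (hφ n).1.continuous).toLp (φ n)
  have hf : ∀ n, f n =ᵐ[μ] φ n := fun n => (hmem (hφ n).1.continuous).coeFn_toLp
  have hdist : ∀ m n, ‖f m - f n‖ ≤ 2 * |R.b - R.a| * ‖u m - u n‖ := by
    intro m n
    have ht : IsTest R.set fun p => φ m p + -1 * φ n p :=
      ⟨(hφ m).1.add (contDiff_const.mul (hφ n).1), (hφ m).2.1.add (hφ n).2.1.mul_left,
        (tsupport_add _ _).trans (union_subset (hφ m).2.2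
          ((tsupport_mul_subset_right).trans (hφ n).2.2))⟩
    have hp := ht.poincare
    have e1 : ‖f m - f n‖ ^ 2 = ∫ p in R.set, (φ m p + -1 * φ n p) ^ 2 := by
      rw [norm_sq_L2]
      refine integral_congr_ae ?_
      filter_upwards [hf m, hf n, Lp.coeFn_sub (f m) (f n)] with p a1 a2 a3
      rw [a3, Pi.sub_apply, a1, a2]; ring
    have e2 : ‖(u m).fst - (u n).fst‖ ^ 2 =
        ∫ p in R.set, dx (fun p => φ m p + -1 * φ n p) p ^ 2 := by
      rw [norm_sq_L2]
      refine integral_congr_ae ?_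
      filter_upwards [hφx m, hφx n, Lp.coeFn_sub (u m).fst (u n).fst] with p a1 a2 a3
      rw [a3, Pi.sub_apply, a1, a2, dx_add (hφ m).1 (contDiff_const.mul (hφ n).1),
        dx_const_mul (hφ n).1]; ring
    have e3 : ‖(u m).fst - (u n).fst‖ ≤ ‖u m - u n‖ := by
      have := WithLp.prod_norm_sq_eq_of_L2 (u m - u n)
      have h2 : ‖(u m - u n).fst‖ ^ 2 ≤ ‖u m - u n‖ ^ 2 := by
        rw [this]; nlinarith [sq_nonneg ‖(u m - u n).snd‖]
      exact abs_le_of_sq_le_sq' h2 (norm_nonneg _) |>.2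
    have e4 : ‖f m - f n‖ ^ 2 ≤ (2 * |R.b - R.a| * ‖(u m).fst - (u n).fst‖) ^ 2 := by
      rw [e1, mul_pow, e2, mul_pow 2 |R.b - R.a|, sq_abs, ← mul_pow]
      exact hp
    refine (abs_le_of_sq_le_sq' e4 (by positivity)).2.trans ?_
    exact mul_le_mul_of_nonneg_left e3 (by positivity)
  have hcauchy : CauchySeq f := by
    rw [Metric.cauchySeq_iff]
    intro ε hε
    obtain ⟨N, hN⟩ := Metric.cauchySeq_iff.1 hu.cauchySeq (ε / (2 * |R.b - R.a| + 1))
      (by positivity)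
    refine ⟨N, fun m hm n hn => ?_⟩
    have h1 := hN m hm n hn
    rw [dist_eq_norm] at h1 ⊢
    rw [lt_div_iff₀ (by positivity)] at h1
    have := hdist m n
    nlinarith [norm_nonneg (u m - u n)]
  obtain ⟨f₀, hf₀⟩ := cauchySeq_tendsto_of_complete hcauchy
  have hu1 : Tendsto (fun n => (u n).fst) atTop (𝓝 k.fst) :=
    ((WithLp.prod_continuous_ofLp 2 _ _).fst.tendsto k).comp hu
  have hu2 : Tendsto (fun n => (u n).snd) atTop (𝓝 k.snd) :=
    ((WithLp.prod_continuous_ofLp 2 _ _).snd.tendsto k).comp hu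
  -- their limit has the gradient `k` and trace zero
  have h0 : TracedH1 R f₀ k.fst k.snd 0 := by
    refine ⟨⟨Lp.memLp f₀, Lp.memLp k.fst, MemLp.zero, MemLp.zero, fun ψ hψ => ?_⟩,
      ⟨memLp_swap (Lp.memLp f₀), memLp_swap (Lp.memLp k.snd), MemLp.zero, MemLp.zero,
        fun ψ hψ => ?_⟩⟩
    · simp only [Pi.zero_apply, zero_mul, integral_zero, sub_zero]
      refine integral_pairing_eq_zero_of_tendsto hf hφx hf₀ hu1
        (hmem (smooth_dx hψ).continuous) (hmem hψ.continuous) fun n => ?_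
      have := (hφ n).hasXTrace.ibp ψ hψ
      simp only [Pi.zero_apply, zero_mul, integral_zero, sub_zero] at this
      exact this
    · simp only [Function.comp_apply, Pi.zero_apply, zero_mul, integral_zero, sub_zero]
      have hψ' := smooth_swap hψ
      rw [← setIntegral_swap]
      simp only [Prod.swap_swap]
      refine integral_pairing_eq_zero_of_tendsto hf hφy hf₀ hu2 (A := fun p => dx ψ p.swap)
        (B := fun p => ψ p.swap) (hmem ((smooth_dx hψ).continuous.comp continuous_swap))
        (hmem hψ'.continuous) fun n => ?_
      have := (hφ n).swap.hasXTrace.ibp ψ hψ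
      rw [← setIntegral_swap] at this
      simp [dx_swap (hφ n).1] at this
      exact this
  refine ⟨_, _, _, (h.sub h0).congr ae_eq_rfl ae_eq_rfl ae_eq_rfl
    (Eventually.of_forall fun p => sub_zero _), fun ψ hψ => ?_⟩
  -- the remaining part of the gradient is orthogonal to the gradients of test functions
  have iψx := hmem (smooth_dx hψ.1).continuous
  have iψy := hmem (smooth_dy hψ.1).continuous
  let w : H := WithLp.toLp 2 (iψx.toLp (dx ψ), iψy.toLp (dy ψ))
  have hwK : w ∈ K := D.le_topologicalClosure ⟨ψ, hψ, iψx.coeFn_toLp, iψy.coeFn_toLp⟩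
  have hinner := hz w hwK
  have hz' : z = G - k := by rw [hG]; abel
  have hz1 : z.fst =ᵐ[μ] fun p => vx p - k.fst p := by
    rw [hz']
    filter_upwards [Lp.coeFn_sub G.fst k.fst, h.memLp_x.coeFn_toLp] with p e1 e2
    rw [← e2]; exact e1
  have hz2 : z.snd =ᵐ[μ] fun p => vy p - k.snd p := by
    rw [hz']
    filter_upwards [Lp.coeFn_sub G.snd k.snd, h.memLp_y.coeFn_toLp] with p e1 e2
    rw [← e2]; exact e1
  rw [WithLp.prod_inner_apply, L2.inner_def, L2.inner_def] at hinner
  have mx : MemLp (fun p => vx p - k.fst p) 2 μ := h.memLp_x.sub (Lp.memLp _)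
  have my : MemLp (fun p => vy p - k.snd p) 2 μ := h.memLp_y.sub (Lp.memLp _)
  rw [integral_add (integrable_mul_of_memLp mx iψx) (integrable_mul_of_memLp my iψy), ← hinner]
  congr 1
  · refine integral_congr_ae ?_
    filter_upwards [hz1, iψx.coeFn_toLp] with p e1 e2
    change _ = inner ℝ (iψx.toLp (dx ψ) p) (z.fst p)
    rw [e1, e2]; simp
  · refine integral_congr_ae ?_
    filter_upwards [hz2, iψy.coeFn_toLp] with p e1 e2
    change _ = inner ℝ (iψy.toLp (dy ψ) p) (z.snd p)
    rw [e1, e2]; simp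

/-! ### Lifting of the interface values -/

/-- `v` has square-integrable weak partial derivatives `∂ₓv`, `∂_yv`, `∂_y∂ₓv` and `∂ₓ∂_yv`. -/
def HasMixedPartials (U : Set Plane) (v : Plane → ℝ) : Prop :=
  MemLp v 2 (volume.restrict U) ∧
  ∃ vx vy vxy vyx : Plane → ℝ, (MemLp vx 2 (volume.restrict U) ∧ MemLp vy 2 (volume.restrict U) ∧
    MemLp vxy 2 (volume.restrict U) ∧ MemLp vyx 2 (volume.restrict U)) ∧
    IsWeakPartial U (1, 0) v vx ∧ IsWeakPartial U (0, 1) v vy ∧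
    IsWeakPartial U (0, 1) vx vxy ∧ IsWeakPartial U (1, 0) vy vyx

lemma MemH2.hasMixedPartials {U : Set Plane} {v : Plane → ℝ} (h : MemH2 U v) :
    HasMixedPartials U v := by
  have h1 := weakPartial_spec h.1.2.1
  have h2 := weakPartial_spec h.1.2.2
  have h3 := weakPartial_spec h.2.1.2.2
  have h4 := weakPartial_spec h.2.2.2.1
  exact ⟨h.1.1, _, _, _, _, ⟨h1.1, h2.1, h3.1, h4.1⟩, h1.2, h2.2, h3.2, h4.2⟩

lemma IsWeakPartial.congr {U : Set Plane} {e : Plane} {v v' w : Plane → ℝ}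
    (h : IsWeakPartial U e v w) (hv : v =ᵐ[volume.restrict U] v') : IsWeakPartial U e v' w := by
  intro φ hφ
  rw [← h φ hφ]
  exact integral_congr_ae (hv.mono fun p hp => by simp only [hp])

lemma IsWeakPartial.comb {a b c d : ℝ} {e : Plane} {v w v' w' : Plane → ℝ} (k k' : ℝ)
    (h : IsWeakPartial (box a b c d) e v w) (h' : IsWeakPartial (box a b c d) e v' w')
    (hv : MemLp v 2 (volume.restrict (box a b c d)))
    (hw : MemLp w 2 (volume.restrict (box a b c d)))
    (hv' : MemLp v' 2 (volume.restrict (box a b c d)))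
    (hw' : MemLp w' 2 (volume.restrict (box a b c d))) :
    IsWeakPartial (box a b c d) e (fun p => k * v p + k' * v' p)
      (fun p => k * w p + k' * w' p) := by
  intro φ hφ
  have hd := (smooth_dir hφ.1 e).continuous
  have hc := hφ.1.continuous
  simp only [add_mul, mul_assoc]
  rw [integral_add ((integrable_mul_continuous hv hd).const_mul k)
    ((integrable_mul_continuous hv' hd).const_mul k'),
    integral_add ((integrable_mul_continuous hw hc).const_mul k)
    ((integrable_mul_continuous hw' hc).const_mul k'), integral_const_mul, integral_const_mul,
    integral_const_mul, integral_const_mul, h φ hφ, h' φ hφ]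
  ring

lemma measurePreserving_neg_omega : MeasurePreserving (fun p : Plane => -p)
    (volume.restrict Omega) (volume.restrict Omega) := by
  have := measurePreserving_refl_restrict isRefl_square.sq_left isRefl_square.sq_right square.set
  rwa [← isRefl_square.set_eq, refl_neg_neg] at this

lemma setIntegral_omega_neg (F : Plane → ℝ) : ∫ p in Omega, F (-p) = ∫ p in Omega, F p := by
  have := setIntegral_refl isRefl_square.sq_left isRefl_square.sq_right F square.set
  rwa [← isRefl_square.set_eq, refl_neg_neg] at this

lemma IsTest.comp_neg {φ : Plane → ℝ} (h : IsTest Omega φ) : IsTest Omega fun p => φ (-p) := by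
  rw [Omega, isRefl_square.set_eq] at h
  have := h.refl isRefl_square.sq_left isRefl_square.sq_right
  rwa [refl_neg_neg] at this

lemma IsWeakPartial.comp_neg {e : Plane} {v w : Plane → ℝ} (h : IsWeakPartial Omega e v w) :
    IsWeakPartial Omega e (fun p => v (-p)) (fun p => -w (-p)) := by
  intro φ hφ
  have hd : ∀ p, fderiv ℝ (fun p => φ (-p)) p e = -fderiv ℝ φ (-p) e := fun p => by
    have := ((smooth_diff hφ.1 (-p)).hasFDerivAt.comp p (hasFDerivAt_id p).neg).fderiv
    erw [this]
    simp
  have := h _ hφ.comp_neg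
  rw [← setIntegral_omega_neg, ← setIntegral_omega_neg fun p => w p * φ (-p)] at this
  simp only [hd, neg_neg, mul_neg, neg_mul,
    integral_neg] at this ⊢
  linarith

namespace HasMixedPartials

lemma congr {U : Set Plane} {v v' : Plane → ℝ} (h : HasMixedPartials U v)
    (hv : v =ᵐ[volume.restrict U] v') : HasMixedPartials U v' := by
  obtain ⟨h0, vx, vy, vxy, vyx, hm, h1, h2, h3, h4⟩ := h
  exact ⟨(memLp_congr_ae hv).1 h0, vx, vy, vxy, vyx, hm, h1.congr hv, h2.congr hv, h3, h4⟩

lemma mono {U V : Set Plane} {v : Plane → ℝ} (h : HasMixedPartials V v) (hV : MeasurableSet V)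
    (hUV : U ⊆ V) : HasMixedPartials U v := by
  have hle := Measure.restrict_mono hUV (le_refl (volume : Measure Plane))
  obtain ⟨h0, vx, vy, vxy, vyx, ⟨m1, m2, m3, m4⟩, h1, h2, h3, h4⟩ := h
  exact ⟨h0.mono_measure hle, vx, vy, vxy, vyx, ⟨m1.mono_measure hle, m2.mono_measure hle,
    m3.mono_measure hle, m4.mono_measure hle⟩, h1.mono hV hUV, h2.mono hV hUV, h3.mono hV hUV,
    h4.mono hV hUV⟩

lemma comb {a b c d : ℝ} {v v' : Plane → ℝ} (k k' : ℝ) (h : HasMixedPartials (box a b c d) v)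
    (h' : HasMixedPartials (box a b c d) v') :
    HasMixedPartials (box a b c d) fun p => k * v p + k' * v' p := by
  obtain ⟨m0, vx, vy, vxy, vyx, ⟨m1, m2, m3, m4⟩, h1, h2, h3, h4⟩ := h
  obtain ⟨n0, wx, wy, wxy, wyx, ⟨n1, n2, n3, n4⟩, h1', h2', h3', h4'⟩ := h'
  exact ⟨(m0.const_mul k).add (n0.const_mul k'), _, _, _, _,
    ⟨(m1.const_mul k).add (n1.const_mul k'), (m2.const_mul k).add (n2.const_mul k'),
      (m3.const_mul k).add (n3.const_mul k'), (m4.const_mul k).add (n4.const_mul k')⟩,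
    h1.comb k k' h1' m0 m1 n0 n1, h2.comb k k' h2' m0 m2 n0 n2, h3.comb k k' h3' m1 m3 n1 n3,
    h4.comb k k' h4' m2 m4 n2 n4⟩

lemma evenPart {v : Plane → ℝ} (h : HasMixedPartials Omega v) :
    HasMixedPartials Omega (evenPart v) := by
  have hn : HasMixedPartials Omega fun p => v (-p) := by
    obtain ⟨m0, vx, vy, vxy, vyx, ⟨m1, m2, m3, m4⟩, h1, h2, h3, h4⟩ := h
    have hm : ∀ {u : Plane → ℝ}, MemLp u 2 (volume.restrict Omega) →
        MemLp (fun p => u (-p)) 2 (volume.restrict Omega) := fun hu =>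
      hu.comp_measurePreserving measurePreserving_neg_omega
    have hneg : ∀ {e : Plane} {u w : Plane → ℝ}, IsWeakPartial Omega e u w →
        IsWeakPartial Omega e (fun p => -u (-p)) (fun p => w (-p)) := fun hu φ hφ => by
      have := hu.comp_neg φ hφ
      simp only [neg_mul, integral_neg, neg_neg] at this ⊢
      linarith
    exact ⟨hm m0, _, _, _, _, ⟨(hm m1).neg, (hm m2).neg, hm m3, hm m4⟩, h1.comp_neg, h2.comp_neg,
      hneg h3, hneg h4⟩
  refine (h.comb (1 / 2) (1 / 2) hn).congr (Eventually.of_forall fun p => ?_)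
  simp only [NeumannNeumann.evenPart]; ring

lemma swap {a b c d : ℝ} {v : Plane → ℝ} (h : HasMixedPartials (box a b c d) v) :
    HasMixedPartials (box c d a b) (v ∘ Prod.swap) := by
  obtain ⟨m0, vx, vy, vxy, vyx, ⟨m1, m2, m3, m4⟩, h1, h2, h3, h4⟩ := h
  exact ⟨memLp_swap m0, _, _, _, _, ⟨memLp_swap m2, memLp_swap m1, memLp_swap m4, memLp_swap m3⟩,
    h2.swap, h1.swap, h4.swap, h3.swap⟩

end HasMixedPartials

/-- Weak derivatives in `y` against smooth functions that vanish on the horizontal sides. -/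
lemma integral_eq_zero_of_isWeakPartial_snd {a b c d : ℝ} {v w φ : Plane → ℝ}
    (hv : MemLp v 2 (volume.restrict (box a b c d)))
    (hw : MemLp w 2 (volume.restrict (box a b c d)))
    (h : IsWeakPartial (box a b c d) (0, 1) v w) (hφ : ContDiff ℝ ∞ φ)
    (hc : ∀ x, φ (x, c) = 0) (hd : ∀ x, φ (x, d) = 0) :
    ∫ p in box a b c d, (v p * dy φ p + w p * φ p) = 0 := by
  have := integral_eq_zero_of_isWeakPartial (memLp_swap hv) (memLp_swap hw) h.swap
    (smooth_swap hφ) hc hd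
  rw [← setIntegral_swap] at this
  simpa only [dx_swap hφ, Function.comp_apply, Prod.swap_swap] using this

/-- The left boundary values of a continuous function with square-integrable mixed derivative have
a square-integrable weak derivative, by differentiating
`v(0, y) = ∫₀¹ (v - (1 - x) ∂ₓv) dx`. -/
lemma HasMixedPartials.exists_deriv_left {v : Plane → ℝ} (h : HasMixedPartials (box 0 1 0 1) v)
    (hc : ContinuousOn v (Icc 0 1 ×ˢ Icc 0 1)) : ∃ g : ℝ → ℝ,
    MemLp g 2 (volume.restrict (Ioo 0 1)) ∧ ∀ η : ℝ → ℝ, ContDiff ℝ ∞ η → η 0 = 0 → η 1 = 0 →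
      ∫ y in Ioo (0 : ℝ) 1, v (0, y) * deriv η y = -∫ y in Ioo (0 : ℝ) 1, g y * η y := by
  obtain ⟨m0, vx, vy, vxy, vyx, ⟨m1, m2, m3, m4⟩, h1, h2, h3, h4⟩ := h
  have hs : ContDiff ℝ ∞ fun x : ℝ => 1 - x := contDiff_const.sub contDiff_id
  have hsd : ∀ x, deriv (fun x : ℝ => 1 - x) x = -1 := fun x => by
    simp
  have m3' : MemLp (fun p : Plane => (1 - p.1) * vxy p) 2 (volume.restrict (box 0 1 0 1)) :=
    memLp_continuous_mul m3 (smooth_fst hs).continuous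
  have mg : MemLp (fun p : Plane => vy p - (1 - p.1) * vxy p) 2 (volume.restrict (box 0 1 0 1)) :=
    m2.sub m3'
  refine ⟨_, memLp_integral_fst one_pos mg, fun η hη h0 h1' => ?_⟩
  have hη' : ContDiff ℝ ∞ (deriv η) := hη.deriv'
  have e1 := (hasXTrace_of_continuousOn one_pos one_pos hc m1 h1).ibp
    (fun p => (1 - p.1) * deriv η p.2) ((smooth_fst hs).mul (smooth_snd hη'))
  have e2 := integral_eq_zero_of_isWeakPartial_snd m0 m2 h2 (smooth_snd hη) (fun _ => h0)
    (fun _ => h1')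
  have e3 := integral_eq_zero_of_isWeakPartial_snd m1 m3 h3 ((smooth_fst hs).mul (smooth_snd hη))
    (fun _ => by simp only [h0, mul_zero]) (fun _ => by simp only [h1', mul_zero])
  simp only [dx_mul (smooth_fst hs) (smooth_snd hη'), dx_fst hs, dx_snd hη', hsd, sub_self,
    zero_mul, mul_zero, integral_zero, zero_sub, sub_zero, one_mul, add_zero] at e1
  simp only [dy_snd hη] at e2
  simp only [dy_mul (smooth_fst hs) (smooth_snd hη), dy_fst hs, dy_snd hη, zero_mul,
    zero_add] at e3
  rw [← integral_box_mul_snd mg hη.continuous]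
  have i1 : Integrable (fun p : Plane => v p * (-1 * deriv η p.2) +
      vx p * ((1 - p.1) * deriv η p.2)) (volume.restrict (box 0 1 0 1)) :=
    (integrable_mul_continuous m0 (continuous_const.mul (smooth_snd hη').continuous)).add
      (integrable_mul_continuous m1 ((smooth_fst hs).mul (smooth_snd hη')).continuous)
  have i2 : Integrable (fun p : Plane => v p * deriv η p.2 + vy p * η p.2)
      (volume.restrict (box 0 1 0 1)) :=
    (integrable_mul_snd m0 hη'.continuous).add (integrable_mul_snd m2 hη.continuous)
  have i3 : Integrable (fun p : Plane => vx p * ((1 - p.1) * deriv η p.2) +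
      vxy p * ((1 - p.1) * η p.2)) (volume.restrict (box 0 1 0 1)) :=
    (integrable_mul_continuous m1 ((smooth_fst hs).mul (smooth_snd hη')).continuous).add
      (integrable_mul_continuous m3 ((smooth_fst hs).mul (smooth_snd hη)).continuous)
  have i23 : Integrable (fun p : Plane => (v p * deriv η p.2 + vy p * η p.2) -
      (vx p * ((1 - p.1) * deriv η p.2) + vxy p * ((1 - p.1) * η p.2)))
      (volume.restrict (box 0 1 0 1)) := i2.sub i3
  have e : ∫ p in box 0 1 0 1, (vy p - (1 - p.1) * vxy p) * η p.2 =
      ∫ p in box 0 1 0 1, ((v p * (-1 * deriv η p.2) + vx p * ((1 - p.1) * deriv η p.2)) +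
        ((v p * deriv η p.2 + vy p * η p.2) - (vx p * ((1 - p.1) * deriv η p.2) +
          vxy p * ((1 - p.1) * η p.2)))) :=
    integral_congr_ae (Eventually.of_forall fun p => by ring)
  rw [e, integral_add i1 i23, integral_sub i2 i3, e1, e2, e3]
  ring

/-- The boundary values on the left side, extended linearly to zero on the right side. -/
lemma HasMixedPartials.exists_tracedH1_left {v : Plane → ℝ}
    (h : HasMixedPartials (box 0 1 0 1) v) (hc : ContinuousOn v (Icc 0 1 ×ˢ Icc 0 1)) :
    ∃ ux uy, TracedH1 (subRect 2) (fun p => (1 - p.1) * v (0, p.2)) ux uy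
      fun p => (1 - p.1) * v (0, p.2) := by
  obtain ⟨g, hg, hgd⟩ := h.exists_deriv_left hc
  have hs : ContDiff ℝ ∞ fun x : ℝ => 1 - x := contDiff_const.sub contDiff_id
  have ha : ContinuousOn (fun y => v (0, y)) (Icc 0 1) :=
    hc.comp (continuousOn_const.prodMk continuousOn_id) fun y hy => ⟨⟨le_rfl, zero_le_one⟩, hy⟩
  have hx := hasXTrace_mul (c := 0) (d := 1) zero_le_one hs (memLp_Ioo_of_continuousOn ha)
  have mA : MemLp (fun p : Plane => (1 - p.1) * v (0, p.2)) 2 (volume.restrict (box 0 1 0 1)) :=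
    hx.memLp
  have mG : MemLp (fun p : Plane => (1 - p.1) * g p.2) 2 (volume.restrict (box 0 1 0 1)) :=
    memLp_continuous_mul (memLp_comp_snd hg 0 1) (smooth_fst hs).continuous
  refine ⟨_, fun p => (1 - p.1) * g p.2, tracedH1_of_continuousOn one_pos one_pos ?_
    hx.memLp_deriv mG hx.isWeakPartial ?_⟩
  · refine ((smooth_fst hs).continuous.continuousOn).mul ?_
    exact ha.comp continuousOn_snd fun p hp => hp.2
  · intro φ hφ
    have i1 : Integrable (fun p : Plane => (1 - p.1) * v (0, p.2) * dy φ p)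
        (volume.restrict (box 0 1 0 1)) :=
      integrable_mul_continuous mA (smooth_dy hφ.1).continuous
    have i2 : Integrable (fun p : Plane => (1 - p.1) * g p.2 * φ p)
        (volume.restrict (box 0 1 0 1)) := integrable_mul_continuous mG hφ.1.continuous
    change ∫ p in box 0 1 0 1, (1 - p.1) * v (0, p.2) * dy φ p =
      -∫ p in box 0 1 0 1, (1 - p.1) * g p.2 * φ p
    rw [restrict_box] at i1 i2 ⊢
    rw [integral_prod _ i1, integral_prod _ i2, ← integral_neg]
    refine integral_congr_ae (Eventually.of_forall fun x => ?_)
    have hη : ContDiff ℝ ∞ fun y => φ (x, y) := hφ.1.comp (contDiff_const.prodMk contDiff_id)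
    have hd : ∀ y, deriv (fun y => φ (x, y)) y = dy φ (x, y) := fun y => by
      have := (hasDerivAt_dx (smooth_swap hφ.1) y x).deriv
      rwa [dx_swap hφ.1] at this
    have hb : ∀ y, y ∉ Ioo (0 : ℝ) 1 → φ (x, y) = 0 := fun y hy =>
      hφ.eq_zero fun hp => hy hp.2
    have := hgd _ hη (hb 0 (by simp)) (hb 1 (by simp))
    simp only [hd] at this
    simp only [mul_assoc]
    rw [integral_const_mul, integral_const_mul, this, mul_neg]

/-- The Coons interpolant of boundary values that are zero on the sides `x = 1` and `y = 1`. -/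
lemma HasMixedPartials.exists_lift {v : Plane → ℝ} (h : HasMixedPartials (box 0 1 0 1) v)
    (hc : ContinuousOn v (Icc 0 1 ×ˢ Icc 0 1)) (h10 : v (1, 0) = 0) (h01 : v (0, 1) = 0) :
    ∃ l lx ly, TracedH1 (subRect 2) l lx ly l ∧ (∀ y, l (0, y) = v (0, y)) ∧
      (∀ x, l (x, 0) = v (x, 0)) ∧ (∀ y, l (1, y) = 0) ∧ ∀ x, l (x, 1) = 0 := by
  obtain ⟨ax, ay, hA⟩ := h.exists_tracedH1_left hc
  obtain ⟨bx, bY, hB⟩ := h.swap.exists_tracedH1_left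
    (hc.comp continuous_swap.continuousOn fun p hp => hp.symm)
  have hB' : TracedH1 (subRect 2) (fun p => (1 - p.2) * v (p.1, 0)) (bY ∘ Prod.swap)
      (bx ∘ Prod.swap) fun p => (1 - p.2) * v (p.1, 0) := ⟨hB.y, hB.x⟩
  have hs : ContDiff ℝ ∞ fun x : ℝ => 1 - x := contDiff_const.sub contDiff_id
  have hx := hasXTrace_mul (a := 0) (b := 1) (c := 0) (d := 1) zero_le_one hs
    (memLp_Ioo_of_continuous hs.continuous 0 1)
  have hy := hx
  have hC : TracedH1 (subRect 2) (fun p => (1 - p.1) * (1 - p.2)) _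
      ((fun p => deriv (fun x : ℝ => 1 - x) p.1 * (1 - p.2)) ∘ Prod.swap)
      (fun p => (1 - p.1) * (1 - p.2)) := ⟨hx, by
    refine hx.congr (Eventually.of_forall fun p => ?_) ae_eq_rfl (Eventually.of_forall fun p => ?_)
      (Eventually.of_forall fun p => ?_) <;> simp [mul_comm]⟩
  refine ⟨_, _, _, (hA.add hB').sub (hC.const_mul (v (0, 0))), fun y => ?_, fun x => ?_,
    fun y => ?_, fun x => ?_⟩ <;> simp only [h10, h01] <;> ring

/-! ### Geometry of the decomposition -/

lemma signX_eq (i : Fin 4) : signX i = 1 ∨ signX i = -1 := by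
  fin_cases i <;> simp [signX]

lemma signY_eq (i : Fin 4) : signY i = 1 ∨ signY i = -1 := by
  fin_cases i <;> simp [signY]

/-- The neighbour across the `y`-axis. -/
lemma exists_neighbour_x (i : Fin 4) : ∃ j, i ≠ j ∧ signX j = -signX i ∧ signY j = signY i := by
  fin_cases i
  exacts [⟨1, by simp [signX, signY]⟩, ⟨0, by simp [signX, signY]⟩, ⟨3, by simp [signX, signY]⟩,
    ⟨2, by simp [signX, signY]⟩]

/-- The neighbour across the `x`-axis. -/
lemma exists_neighbour_y (i : Fin 4) : ∃ j, i ≠ j ∧ signX j = signX i ∧ signY j = -signY i := by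
  fin_cases i
  exacts [⟨3, by simp [signX, signY]⟩, ⟨2, by simp [signX, signY]⟩, ⟨1, by simp [signX, signY]⟩,
    ⟨0, by simp [signX, signY]⟩]

lemma eq_of_sign_eq {i j : Fin 4} (hx : signX i = signX j) (hy : signY i = signY j) : i = j := by
  fin_cases i <;> fin_cases j <;> first
    | rfl
    | (norm_num [signX] at hx; done)
    | norm_num [signY] at hy

lemma mem_subsq_iff {i : Fin 4} {p : Plane} : p ∈ Subsq i ↔
    (0 < signX i * p.1 ∧ signX i * p.1 < 1) ∧ 0 < signY i * p.2 ∧ signY i * p.2 < 1 := by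
  rw [Subsq, (isRefl_subRect i).set_eq]
  rfl

lemma mem_omega_iff {p : Plane} : p ∈ Omega ↔ |p.1| < 1 ∧ |p.2| < 1 := by
  rw [abs_lt, abs_lt]; rfl

lemma measurableSet_subsq (i : Fin 4) : MeasurableSet (Subsq i) := measurableSet_box _ _ _ _

lemma subsq_subset_omega (i : Fin 4) : Subsq i ⊆ Omega := by
  intro p hp
  rw [mem_subsq_iff] at hp
  rw [mem_omega_iff, abs_lt, abs_lt]
  obtain ⟨⟨h1, h2⟩, h3, h4⟩ := hp
  rcases signX_eq i with h | h <;> rcases signY_eq i with h' | h' <;> rw [h] at h1 h2 <;>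
    rw [h'] at h3 h4 <;> refine ⟨⟨?_, ?_⟩, ?_, ?_⟩ <;> linarith

lemma disjoint_subsq {i j : Fin 4} (hij : i ≠ j) : Disjoint (Subsq i) (Subsq j) := by
  refine disjoint_left.2 fun p hp hp' => hij ?_
  rw [mem_subsq_iff] at hp hp'
  refine eq_of_sign_eq ?_ ?_
  · rcases signX_eq i with h | h <;> rcases signX_eq j with h' | h' <;> rw [h, h'] <;>
      rw [h] at hp <;> rw [h'] at hp' <;> linarith [hp.1.1, hp'.1.1]
  · rcases signY_eq i with h | h <;> rcases signY_eq j with h' | h' <;> rw [h, h'] <;>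
      rw [h] at hp <;> rw [h'] at hp' <;> linarith [hp.2.1, hp'.2.1]

lemma mem_frontier_rect {R : Rect} (hab : R.a < R.b) (hcd : R.c < R.d) {p : Plane} :
    p ∈ frontier R.set ↔ p.1 ∈ Icc R.a R.b ∧ (p.2 = R.c ∨ p.2 = R.d) ∨
      (p.1 = R.a ∨ p.1 = R.b) ∧ p.2 ∈ Icc R.c R.d := by
  rw [Rect.set, frontier_prod_eq, frontier_Ioo hab, frontier_Ioo hcd, closure_Ioo hab.ne,
    closure_Ioo hcd.ne]
  rfl

lemma mem_frontier_omega_iff {p : Plane} : p ∈ frontier Omega ↔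
    |p.1| ≤ 1 ∧ |p.2| = 1 ∨ |p.1| = 1 ∧ |p.2| ≤ 1 := by
  rw [Omega, mem_frontier_rect (by simp [square]) (by simp [square]), abs_le, abs_le,
    abs_eq zero_le_one, abs_eq zero_le_one, or_comm (a := p.1 = 1), or_comm (a := p.2 = 1)]
  rfl

lemma mem_frontier_subsq_iff {i : Fin 4} {p : Plane} : p ∈ frontier (Subsq i) ↔
    (0 ≤ signX i * p.1 ∧ signX i * p.1 ≤ 1) ∧ (p.2 = 0 ∨ signY i * p.2 = 1) ∨
      (p.1 = 0 ∨ signX i * p.1 = 1) ∧ 0 ≤ signY i * p.2 ∧ signY i * p.2 ≤ 1 := by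
  rw [Subsq, mem_frontier_rect (subRect_lt i).1 (subRect_lt i).2]
  fin_cases i <;> simp [subRect, signX, signY] <;> grind

/-- Subsquares with the same vertical sign meet in a half of the `y`-axis, those with the same
horizontal sign in a half of the `x`-axis, and opposite subsquares do not meet in a segment. -/
lemma mem_interface_iff {i j : Fin 4} (hij : i ≠ j) {p : Plane} : p ∈ interface i j ↔
    signY i = signY j ∧ p.1 = 0 ∧ 0 < signY i * p.2 ∧ signY i * p.2 < 1 ∨
      signX i = signX j ∧ p.2 = 0 ∧ 0 < signX i * p.1 ∧ signX i * p.1 < 1 := by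
  have hne : ¬ (signX i = signX j ∧ signY i = signY j) := fun h => hij (eq_of_sign_eq h.1 h.2)
  obtain ⟨x, y⟩ := p
  simp only [interface, Set.mem_sdiff, mem_inter_iff, mem_frontier_subsq_iff, mem_omega_iff, abs_lt,
    mem_singleton_iff, Prod.mk.injEq]
  rcases signX_eq i with h1 | h1 <;> rcases signX_eq j with h2 | h2 <;>
    rcases signY_eq i with h3 | h3 <;> rcases signY_eq j with h4 | h4 <;>
    simp only [h1, h2, h3, h4] at hne ⊢ <;>
    first
    | (norm_num at hne; done)
    | (norm_num; grind)

lemma interface_subset_omega (i j : Fin 4) : interface i j ⊆ Omega := fun _ hp => hp.1.2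

lemma interface_x {i j : Fin 4} (hij : i ≠ j) (h : signY j = signY i) {p : Plane} :
    p ∈ interface i j ↔ p.1 = 0 ∧ 0 < signY i * p.2 ∧ signY i * p.2 < 1 := by
  rw [mem_interface_iff hij, or_iff_left, and_iff_right h.symm]
  exact fun h' => hij (eq_of_sign_eq h'.1 h.symm)

lemma interface_y {i j : Fin 4} (hij : i ≠ j) (h : signX j = signX i) {p : Plane} :
    p ∈ interface i j ↔ p.2 = 0 ∧ 0 < signX i * p.1 ∧ signX i * p.1 < 1 := by
  rw [mem_interface_iff hij, or_iff_right, and_iff_right h.symm]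
  exact fun h' => hij (eq_of_sign_eq h.symm h'.1)

lemma interface_x_nonempty {i j : Fin 4} (hij : i ≠ j) (h : signY j = signY i) :
    (interface i j).Nonempty := by
  refine ⟨(0, signY i * (1 / 2)), (interface_x hij h).2 ⟨rfl, ?_⟩⟩
  rcases signY_eq i with h | h <;> rw [h] <;> norm_num

lemma interface_y_nonempty {i j : Fin 4} (hij : i ≠ j) (h : signX j = signX i) :
    (interface i j).Nonempty := by
  refine ⟨(signX i * (1 / 2), 0), (interface_y hij h).2 ⟨rfl, ?_⟩⟩
  rcases signX_eq i with h | h <;> rw [h] <;> norm_num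

lemma ae_Ioo_neg_iff {P : ℝ → Prop} : (∀ᵐ y ∂(volume.restrict (Ioo (-1 : ℝ) 0)), P y) ↔
    ∀ᵐ y ∂(volume.restrict (Ioo (0 : ℝ) 1)), P (-y) := by
  have h : MeasurePreserving (fun y : ℝ => -y) (volume.restrict (Ioo (0 : ℝ) 1))
      (volume.restrict (Ioo (-1 : ℝ) 0)) := by
    have := (Measure.measurePreserving_neg (volume : Measure ℝ)).restrict_preimage
      (measurableSet_Ioo (a := (-1 : ℝ)) (b := 0))
    simpa using this
  rw [← h.map_eq]
  exact (MeasurableEquiv.neg ℝ).measurableEmbedding.ae_map_iff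

/-- The boundary of a subsquare consists of two sides on the axes and two sides on `∂Ω`. -/
lemma ae_arc_subRect_iff {i : Fin 4} {P : Plane → Prop} : (∀ᵐ p ∂((subRect i).arc), P p) ↔
    ((∀ᵐ y ∂(volume.restrict (Ioo (0 : ℝ) 1)), P (0, signY i * y)) ∧
      ∀ᵐ y ∂(volume.restrict (Ioo (0 : ℝ) 1)), P (signX i, signY i * y)) ∧
    (∀ᵐ x ∂(volume.restrict (Ioo (0 : ℝ) 1)), P (signX i * x, 0)) ∧
      ∀ᵐ x ∂(volume.restrict (Ioo (0 : ℝ) 1)), P (signX i * x, signY i) := by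
  have hx : (subRect i).a = 0 ∧ (subRect i).b = 1 ∧ signX i = 1 ∨
      (subRect i).a = -1 ∧ (subRect i).b = 0 ∧ signX i = -1 := by
    fin_cases i <;> simp [subRect, signX]
  have hy : (subRect i).c = 0 ∧ (subRect i).d = 1 ∧ signY i = 1 ∨
      (subRect i).c = -1 ∧ (subRect i).d = 0 ∧ signY i = -1 := by
    fin_cases i <;> simp [subRect, signY]
  rw [ae_arc_iff]
  rcases hx with ⟨h1, h2, h3⟩ | ⟨h1, h2, h3⟩ <;> rcases hy with ⟨h4, h5, h6⟩ | ⟨h4, h5, h6⟩ <;>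
    simp only [h1, h2, h3, h4, h5, h6, one_mul, neg_one_mul, ae_Ioo_neg_iff] <;> tauto

/-- An interface has the same null sets as a part of the boundary of either subsquare. -/
lemma ae_arc_of_ae_arc {i j : Fin 4} (hij : i ≠ j) {P : Plane → Prop}
    (h : ∀ᵐ p ∂((subRect j).arc), P p) : ∀ᵐ p ∂((subRect i).arc), p ∈ interface i j → P p := by
  rw [ae_arc_subRect_iff] at h ⊢
  obtain ⟨⟨h1, -⟩, h3, -⟩ := h
  have hx0 : signX i ≠ 0 := by rcases signX_eq i with h | h <;> rw [h] <;> norm_num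
  have hy0 : signY i ≠ 0 := by rcases signY_eq i with h | h <;> rw [h] <;> norm_num
  have hx1 : signX i * signX i = 1 := (isRefl_subRect i).sq_left
  have hy1 : signY i * signY i = 1 := (isRefl_subRect i).sq_right
  refine ⟨⟨?_, ?_⟩, ?_, ?_⟩
  · filter_upwards [h1] with y hy hp
    rcases (mem_interface_iff hij).1 hp with h' | h'
    · rwa [h'.1]
    · simp at h'
  · refine Eventually.of_forall fun y hp => ?_
    rcases (mem_interface_iff hij).1 hp with h' | h'
    · exact absurd h'.2.1 hx0
    · simp only [hx1] at h'; exact absurd h'.2.2.2 (lt_irrefl _)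
  · filter_upwards [h3] with x hx hp
    rcases (mem_interface_iff hij).1 hp with h' | h'
    · simp at h'
    · rwa [h'.1]
  · refine Eventually.of_forall fun y hp => ?_
    rcases (mem_interface_iff hij).1 hp with h' | h'
    · simp only [hy1] at h'; exact absurd h'.2.2.2 (lt_irrefl _)
    · exact absurd h'.2.1 hy0

lemma ae_arc_mem (i : Fin 4) : ∀ᵐ p ∂((subRect i).arc), p ∈ frontier Omega ∨
    ∃ j, i ≠ j ∧ p ∈ interface i j := by
  have hx : |signX i| = 1 := by rcases signX_eq i with h | h <;> rw [h] <;> norm_num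
  have hy : |signY i| = 1 := by rcases signY_eq i with h | h <;> rw [h] <;> norm_num
  have hx1 : signX i * signX i = 1 := (isRefl_subRect i).sq_left
  have hy1 : signY i * signY i = 1 := (isRefl_subRect i).sq_right
  obtain ⟨j, hij, -, hj⟩ := exists_neighbour_x i
  obtain ⟨k, hik, hk, -⟩ := exists_neighbour_y i
  rw [ae_arc_subRect_iff]
  refine ⟨⟨?_, ?_⟩, ?_, ?_⟩ <;>
    filter_upwards [ae_restrict_mem measurableSet_Ioo] with y hp
  · refine Or.inr ⟨j, hij, (interface_x hij hj).2 ⟨rfl, ?_⟩⟩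
    simpa only [← mul_assoc, hy1, one_mul, mem_Ioo] using hp
  · refine Or.inl (mem_frontier_omega_iff.2 (Or.inr ⟨hx, ?_⟩))
    simp only [abs_mul, hy, one_mul, abs_of_pos hp.1]; exact hp.2.le
  · refine Or.inr ⟨k, hik, (interface_y hik hk).2 ⟨rfl, ?_⟩⟩
    simpa only [← mul_assoc, hx1, one_mul, mem_Ioo] using hp
  · refine Or.inl (mem_frontier_omega_iff.2 (Or.inl ⟨?_, hy⟩))
    simp only [abs_mul, hx, one_mul, abs_of_pos hp.1]; exact hp.2.le

lemma ae_ne_zero : ∀ᵐ p : Plane, p.1 ≠ 0 ∧ p.2 ≠ 0 := by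
  have : ∀ᵐ x : ℝ, x ≠ 0 := by simp [ae_iff]
  exact (Measure.quasiMeasurePreserving_fst.ae this).and (Measure.quasiMeasurePreserving_snd.ae this)

lemma exists_mem_subsq {p : Plane} (hp : p ∈ Omega) (h : p.1 ≠ 0 ∧ p.2 ≠ 0) : ∃ i, p ∈ Subsq i := by
  rw [mem_omega_iff, abs_lt, abs_lt] at hp
  obtain ⟨⟨h1, h2⟩, h3, h4⟩ := hp
  rcases lt_or_gt_of_ne h.1 with h5 | h5 <;> rcases lt_or_gt_of_ne h.2 with h6 | h6
  · exact ⟨0, ⟨h1, h5⟩, h3, h6⟩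
  · exact ⟨3, ⟨h1, h5⟩, h6, h4⟩
  · exact ⟨1, ⟨h5, h2⟩, h3, h6⟩
  · exact ⟨2, ⟨h5, h2⟩, h6, h4⟩

lemma ae_mem_subsq : ∀ᵐ p ∂(volume.restrict Omega), ∃ i, p ∈ Subsq i := by
  filter_upwards [ae_restrict_mem (measurableSet_box (-1) 1 (-1) 1), ae_restrict_of_ae ae_ne_zero]
    with p hp hp' using exists_mem_subsq hp hp'

lemma ae_notMem_interface {i j : Fin 4} (hij : i ≠ j) : ∀ᵐ p : Plane, p ∉ interface i j := by
  filter_upwards [ae_ne_zero] with p hp hp'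
  rcases (mem_interface_iff hij).1 hp' with h | h
  exacts [hp.1 h.2.1, hp.2 h.2.1]

/-! ### Folding onto the first quadrant -/

/-- The map that folds the plane onto the closed first quadrant. -/
def fold (p : Plane) : Plane := (|p.1|, |p.2|)

lemma refl_eq_fold {i : Fin 4} {p : Plane} (h1 : 0 ≤ signX i * p.1) (h2 : 0 ≤ signY i * p.2) :
    refl (signX i) (signY i) p = fold p := by
  have hx : |signX i| = 1 := by rcases signX_eq i with h | h <;> rw [h] <;> norm_num
  have hy : |signY i| = 1 := by rcases signY_eq i with h | h <;> rw [h] <;> norm_num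
  rw [fold, refl, ← abs_of_nonneg h1, ← abs_of_nonneg h2, abs_mul, abs_mul, hx, hy, one_mul,
    one_mul]

lemma refl_eq_fold_of_mem {i : Fin 4} {p : Plane} (h : p ∈ Subsq i) :
    refl (signX i) (signY i) p = fold p := by
  rw [mem_subsq_iff] at h
  exact refl_eq_fold h.1.1.le h.2.1.le

lemma ae_refl_eq_fold (i : Fin 4) :
    ∀ᵐ p ∂((subRect i).arc), refl (signX i) (signY i) p = fold p := by
  have hx1 : signX i * signX i = 1 := (isRefl_subRect i).sq_left
  have hy1 : signY i * signY i = 1 := (isRefl_subRect i).sq_right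
  rw [ae_arc_subRect_iff]
  refine ⟨⟨?_, ?_⟩, ?_, ?_⟩ <;>
    filter_upwards [ae_restrict_mem measurableSet_Ioo] with y hp <;>
    refine refl_eq_fold ?_ ?_ <;> simp only [← mul_assoc, hx1, hy1, one_mul, mul_zero, le_refl,
      zero_le_one, hp.1.le]

lemma TracedH1.fold {v vx vy t : Plane → ℝ} (h : TracedH1 (subRect 2) v vx vy t) (i : Fin 4) :
    TracedH1 (subRect i) (v ∘ fold) (fun p => signX i * vx (fold p))
      (fun p => signY i * vy (fold p)) (t ∘ fold) := by
  refine (h.reflect (isRefl_subRect i)).congr ?_ ?_ ?_ ?_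
  · filter_upwards [ae_restrict_mem (measurableSet_subsq i)] with p hp
    simp only [Function.comp_apply, refl_eq_fold_of_mem hp]
  · filter_upwards [ae_restrict_mem (measurableSet_subsq i)] with p hp
    simp only [refl_eq_fold_of_mem hp]
  · filter_upwards [ae_restrict_mem (measurableSet_subsq i)] with p hp
    simp only [refl_eq_fold_of_mem hp]
  · filter_upwards [ae_refl_eq_fold i] with p hp
    simp only [Function.comp_apply, hp]

lemma integral_gradient_fold (P Q : Plane → ℝ) {φ : Plane → ℝ} (hφ : ContDiff ℝ ∞ φ) (i : Fin 4) :
    ∫ p in Subsq i, (signX i * P (fold p) * dx φ p + signY i * Q (fold p) * dy φ p) =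
      ∫ p in Subsq 2, (P p * dx (φ ∘ refl (signX i) (signY i)) p +
        Q p * dy (φ ∘ refl (signX i) (signY i)) p) := by
  rw [Subsq, Subsq, ← integral_gradient_refl (isRefl_subRect i).sq_left (isRefl_subRect i).sq_right,
    ← (isRefl_subRect i).set_eq]
  · refine setIntegral_congr_fun (measurableSet_subsq i) fun p hp => ?_
    simp only [refl_eq_fold_of_mem hp]
  · exact hφ

/-! ### The data of the errors -/

lemma TracedH1.weakPoisson_iff {R : Rect} {v vx vy t h : Plane → ℝ} (hv : TracedH1 R v vx vy t) :
    WeakPoisson R.set v h ↔ ∀ φ, IsTest R.set φ →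
      ∫ p in R.set, (vx p * dx φ p + vy p * dy φ p) = ∫ p in R.set, h p * φ p := by
  refine forall₂_congr fun φ _ => ?_
  rw [integral_congr_ae (g := fun p => vx p * dx φ p + vy p * dy φ p)]
  filter_upwards [hv.wdx_ae, hv.wdy_ae] with p hx hy
  rw [hx, hy]

lemma evenPart_neg (h : Plane → ℝ) (p : Plane) : evenPart h (-p) = evenPart h p := by
  simp only [evenPart, neg_neg, add_comm]

/-- On the axes, folding is the identity or the point reflection. -/
lemma comp_fold_of_even {h : Plane → ℝ} (heven : ∀ p, h (-p) = h p) {p : Plane}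
    (hp : p.1 = 0 ∨ p.2 = 0) : h (fold p) = h p := by
  obtain ⟨x, y⟩ := p
  have : fold (x, y) = (x, y) ∨ fold (x, y) = -(x, y) := by
    rcases hp with h | h <;> simp only at h <;> subst h
    · rcases abs_choice y with h | h <;> simp [fold, h]
    · rcases abs_choice x with h | h <;> simp [fold, h]
  rcases this with h | h <;> rw [h]
  exact heven _

lemma closure_omega : closure Omega = Icc (-1) 1 ×ˢ Icc (-1) 1 := by
  rw [Omega, Rect.set, closure_prod_eq, square, closure_Ioo (by norm_num)]

lemma isOpen_omega : IsOpen Omega := isOpen_box _ _ _ _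

lemma continuousOn_evenPart {v : Plane → ℝ} (h : ContinuousOn v (Icc (-1) 1 ×ˢ Icc (-1) 1)) :
    ContinuousOn (evenPart v) (Icc (-1) 1 ×ˢ Icc (-1) 1) := by
  refine (h.add (h.comp continuous_neg.continuousOn fun p hp => ?_)).div_const 2
  exact ⟨⟨neg_le_neg hp.1.2, neg_le.2 hp.1.1⟩, neg_le_neg hp.2.2, neg_le.2 hp.2.1⟩

/-- A continuous function on the closed square with weak derivatives in `L²(Ω)` is its own trace on
every subsquare. -/
lemma tracedH1_subRect {v vx vy : Plane → ℝ} (hv : ContinuousOn v (Icc (-1) 1 ×ˢ Icc (-1) 1))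
    (hx : MemLp vx 2 (volume.restrict Omega)) (hy : MemLp vy 2 (volume.restrict Omega))
    (hwx : IsWeakPartial Omega (1, 0) v vx) (hwy : IsWeakPartial Omega (0, 1) v vy) (i : Fin 4) :
    TracedH1 (subRect i) v vx vy v := by
  have hsub : Subsq i ⊆ Omega := subsq_subset_omega i
  have hle := Measure.restrict_mono hsub (le_refl (volume : Measure Plane))
  refine tracedH1_of_continuousOn (subRect_lt i).1 (subRect_lt i).2 (hv.mono ?_)
    (hx.mono_measure hle) (hy.mono_measure hle) (hwx.mono isOpen_omega.measurableSet hsub)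
    (hwy.mono isOpen_omega.measurableSet hsub)
  have := closure_mono hsub
  rwa [closure_omega, Subsq, Rect.set, closure_prod_eq, closure_Ioo (subRect_lt i).1.ne,
    closure_Ioo (subRect_lt i).2.ne] at this

/-- The weak solution of a Dirichlet problem with even data is even. -/
lemma IsDirichletSolution.even {f g u : Plane → ℝ} (hu : IsDirichletSolution square f g u)
    (hf : ∀ p, f (-p) = f p) (hg : ∀ p, g (-p) = g p) :
    (fun p => u (-p)) =ᵐ[volume.restrict Omega] u := by
  obtain ⟨h1, h2, h3⟩ := hu
  have hT := TracedH1.of_hasTrace h1 h3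
  have hT' := hT.reflect isRefl_square
  have hd := (hT.sub hT').ae_eq_zero (by simp [square]) (by simp [square]) ?_ ?_
  · filter_upwards [hd] with p hp
    simp only [Function.comp_apply, refl_neg_neg, Pi.zero_apply] at hp
    linarith
  · intro φ hφ
    have hφ' : IsTest square.set (φ ∘ refl (-1) (-1)) := by
      have := (show IsTest Omega φ from hφ).comp_neg
      rw [refl_neg_neg]; exact this
    have e1 := (hT.weakPoisson_iff.1 h2) φ hφ
    have e2 := (hT.weakPoisson_iff.1 h2) _ hφ'
    rw [← integral_gradient_refl isRefl_square.sq_left isRefl_square.sq_right hφ.1,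
      ← isRefl_square.set_eq] at e2
    have e3 : ∫ p in square.set, f p * (φ ∘ refl (-1) (-1)) p = ∫ p in square.set, f p * φ p := by
      have := setIntegral_omega_neg fun p => f p * φ p
      simp only [hf] at this
      rw [refl_neg_neg]; exact this
    have i1 : Integrable (fun p => wdx square.set u p * dx φ p + wdy square.set u p * dy φ p)
        (volume.restrict square.set) := integrable_gradient hT.memLp_x hT.memLp_y hφ.1
    have i2 : Integrable (fun p => -1 * wdx square.set u (refl (-1) (-1) p) * dx φ p +
        -1 * wdy square.set u (refl (-1) (-1) p) * dy φ p)
        (volume.restrict square.set) := integrable_gradient hT'.memLp_x hT'.memLp_y hφ.1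
    have := integral_sub i1 i2
    rw [e1, e2, e3, sub_self] at this
    rw [← this]
    exact integral_congr_ae (Eventually.of_forall fun p => by ring)
  · refine Eventually.of_forall fun p => ?_
    simp only [Function.comp_apply, refl_neg_neg, hg, sub_self]

/-- The boundary cross-points lie on the skeleton. -/
lemma mem_skeleton (i : Fin 4) : ((0, signY i) : Plane) ∈ skeleton ∧
    ((signX i, 0) : Plane) ∈ skeleton := by
  have hx1 : signX i * signX i = 1 := (isRefl_subRect i).sq_left
  have hy1 : signY i * signY i = 1 := (isRefl_subRect i).sq_right
  have hclos : (1 : ℝ) ∈ closure (Ioo (0 : ℝ) 1) := by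
    rw [closure_Ioo zero_ne_one]; exact right_mem_Icc.2 zero_le_one
  obtain ⟨j, hij, -, hj⟩ := exists_neighbour_x i
  obtain ⟨k, hik, hk, -⟩ := exists_neighbour_y i
  constructor
  · refine mem_iUnion₂.2 ⟨i, j, mem_iUnion.2 ⟨hij, ?_⟩⟩
    have := map_mem_closure (f := fun y : ℝ => ((0, signY i * y) : Plane)) (t := interface i j)
      (continuous_const.prodMk (continuous_const.mul continuous_id)) hclos fun y hy => by
        refine (interface_x hij hj).2 ⟨rfl, ?_⟩
        simpa only [← mul_assoc, hy1, one_mul, mem_Ioo] using hy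
    simpa using this
  · refine mem_iUnion₂.2 ⟨i, k, mem_iUnion.2 ⟨hik, ?_⟩⟩
    have := map_mem_closure (f := fun x : ℝ => ((signX i * x, 0) : Plane)) (t := interface i k)
      ((continuous_const.mul continuous_id).prodMk continuous_const) hclos fun x hx => by
        refine (interface_y hik hk).2 ⟨rfl, ?_⟩
        simpa only [← mul_assoc, hx1, one_mul, mem_Ioo] using hx
    simpa using this

/-- A function in `H²(Ω)` with prescribed values at the boundary cross-points has a continuous
representative with these values. -/
lemma Compatible.exists_continuousOn {g u0 ψ0 : Plane → ℝ} (h : Compatible g u0 ψ0) :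
    ∃ w : Plane → ℝ, w =ᵐ[volume.restrict Omega] u0 ∧
      ContinuousOn w (Icc (-1) 1 ×ˢ Icc (-1) 1) ∧
      (w (1, 0) = g (1, 0) ∧ w (-1, 0) = g (-1, 0)) ∧ w (0, 1) = g (0, 1) ∧ w (0, -1) = g (0, -1) := by
  have hpt := h.2.2.2
  have m1 : ((1, 0) : Plane) ∈ frontier Omega ∩ skeleton :=
    ⟨mem_frontier_omega_iff.2 (by simp), by simpa [signX] using (mem_skeleton 1).2⟩
  have m2 : ((-1, 0) : Plane) ∈ frontier Omega ∩ skeleton :=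
    ⟨mem_frontier_omega_iff.2 (by simp), by simpa [signX] using (mem_skeleton 0).2⟩
  have m3 : ((0, 1) : Plane) ∈ frontier Omega ∩ skeleton :=
    ⟨mem_frontier_omega_iff.2 (by simp), by simpa [signY] using (mem_skeleton 2).1⟩
  have m4 : ((0, -1) : Plane) ∈ frontier Omega ∩ skeleton :=
    ⟨mem_frontier_omega_iff.2 (by simp), by simpa [signY] using (mem_skeleton 0).1⟩
  obtain ⟨w, hw, hc, hp1⟩ := hpt _ m1
  -- two continuous representatives agree on the closed square
  have huniq : ∀ p ∈ frontier Omega ∩ skeleton, w p = g p := by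
    intro p hp
    obtain ⟨w', hw', hc', hp'⟩ := hpt _ hp
    rw [← hp']
    have hopen : EqOn w w' Omega := Measure.eqOn_open_of_ae_eq (μ := volume) (hw.trans hw'.symm)
      isOpen_omega (hc.mono subset_closure) (hc'.mono subset_closure)
    exact hopen.of_subset_closure hc hc' subset_closure subset_rfl (frontier_subset_closure hp.1)
  refine ⟨w, hw, ?_, ⟨huniq _ m1, huniq _ m2⟩, huniq _ m3, huniq _ m4⟩
  rw [← closure_omega]
  exact hc

/-- All that determines the iterates. The errors of the first iterate and all Neumann corrections
are multiples of `E ∘ fold`, where `E = A + 2 θ B` is harmonic in the first quadrant of the square.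
The boundary values of `A` come from `u - u⁰`, those of `B` from `ψ⁰`. Traces are represented by
functions that serve all subsquares at the same time. -/
structure ErrorProfile (g u w ψ : Plane → ℝ) where
  /-- The part of the first error that comes from `u⁰`. -/
  A : Plane → ℝ
  /-- The weak derivative of `A` in `x`. -/
  Ax : Plane → ℝ
  /-- The weak derivative of `A` in `y`. -/
  Ay : Plane → ℝ
  /-- The trace of `A`. -/
  tA : Plane → ℝ
  /-- The part of the first error that comes from `ψ⁰`, up to the factor `2 θ`. -/
  B : Plane → ℝ
  /-- The weak derivative of `B` in `x`. -/
  Bx : Plane → ℝ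
  /-- The weak derivative of `B` in `y`. -/
  By : Plane → ℝ
  /-- The trace of `B`. -/
  tB : Plane → ℝ
  /-- The trace of the exact solution. -/
  tu : Plane → ℝ
  /-- The trace of the initial guess `u⁰`. -/
  tw : Plane → ℝ
  /-- The trace of the initial guess `ψ⁰`. -/
  tψ : Plane → ℝ
  traced_A : TracedH1 (subRect 2) A Ax Ay tA
  divFree_A : IsDivFree (Subsq 2) (Subsq 2) Ax Ay
  traced_B : TracedH1 (subRect 2) B Bx By tB
  divFree_B : IsDivFree (Subsq 2) (Subsq 2) Bx By
  traced_u : ∀ i, TracedH1 (subRect i) u (wdx Omega u) (wdy Omega u) tu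
  memH1_w : ∀ i, MemH1 (Subsq i) w
  hasTrace_w : ∀ i, HasTrace (subRect i) w tw
  memH1_psi : ∀ i, MemH1 (Subsq i) ψ
  hasTrace_psi : ∀ i, HasTrace (subRect i) ψ tψ
  tu_outer : ∀ p ∈ frontier Omega, tu p = g p
  tA_outer : ∀ p ∈ frontier Omega, tA (fold p) = 0
  tB_outer : ∀ p ∈ frontier Omega, tB (fold p) = 0
  tA_inner : ∀ p : Plane, p.1 = 0 ∨ p.2 = 0 → tA (fold p) = tu p - tw p
  tB_inner : ∀ p : Plane, p.1 = 0 ∨ p.2 = 0 → tB (fold p) = tψ p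

lemma nonempty_errorProfile {f g u0 ψ0 ue : Plane → ℝ} (hg : MemH32 square g)
    (hcomp : Compatible g u0 ψ0)
    (hue : IsDirichletSolution square (evenPart f) (evenPart g) ue) :
    Nonempty (ErrorProfile (evenPart g) ue (evenPart u0) (evenPart ψ0)) := by
  obtain ⟨G, hG2, hGc, hGg⟩ := hg
  obtain ⟨w, hw, hwc, ⟨hw1, hw2⟩, hw3, hw4⟩ := hcomp.exists_continuousOn
  rw [show closure square.set = _ from closure_omega] at hGc
  have hGe := hG2.hasMixedPartials.evenPart
  have hGec := continuousOn_evenPart hGc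
  have hwe := (hcomp.1.hasMixedPartials.congr hw.symm).evenPart
  have hwec := continuousOn_evenPart hwc
  have hfold : ∀ p : Plane, p ∈ frontier Omega → |(fold p).1| = 1 ∨ |(fold p).2| = 1 := by
    intro p hp
    simp only [fold, abs_abs]
    rcases mem_frontier_omega_iff.1 hp with h | h
    exacts [Or.inr h.2, Or.inl h.1]
  have hGg' : ∀ p ∈ frontier Omega, evenPart G p = evenPart g p := by
    intro p hp
    have hp' : -p ∈ frontier Omega := by
      rw [mem_frontier_omega_iff] at hp ⊢
      simpa using hp
    simp only [evenPart]
    rw [hGg p hp, hGg _ hp']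
  -- the values on the axes are lifted to the first quadrant
  have hW := (hGe.comb 1 (-1) hwe).mono (measurableSet_box _ _ _ _) (subsq_subset_omega 2)
  have hWc : ContinuousOn (fun p => 1 * evenPart G p + -1 * evenPart w p)
      (Icc 0 1 ×ˢ Icc 0 1) :=
    ((continuousOn_const.mul hGec).add (continuousOn_const.mul hwec)).mono
      (prod_mono (Icc_subset_Icc (by norm_num) le_rfl) (Icc_subset_Icc (by norm_num) le_rfl))
  obtain ⟨l, lx, ly, hl, hl1, hl2, hl3, hl4⟩ := hW.exists_lift hWc
    (by
      rw [hGg' (1, 0) (mem_frontier_omega_iff.2 (by simp))]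
      simp [evenPart, hw1, hw2])
    (by
      rw [hGg' (0, 1) (mem_frontier_omega_iff.2 (by simp))]
      simp [evenPart, hw3, hw4])
  obtain ⟨-, Gx, Gy, -, -, ⟨mGx, mGy, -, -⟩, hGx, hGy, -, -⟩ := hGe
  obtain ⟨-, wx, wy, -, -, ⟨mwx, mwy, -, -⟩, hwx, hwy, -, -⟩ := hwe
  -- the difference of the exact solution and the extension of the boundary values
  have hGsq : TracedH1 square (evenPart G) Gx Gy (evenPart G) :=
    tracedH1_of_continuousOn (by simp [square]) (by simp [square]) hGec mGx mGy hGx hGy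
  have hu := TracedH1.of_hasTrace hue.1 hue.2.2
  have hv := (hu.sub hGsq).congr (t' := 0) ae_eq_rfl ae_eq_rfl ae_eq_rfl (by
    have : ∀ p ∈ frontier Omega, evenPart g p - evenPart G p = 0 := fun p hp =>
      sub_eq_zero.2 (hGg' p hp).symm
    have hle : ∀ y ∈ Ioo (-1 : ℝ) 1, |y| ≤ 1 := fun y hy => (abs_lt.2 hy).le
    refine ae_arc_iff.2 ⟨⟨?_, ?_⟩, ?_, ?_⟩ <;>
      filter_upwards [ae_restrict_mem measurableSet_Ioo] with y hy <;>
      refine this _ (mem_frontier_omega_iff.2 ?_) <;> simp [square, hle y hy])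
  obtain ⟨tv, htv1, htv2, htv3⟩ := exists_even_trace hv (by
    filter_upwards [hue.even (evenPart_neg f) (evenPart_neg g)] with p hp
    rw [hp, evenPart_neg])
  have hψ := TracedH1.of_hasTrace hcomp.2.2.1.1 hcomp.2.2.1.2
  have hψe : TracedH1 square (evenPart ψ0) _ _ 0 :=
    ((hψ.add (hψ.reflect isRefl_square)).const_mul (1 / 2)).congr
      (Eventually.of_forall fun p => by
        simp only [evenPart, Function.comp_apply, refl_neg_neg]; ring) ae_eq_rfl ae_eq_rfl
      (Eventually.of_forall fun p => by simp)
  obtain ⟨tψ, htψ1, htψ2, htψ3⟩ := exists_even_trace hψe (Eventually.of_forall (evenPart_neg ψ0))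
  have hwi : ∀ i, TracedH1 (subRect i) (evenPart u0) wx wy (evenPart w) := fun i => by
    refine (tracedH1_subRect hwec mwx mwy hwx hwy i).congr ?_ ae_eq_rfl ae_eq_rfl
      (Eventually.of_forall fun p => rfl)
    refine ae_restrict_of_ae_restrict_of_subset (subsq_subset_omega i) ?_
    filter_upwards [hw, measurePreserving_neg_omega.quasiMeasurePreserving.ae_eq_comp hw]
      with p hp hp'
    simp only [Function.comp_apply] at hp'
    simp only [evenPart, hp, hp']
  obtain ⟨A, Ax, Ay, hA, hAd⟩ := exists_harmonic ((htv3 2).add hl)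
  obtain ⟨B, Bx, By, hB, hBd⟩ := exists_harmonic (htψ3 2)
  exact ⟨{
    A := A
    Ax := Ax
    Ay := Ay
    tA := fun p => tv p + l p
    B := B
    Bx := Bx
    By := By
    tB := tψ
    tu := fun p => tv p + evenPart G p
    tw := evenPart w
    tψ := tψ
    traced_A := hA
    divFree_A := hAd
    traced_B := hB
    divFree_B := hBd
    traced_u := fun i => ((htv3 i).add (tracedH1_subRect hGec mGx mGy hGx hGy i)).congr
      (Eventually.of_forall fun p => sub_add_cancel _ _)
      (Eventually.of_forall fun p => sub_add_cancel _ _)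
      (Eventually.of_forall fun p => sub_add_cancel _ _) (Eventually.of_forall fun p => rfl)
    memH1_w := fun i => (hwi i).memH1
    hasTrace_w := fun i => (hwi i).hasTrace
    memH1_psi := fun i => (htψ3 i).memH1
    hasTrace_psi := fun i => (htψ3 i).hasTrace
    tu_outer := fun p hp => by
      have : |p.1| = 1 ∨ |p.2| = 1 := by simpa only [fold, abs_abs] using hfold p hp
      rw [htv2 p this, hGg' p hp, zero_add]
    tA_outer := fun p hp => by
      rw [htv2 _ (hfold p hp), zero_add]
      rcases mem_frontier_omega_iff.1 hp with h | h <;> simp only [fold, h, hl3, hl4]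
    tB_outer := fun p hp => htψ2 _ (hfold p hp)
    tA_inner := fun p hp => by
      have hl' : l (fold p) = 1 * evenPart G (fold p) + -1 * evenPart w (fold p) := by
        rcases hp with h | h <;> simp only [fold, h, abs_zero, hl1, hl2]
      simp only [comp_fold_of_even htv1 hp, hl', comp_fold_of_even (evenPart_neg G) hp,
        comp_fold_of_even (evenPart_neg w) hp]
      ring
    tB_inner := fun p hp => comp_fold_of_even htψ1 hp }⟩

/-! ### Uniqueness of the iterates -/

lemma TracedH1.normalDeriv_eq {R : Rect} {v vx vy t : Plane → ℝ} (hv : TracedH1 R v vx vy t)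
    (h φ : Plane → ℝ) :
    normalDeriv R.set v h φ = ∫ p in R.set, (vx p * dx φ p + vy p * dy φ p - h p * φ p) := by
  refine integral_congr_ae ?_
  filter_upwards [hv.wdx_ae, hv.wdy_ae] with p hx hy
  rw [hx, hy]

lemma TracedH1.integrable_gradient {R : Rect} {v vx vy t φ : Plane → ℝ}
    (hv : TracedH1 R v vx vy t) (hφ : ContDiff ℝ ∞ φ) :
    Integrable (fun p => vx p * dx φ p + vy p * dy φ p) (volume.restrict R.set) :=
  NeumannNeumann.integrable_gradient hv.memLp_x hv.memLp_y hφ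

/-- Uniqueness for the Dirichlet problem, for two functions with the same right-hand side. -/
lemma TracedH1.ae_eq {R : Rect} (hab : R.a < R.b) (hcd : R.c < R.d)
    {v vx vy t v' vx' vy' t' h : Plane → ℝ} (hv : TracedH1 R v vx vy t)
    (hv' : TracedH1 R v' vx' vy' t') (hp : WeakPoisson R.set v h) (hp' : WeakPoisson R.set v' h)
    (ht : ∀ᵐ p ∂(R.arc), t p = t' p) : v =ᵐ[volume.restrict R.set] v' := by
  have := (hv.sub hv').ae_eq_zero hab hcd (fun φ hφ => ?_) (ht.mono fun p hp => sub_eq_zero.2 hp)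
  · exact this.mono fun p hp => sub_eq_zero.1 hp
  · have e : ∀ p, (vx p - vx' p) * dx φ p + (vy p - vy' p) * dy φ p =
        (vx p * dx φ p + vy p * dy φ p) - (vx' p * dx φ p + vy' p * dy φ p) := fun p => by ring
    simp only [e]
    rw [integral_sub (hv.integrable_gradient hφ.1) (hv'.integrable_gradient hφ.1),
      hv.weakPoisson_iff.1 hp φ hφ, hv'.weakPoisson_iff.1 hp' φ hφ, sub_self]

/-- The previous iterates determine the result of the Dirichlet step. The interface condition
involves the trace of the neighbour, which is transported by `ae_arc_of_ae_arc`. -/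
lemma DirichletStep.unique {θ : ℝ} {f g : Plane → ℝ} {u ψ v u' ψ' v' : Fin 4 → Plane → ℝ}
    (h : DirichletStep θ f g u ψ v) (h' : DirichletStep θ f g u' ψ' v')
    (hu : ∀ i, u i =ᵐ[volume.restrict (Subsq i)] u' i)
    (hψ : ∀ i, ψ i =ᵐ[volume.restrict (Subsq i)] ψ' i) (hmu : ∀ i, MemH1 (Subsq i) (u i))
    (hmu' : ∀ i, MemH1 (Subsq i) (u' i)) (hmψ : ∀ i, MemH1 (Subsq i) (ψ i))
    (hmψ' : ∀ i, MemH1 (Subsq i) (ψ' i)) (i : Fin 4) :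
    v i =ᵐ[volume.restrict (Subsq i)] v' i := by
  obtain ⟨hv, tv, tu, tψ, ht, hout, hin⟩ := h
  obtain ⟨hv', tv', tu', tψ', ht', hout', hin'⟩ := h'
  have hlt := subRect_lt
  have eu := ((TracedH1.of_hasTrace (hmu i) (ht i).2.1).unique (hlt i).1 (hlt i).2
    (TracedH1.of_hasTrace (hmu' i) (ht' i).2.1) (hu i)).2.2
  have eψ : ∀ j, ∀ᵐ p ∂((subRect j).arc), tψ j p = tψ' j p := fun j =>
    ((TracedH1.of_hasTrace (hmψ j) (ht j).2.2).unique (hlt j).1 (hlt j).2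
      (TracedH1.of_hasTrace (hmψ' j) (ht' j).2.2) (hψ j)).2.2
  have eψ' : ∀ j, ∀ᵐ p ∂((subRect i).arc), i ≠ j → p ∈ interface i j → tψ j p = tψ' j p := by
    intro j
    rcases eq_or_ne i j with hij | hij
    · exact Eventually.of_forall fun p h => absurd hij h
    · exact (ae_arc_of_ae_arc hij (eψ j)).mono fun p hp _ => hp
  have ein : ∀ j, ∀ᵐ p ∂((subRect i).arc), i ≠ j → p ∈ interface i j → tv i p = tv' i p := by
    intro j
    rcases eq_or_ne i j with hij | hij
    · exact Eventually.of_forall fun p h => absurd hij h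
    · rcases (interface i j).eq_empty_or_nonempty with he | hne
      · exact Eventually.of_forall fun p _ hp => by simp [he] at hp
      · filter_upwards [hin i j hij hne, hin' i j hij hne, eu, eψ i, eψ' j]
          with p h1 h2 h3 h4 h5 _ hp
        rw [h1 hp, h2 hp, h3, h4, h5 hij hp]
  refine (TracedH1.of_hasTrace (hv i).1 (ht i).1).ae_eq (hlt i).1 (hlt i).2
    (TracedH1.of_hasTrace (hv' i).1 (ht' i).1) (hv i).2 (hv' i).2 ?_
  filter_upwards [ae_arc_mem i, hout i, hout' i, ae_all_iff.2 ein] with p hp h1 h2 h3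
  rcases hp with hp | ⟨j, hij, hp⟩
  · rw [h1 hp, h2 hp]
  · exact h3 j hij hp

/-- The reflection onto the first quadrant takes a subsquare and its neighbour across the `x`-axis
to the first quadrant and its neighbour across the `x`-axis. -/
lemma preimage_refl_subset_y {i j : Fin 4} (hij : i ≠ j) (hx : signX j = signX i)
    (hy : signY j = -signY i) : refl (signX i) (signY i) ⁻¹' box 0 1 (-1) 1 ⊆
      Subsq i ∪ interface i j ∪ Subsq j := by
  rintro p ⟨⟨h1, h2⟩, h3, h4⟩
  simp only [refl] at h1 h2 h3 h4
  rcases lt_trichotomy (signY i * p.2) 0 with h | h | h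
  · exact Or.inr (mem_subsq_iff.2 ⟨by rw [hx]; exact ⟨h1, h2⟩, by rw [hy]; linarith,
      by rw [hy]; linarith⟩)
  · refine Or.inl (Or.inr ((interface_y hij hx).2 ⟨?_, h1, h2⟩))
    rcases signY_eq i with h' | h' <;> rw [h'] at h <;> linarith
  · exact Or.inl (Or.inl (mem_subsq_iff.2 ⟨⟨h1, h2⟩, h, h4⟩))

/-- As `preimage_refl_subset_y`, for the neighbour across the `y`-axis. -/
lemma preimage_refl_subset_x {i j : Fin 4} (hij : i ≠ j) (hx : signX j = -signX i)
    (hy : signY j = signY i) : refl (signX i) (signY i) ⁻¹' box (-1) 1 0 1 ⊆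
      Subsq i ∪ interface i j ∪ Subsq j := by
  rintro p ⟨⟨h1, h2⟩, h3, h4⟩
  simp only [refl] at h1 h2 h3 h4
  rcases lt_trichotomy (signX i * p.1) 0 with h | h | h
  · exact Or.inr (mem_subsq_iff.2 ⟨⟨by rw [hx]; linarith, by rw [hx]; linarith⟩,
      by rw [hy]; exact ⟨h3, h4⟩⟩)
  · refine Or.inl (Or.inr ((interface_x hij hy).2 ⟨?_, h3, h4⟩))
    rcases signX_eq i with h' | h' <;> rw [h'] at h <;> linarith
  · exact Or.inl (Or.inl (mem_subsq_iff.2 ⟨⟨h, h2⟩, h3, h4⟩))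

/-- The Neumann correction is determined on each subsquare separately: the difference of two of them
solves a mixed problem with zero data. -/
lemma NeumannStep.unique {f : Plane → ℝ} {u ψ u' ψ' : Fin 4 → Plane → ℝ}
    (h : NeumannStep f u ψ) (h' : NeumannStep f u' ψ')
    (hu : ∀ i, u i =ᵐ[volume.restrict (Subsq i)] u' i) (hmu : ∀ i, MemH1 (Subsq i) (u i))
    (i : Fin 4) : ψ i =ᵐ[volume.restrict (Subsq i)] ψ' i := by
  obtain ⟨hψ, htr, hn⟩ := h
  obtain ⟨hψ', htr', hn'⟩ := h'
  obtain ⟨t, ht, ht0⟩ := htr i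
  obtain ⟨t', ht', ht0'⟩ := htr' i
  have T := TracedH1.of_hasTrace (hψ i).1 ht
  have T' := TracedH1.of_hasTrace (hψ' i).1 ht'
  have D := T.sub T'
  have hR := (isRefl_subRect i).symm
  -- the normal derivatives of `u` and `u'` agree since `u` and `u'` have the same weak gradients
  have hnu : ∀ j φ, normalDeriv (Subsq j) (u j) f φ = normalDeriv (Subsq j) (u' j) f φ := by
    intro j φ
    refine integral_congr_ae ?_
    have e1 := (weakPartial_spec (hmu j).2.1)
    have e2 := (weakPartial_spec (hmu j).2.2)
    have e3 : wdx (Subsq j) (u' j) =ᵐ[volume.restrict (Subsq j)] wdx (Subsq j) (u j) :=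
      weakPartial_ae_eq (e1.2.congr (hu j)) e1.1
    have e4 : wdy (Subsq j) (u' j) =ᵐ[volume.restrict (Subsq j)] wdy (Subsq j) (u j) :=
      weakPartial_ae_eq (e2.2.congr (hu j)) e2.1
    filter_upwards [e3, e4] with p h3 h4
    rw [h3, h4]
  have hfree : ∀ j, i ≠ j → (interface i j).Nonempty → IsDivFree (Subsq i)
      (Subsq i ∪ interface i j ∪ Subsq j)
      (fun p => wdx (Subsq i) (ψ i) p - wdx (Subsq i) (ψ' i) p)
      (fun p => wdy (Subsq i) (ψ i) p - wdy (Subsq i) (ψ' i) p) := by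
    intro j hij hne φ hφ
    have e1 := hn i j hij hne φ hφ
    have e2 := hn' i j hij hne φ hφ
    rw [← hnu i, ← hnu j, ← e1] at e2
    rw [Subsq, T.normalDeriv_eq, T'.normalDeriv_eq] at e2
    simp only [Pi.zero_apply, zero_mul, sub_zero] at e2
    have e : ∀ p, (wdx (Subsq i) (ψ i) p - wdx (Subsq i) (ψ' i) p) * dx φ p +
        (wdy (Subsq i) (ψ i) p - wdy (Subsq i) (ψ' i) p) * dy φ p =
        (wdx (Subsq i) (ψ i) p * dx φ p + wdy (Subsq i) (ψ i) p * dy φ p) -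
          (wdx (Subsq i) (ψ' i) p * dx φ p + wdy (Subsq i) (ψ' i) p * dy φ p) := fun p => by ring
    simp only [e]
    exact (integral_sub (T.integrable_gradient hφ.1) (T'.integrable_gradient hφ.1)).trans
      (sub_eq_zero.2 e2.symm)
  -- pulled back to the first quadrant, the difference solves the mixed problem with zero data
  have D2 := D.reflect hR
  have hpre : ∀ {j : Fin 4} {V : Set Plane}, i ≠ j → (interface i j).Nonempty →
      refl (signX i) (signY i) ⁻¹' V ⊆ Subsq i ∪ interface i j ∪ Subsq j →
      IsDivFree (box 0 1 0 1) V
        (fun p => signX i * (wdx (Subsq i) (ψ i) (refl (signX i) (signY i) p) -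
          wdx (Subsq i) (ψ' i) (refl (signX i) (signY i) p)))
        (fun p => signY i * (wdy (Subsq i) (ψ i) (refl (signX i) (signY i) p) -
          wdy (Subsq i) (ψ' i) (refl (signX i) (signY i) p))) := by
    intro j V hij hne hV φ hφ
    have hinv : ∀ p, refl (signX i) (signY i) (refl (signX i) (signY i) p) = p :=
      refl_refl hR.sq_left hR.sq_right
    have hVV : refl (signX i) (signY i) ⁻¹' (refl (signX i) (signY i) ⁻¹' V) = V := by
      ext p; simp only [mem_preimage, hinv]
    have hUU : refl (signX i) (signY i) ⁻¹' (Subsq i) = box 0 1 0 1 := hR.set_eq.symm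
    have := IsDivFree.refl (U := Subsq i) (V := refl (signX i) (signY i) ⁻¹' V)
      (fun χ hχ => hfree j hij hne χ ⟨hχ.1, hχ.2.1, hχ.2.2.trans hV⟩) hR.sq_left hR.sq_right
    rw [hVV, hUU] at this
    exact this φ hφ
  obtain ⟨j, hij, hj1, hj2⟩ := exists_neighbour_x i
  obtain ⟨k, hik, hk1, hk2⟩ := exists_neighbour_y i
  have hd : ∀ᵐ p ∂((subRect i).arc), p ∈ frontier Omega → t p - t' p = 0 := by
    filter_upwards [ht0, ht0'] with p h1 h2 hp
    rw [h1 hp, h2 hp, sub_self]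
  obtain ⟨⟨-, hdx⟩, -, hdy⟩ := ae_arc_subRect_iff.1 hd
  have hX : |signX i| = 1 := by rcases signX_eq i with h | h <;> rw [h] <;> norm_num
  have hY : |signY i| = 1 := by rcases signY_eq i with h | h <;> rw [h] <;> norm_num
  have hzero := ae_eq_zero_of_mixed D2.x D2.y ?_ ?_
    (hpre hik (interface_y_nonempty hik hk1) (preimage_refl_subset_y hik hk1 hk2))
    (hpre hij (interface_x_nonempty hij hj2) (preimage_refl_subset_x hij hj1 hj2))
  · have := (isRefl_subRect i).ae_comp (v := (fun p => ψ i p - ψ' i p) ∘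
      refl (signX i) (signY i)) (w := 0) hzero
    filter_upwards [this] with p hp
    simp only [Function.comp_apply, refl_refl hR.sq_left hR.sq_right, Pi.zero_apply] at hp
    exact sub_eq_zero.1 hp
  · filter_upwards [hdx, ae_restrict_mem measurableSet_Ioo] with y hy hy'
    simp only [Function.comp_apply, refl, mul_one]
    refine hy (mem_frontier_omega_iff.2 (Or.inr ⟨hX, ?_⟩))
    simp only [abs_mul, hY, one_mul, abs_of_pos hy'.1]; exact hy'.2.le
  · filter_upwards [hdy, ae_restrict_mem measurableSet_Ioo] with x hx hx'
    simp only [Function.comp_apply, Prod.swap_prod_mk, refl, mul_one]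
    refine hx (mem_frontier_omega_iff.2 (Or.inl ⟨?_, hY⟩))
    simp only [abs_mul, hX, one_mul, abs_of_pos hx'.1]; exact hx'.2.le

lemma MemH1.congr {a b c d : ℝ} {v v' : Plane → ℝ} (h : MemH1 (box a b c d) v)
    (hv : v =ᵐ[volume.restrict (box a b c d)] v') : MemH1 (box a b c d) v' := by
  obtain ⟨h0, ⟨vx, hx, hx'⟩, vy, hy, hy'⟩ := h
  exact ⟨(memLp_congr_ae hv).1 h0, ⟨vx, hx, hx'.congr hv⟩, vy, hy, hy'.congr hv⟩

lemma IsNNSequence.unique {θ : ℝ} {f g u0 ψ0 : Plane → ℝ} {u ψ u' ψ' : ℕ → Fin 4 → Plane → ℝ}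
    (h : IsNNSequence θ f g u0 ψ0 u ψ) (h' : IsNNSequence θ f g u0 ψ0 u' ψ')
    (hu0 : ∀ i, MemH1 (Subsq i) u0) (hψ0 : ∀ i, MemH1 (Subsq i) ψ0) (k : ℕ) :
    ∀ i, u k i =ᵐ[volume.restrict (Subsq i)] u' k i ∧
      ψ k i =ᵐ[volume.restrict (Subsq i)] ψ' k i := by
  have hmem : ∀ {u ψ : ℕ → Fin 4 → Plane → ℝ}, IsNNSequence θ f g u0 ψ0 u ψ → ∀ k i,
      MemH1 (Subsq i) (u k i) ∧ MemH1 (Subsq i) (ψ k i) := by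
    intro u ψ h k i
    cases k with
    | zero => exact ⟨(hu0 i).congr (h.init_u i).symm, (hψ0 i).congr (h.init_psi i).symm⟩
    | succ k => exact ⟨((h.dirichlet k).1 i).1, ((h.neumann k).1 i).1⟩
  induction k with
  | zero =>
    exact fun i => ⟨(h.init_u i).trans (h'.init_u i).symm, (h.init_psi i).trans (h'.init_psi i).symm⟩
  | succ k ih =>
    have hu := (h.dirichlet k).unique (h'.dirichlet k) (fun i => (ih i).1) (fun i => (ih i).2)
      (fun i => (hmem h k i).1) (fun i => (hmem h' k i).1) (fun i => (hmem h k i).2)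
      (fun i => (hmem h' k i).2)
    exact fun i => ⟨hu i, (h.neumann k).unique (h'.neumann k) hu
      (fun i => (hmem h (k + 1) i).1) i⟩

/-! ### Existence of the iterates -/

lemma IsTest.mono {U V : Set Plane} {φ : Plane → ℝ} (h : IsTest U φ) (hUV : U ⊆ V) : IsTest V φ :=
  ⟨h.1, h.2.1, h.2.2.trans hUV⟩

lemma IsTest.dx_eq_zero {U : Set Plane} {φ : Plane → ℝ} (h : IsTest U φ) {p : Plane} (hp : p ∉ U) :
    dx φ p = 0 :=
  image_eq_zero_of_notMem_tsupport (f := dx φ)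
    fun h' => hp (h.2.2 (tsupport_fderiv_apply_subset ℝ (1, 0) h'))

lemma IsTest.dy_eq_zero {U : Set Plane} {φ : Plane → ℝ} (h : IsTest U φ) {p : Plane} (hp : p ∉ U) :
    dy φ p = 0 :=
  image_eq_zero_of_notMem_tsupport (f := dy φ)
    fun h' => hp (h.2.2 (tsupport_fderiv_apply_subset ℝ (0, 1) h'))

/-- `E ∘ fold` is harmonic in every subsquare if `E` is harmonic in the first quadrant. -/
lemma integral_gradient_fold_eq_zero {P Q φ : Plane → ℝ} (h : IsDivFree (Subsq 2) (Subsq 2) P Q)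
    {i : Fin 4} (hφ : IsTest (Subsq i) φ) :
    ∫ p in Subsq i, (signX i * P (fold p) * dx φ p + signY i * Q (fold p) * dy φ p) = 0 := by
  rw [integral_gradient_fold P Q hφ.1]
  rw [Subsq, (isRefl_subRect i).set_eq] at hφ
  exact h _ (hφ.refl (isRefl_subRect i).sq_left (isRefl_subRect i).sq_right)

/-- The normal derivatives of `E ∘ fold` on both sides of an interface, each in its outward
direction, agree. -/
lemma integral_gradient_fold_eq {P Q φ : Plane → ℝ} (h : IsDivFree (Subsq 2) (Subsq 2) P Q)
    (hP : MemLp P 2 (volume.restrict (Subsq 2))) (hQ : MemLp Q 2 (volume.restrict (Subsq 2)))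
    {i j : Fin 4} (hij : i ≠ j) (hne : (interface i j).Nonempty)
    (hφ : IsTest (Subsq i ∪ interface i j ∪ Subsq j) φ) :
    ∫ p in Subsq i, (signX i * P (fold p) * dx φ p + signY i * Q (fold p) * dy φ p) =
      ∫ p in Subsq j, (signX j * P (fold p) * dx φ p + signY j * Q (fold p) * dy φ p) := by
  rw [integral_gradient_fold P Q hφ.1, integral_gradient_fold P Q hφ.1, ← sub_eq_zero]
  have si := smooth_refl hφ.1 (signX i) (signY i)
  have sj := smooth_refl hφ.1 (signX j) (signY j)
  have ii : Integrable (fun p => P p * dx (φ ∘ refl (signX i) (signY i)) p +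
      Q p * dy (φ ∘ refl (signX i) (signY i)) p) (volume.restrict (Subsq 2)) :=
    integrable_gradient hP hQ si
  have ij : Integrable (fun p => P p * dx (φ ∘ refl (signX j) (signY j)) p +
      Q p * dy (φ ∘ refl (signX j) (signY j)) p) (volume.restrict (Subsq 2)) :=
    integrable_gradient hP hQ sj
  rw [← integral_sub ii ij]
  have hX : ∀ i, |signX i| = 1 := fun i => by
    rcases signX_eq i with h | h <;> rw [h] <;> norm_num
  have hY : ∀ i, |signY i| = 1 := fun i => by
    rcases signY_eq i with h | h <;> rw [h] <;> norm_num
  have hzero : ∀ p, p ∉ Omega → φ p = 0 := fun p hp => hφ.eq_zero fun h' => hp <| by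
    rcases h' with (h' | h') | h'
    exacts [subsq_subset_omega _ h', interface_subset_omega _ _ h', subsq_subset_omega _ h']
  have hb : ∀ k y, φ (signX k * 1, y) = 0 := fun k y => hzero _ fun h' => by
    rw [mem_omega_iff, mul_one, hX] at h'; exact lt_irrefl _ h'.1
  have hd : ∀ k x, φ (x, signY k * 1) = 0 := fun k x => hzero _ fun h' => by
    rw [mem_omega_iff, mul_one, hY] at h'; exact lt_irrefl _ h'.2
  -- at the axes, the two reflections of `φ` agree or both vanish
  have hac : (∀ y, φ (0, signY i * y) = φ (0, signY j * y)) ∧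
      ∀ x, φ (signX i * x, 0) = φ (signX j * x, 0) := by
    obtain ⟨q, hq⟩ := hne
    rcases (mem_interface_iff hij).1 hq with ⟨hs, -⟩ | ⟨hs, -⟩
    · refine ⟨fun y => by rw [hs], fun x => ?_⟩
      have : ∀ x, φ (x, 0) = 0 := fun x => hφ.eq_zero fun h' => by
        rcases h' with (h' | h') | h'
        · simpa using (mem_subsq_iff.1 h').2.1
        · simpa using ((interface_x hij hs.symm).1 h').2.1
        · simpa using (mem_subsq_iff.1 h').2.1
      rw [this, this]
    · refine ⟨fun y => ?_, fun x => by rw [hs]⟩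
      have : ∀ y, φ (0, y) = 0 := fun y => hφ.eq_zero fun h' => by
        rcases h' with (h' | h') | h'
        · simpa using (mem_subsq_iff.1 h').1.1
        · simpa using ((interface_y hij hs.symm).1 h').2.1
        · simpa using (mem_subsq_iff.1 h').1.1
      rw [this, this]
  have := IsDivFree.integral_eq_zero (a := 0) (b := 1) (c := 0) (d := 1) h hP hQ (si.sub sj)
    (fun y => ?_) (fun y => ?_) (fun x => ?_) (fun x => ?_)
  · rw [← this]
    refine integral_congr_ae (Eventually.of_forall fun p => ?_)
    have ex := dx_sub si sj p
    have ey := dy_sub si sj p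
    beta_reduce
    rw [ex, ey]; ring
  · simp only [Function.comp_apply, refl, mul_zero, hac.1, sub_self]
  · simp only [Function.comp_apply, refl, hb, sub_self]
  · simp only [Function.comp_apply, refl, mul_zero, hac.2, sub_self]
  · simp only [Function.comp_apply, refl, hd, sub_self]

lemma memLp_evenPart {f : Plane → ℝ} (hf : MemLp f 2 (volume.restrict Omega)) :
    MemLp (evenPart f) 2 (volume.restrict Omega) := by
  have := (hf.add (hf.comp_measurePreserving measurePreserving_neg_omega)).const_mul (1 / 2)
  refine (memLp_congr_ae (Eventually.of_forall fun p => ?_)).1 this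
  simp only [evenPart, Pi.add_apply, Function.comp_apply]; ring

namespace ErrorProfile

variable {f g u w ψ : Plane → ℝ} (P : ErrorProfile g u w ψ) (θ : ℝ)

/-- The first error, as a function on the first quadrant. -/
def E (p : Plane) : ℝ := P.A p + 2 * θ * P.B p

/-- The weak derivative of `E` in `x`. -/
def Ex (p : Plane) : ℝ := P.Ax p + 2 * θ * P.Bx p

/-- The weak derivative of `E` in `y`. -/
def Ey (p : Plane) : ℝ := P.Ay p + 2 * θ * P.By p

/-- The trace of `E`. -/
def tE (p : Plane) : ℝ := P.tA p + 2 * θ * P.tB p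

lemma traced_E : TracedH1 (subRect 2) (P.E θ) (P.Ex θ) (P.Ey θ) (P.tE θ) :=
  P.traced_A.add (P.traced_B.const_mul (2 * θ))

lemma divFree_E : IsDivFree (Subsq 2) (Subsq 2) (P.Ex θ) (P.Ey θ) := by
  intro φ hφ
  have iA : Integrable (fun p => P.Ax p * dx φ p + P.Ay p * dy φ p) (volume.restrict (Subsq 2)) :=
    P.traced_A.integrable_gradient hφ.1
  have iB : Integrable (fun p => P.Bx p * dx φ p + P.By p * dy φ p) (volume.restrict (Subsq 2)) :=
    P.traced_B.integrable_gradient hφ.1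
  have e : ∀ p, P.Ex θ p * dx φ p + P.Ey θ p * dy φ p = (P.Ax p * dx φ p + P.Ay p * dy φ p) +
      2 * θ * (P.Bx p * dx φ p + P.By p * dy φ p) := fun p => by simp only [Ex, Ey]; ring
  simp only [e]
  rw [integral_add iA (iB.const_mul _), integral_const_mul, P.divFree_A φ hφ, P.divFree_B φ hφ,
    mul_zero, add_zero]

lemma tE_outer (p : Plane) (hp : p ∈ frontier Omega) : P.tE θ (fold p) = 0 := by
  rw [tE, P.tA_outer p hp, P.tB_outer p hp, mul_zero, add_zero]

/-- The iterates `uᵏ`: for `k ≥ 1` their errors are `(1 - 4 θ) ^ (k - 1) * E ∘ fold`. -/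
def iterU : ℕ → Fin 4 → Plane → ℝ
  | 0, _ => w
  | k + 1, _ => fun p => u p - (1 - 4 * θ) ^ k * P.E θ (fold p)

/-- The iterates `ψᵏ`: for `k ≥ 1` they are `-2` times the errors of `uᵏ`. -/
def iterPsi : ℕ → Fin 4 → Plane → ℝ
  | 0, _ => ψ
  | k + 1, _ => fun p => -2 * (1 - 4 * θ) ^ k * P.E θ (fold p)

lemma traced_iterU (k : ℕ) (i : Fin 4) : TracedH1 (subRect i) (P.iterU θ (k + 1) i)
    (fun p => wdx Omega u p - (1 - 4 * θ) ^ k * (signX i * P.Ex θ (fold p)))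
    (fun p => wdy Omega u p - (1 - 4 * θ) ^ k * (signY i * P.Ey θ (fold p)))
    (fun p => P.tu p - (1 - 4 * θ) ^ k * P.tE θ (fold p)) :=
  (P.traced_u i).sub (((P.traced_E θ).fold i).const_mul _)

lemma traced_iterPsi (k : ℕ) (i : Fin 4) : TracedH1 (subRect i) (P.iterPsi θ (k + 1) i)
    (fun p => -2 * (1 - 4 * θ) ^ k * (signX i * P.Ex θ (fold p)))
    (fun p => -2 * (1 - 4 * θ) ^ k * (signY i * P.Ey θ (fold p)))
    (fun p => -2 * (1 - 4 * θ) ^ k * P.tE θ (fold p)) :=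
  ((P.traced_E θ).fold i).const_mul _

lemma integrable_fold {φ : Plane → ℝ} (hφ : ContDiff ℝ ∞ φ) (i : Fin 4) :
    Integrable (fun p => signX i * P.Ex θ (fold p) * dx φ p + signY i * P.Ey θ (fold p) * dy φ p)
      (volume.restrict (Subsq i)) :=
  ((P.traced_E θ).fold i).integrable_gradient hφ

/-- The weak form of `-Δu = f`, integrated over a part `V` of `Ω` outside of which `φ` and its
gradient vanish almost everywhere. -/
lemma integral_eq_zero_of_subset (hf : MemLp f 2 (volume.restrict Omega))
    (hu : IsDirichletSolution square f g u) {φ : Plane → ℝ} (hφ : IsTest Omega φ) {V : Set Plane}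
    (hV : V ⊆ Omega) (h : ∀ᵐ p : Plane, p ∉ V → φ p = 0 ∧ dx φ p = 0 ∧ dy φ p = 0) :
    ∫ p in V, (wdx Omega u p * dx φ p + wdy Omega u p * dy φ p - f p * φ p) = 0 := by
  rw [← setIntegral_eq_of_subset_of_ae_sdiff_eq_zero isOpen_omega.measurableSet.nullMeasurableSet hV
    (h.mono fun p hp hp' => by obtain ⟨h1, h2, h3⟩ := hp hp'.2; rw [h1, h2, h3]; simp)]
  have i1 : Integrable (fun p => wdx Omega u p * dx φ p + wdy Omega u p * dy φ p)
      (volume.restrict Omega) :=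
    integrable_gradient (weakPartial_spec hu.1.2.1).1 (weakPartial_spec hu.1.2.2).1 hφ.1
  have i2 : Integrable (fun p => f p * φ p) (volume.restrict Omega) :=
    integrable_mul_continuous hf hφ.1.continuous
  rw [integral_sub i1 i2]
  exact sub_eq_zero.2 (hu.2.1 φ hφ)

lemma integrable_u (hf : MemLp f 2 (volume.restrict Omega))
    (hu : MemH1 Omega u) {φ : Plane → ℝ} (hφ : ContDiff ℝ ∞ φ) {V : Set Plane} (hV : V ⊆ Omega) :
    Integrable (fun p => wdx Omega u p * dx φ p + wdy Omega u p * dy φ p - f p * φ p)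
      (volume.restrict V) := by
  have i1 : Integrable (fun p => wdx Omega u p * dx φ p + wdy Omega u p * dy φ p)
      (volume.restrict Omega) :=
    integrable_gradient (weakPartial_spec hu.2.1).1 (weakPartial_spec hu.2.2).1 hφ
  have i2 : Integrable (fun p => f p * φ p) (volume.restrict Omega) :=
    integrable_mul_continuous hf hφ.continuous
  exact (i1.sub i2).mono_measure (Measure.restrict_mono hV le_rfl)

lemma normalDeriv_iterU (hf : MemLp f 2 (volume.restrict Omega)) (hu : MemH1 Omega u)
    {φ : Plane → ℝ} (hφ : ContDiff ℝ ∞ φ) (k : ℕ) (i : Fin 4) :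
    normalDeriv (Subsq i) (P.iterU θ (k + 1) i) f φ =
      (∫ p in Subsq i, (wdx Omega u p * dx φ p + wdy Omega u p * dy φ p - f p * φ p)) -
      (1 - 4 * θ) ^ k * ∫ p in Subsq i,
        (signX i * P.Ex θ (fold p) * dx φ p + signY i * P.Ey θ (fold p) * dy φ p) := by
  have := integral_sub (integrable_u hf hu hφ (subsq_subset_omega i))
    ((P.integrable_fold θ hφ i).const_mul ((1 - 4 * θ) ^ k))
  rw [integral_const_mul] at this
  rw [← this, Subsq, (P.traced_iterU θ k i).normalDeriv_eq]
  exact integral_congr_ae (Eventually.of_forall fun p => by ring)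

lemma weakPoisson_iterU (hf : MemLp f 2 (volume.restrict Omega))
    (hu : IsDirichletSolution square f g u) (k : ℕ) (i : Fin 4) :
    WeakPoisson (Subsq i) (P.iterU θ (k + 1) i) f := by
  intro φ hφ
  have h1 := P.normalDeriv_iterU θ hf hu.1 hφ.1 k i
  rw [integral_gradient_fold_eq_zero (P.divFree_E θ) hφ, mul_zero, sub_zero,
    integral_eq_zero_of_subset hf hu (hφ.mono (subsq_subset_omega i)) (subsq_subset_omega i)
      (Eventually.of_forall fun p hp => ⟨hφ.eq_zero hp, hφ.dx_eq_zero hp, hφ.dy_eq_zero hp⟩),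
    normalDeriv] at h1
  have T := P.traced_iterU θ k i
  have i1 : Integrable (fun p => wdx (Subsq i) (P.iterU θ (k + 1) i) p * dx φ p +
      wdy (Subsq i) (P.iterU θ (k + 1) i) p * dy φ p) (volume.restrict (Subsq i)) :=
    integrable_gradient (weakPartial_spec T.memH1.2.1).1 (weakPartial_spec T.memH1.2.2).1 hφ.1
  have i2 : Integrable (fun p => f p * φ p) (volume.restrict (Subsq i)) :=
    integrable_mul_continuous (hf.mono_measure (Measure.restrict_mono (subsq_subset_omega i) le_rfl))
      hφ.1.continuous
  rw [integral_sub i1 i2] at h1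
  exact sub_eq_zero.1 h1

lemma normalDeriv_iterPsi (φ : Plane → ℝ) (k : ℕ) (i : Fin 4) :
    normalDeriv (Subsq i) (P.iterPsi θ (k + 1) i) 0 φ = -2 * (1 - 4 * θ) ^ k * ∫ p in Subsq i,
        (signX i * P.Ex θ (fold p) * dx φ p + signY i * P.Ey θ (fold p) * dy φ p) := by
  rw [← integral_const_mul, Subsq, (P.traced_iterPsi θ k i).normalDeriv_eq]
  refine integral_congr_ae (Eventually.of_forall fun p => ?_)
  simp only [Pi.zero_apply]; ring

lemma weakPoisson_iterPsi (k : ℕ) (i : Fin 4) : WeakPoisson (Subsq i) (P.iterPsi θ (k + 1) i) 0 := by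
  intro φ hφ
  have h1 := P.normalDeriv_iterPsi θ φ k i
  rw [integral_gradient_fold_eq_zero (P.divFree_E θ) hφ, mul_zero, normalDeriv] at h1
  simpa using h1

lemma dirichletStep (hf : MemLp f 2 (volume.restrict Omega))
    (hu : IsDirichletSolution square f g u) (k : ℕ) :
    DirichletStep θ f g (P.iterU θ k) (P.iterPsi θ k) (P.iterU θ (k + 1)) := by
  refine ⟨fun i => ⟨(P.traced_iterU θ k i).memH1, P.weakPoisson_iterU θ hf hu k i⟩, ?_⟩
  have hout : ∀ p ∈ frontier Omega, P.tu p - (1 - 4 * θ) ^ k * P.tE θ (fold p) = g p :=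
    fun p hp => by rw [P.tE_outer θ p hp, mul_zero, sub_zero, P.tu_outer p hp]
  have hax : ∀ {i j p}, i ≠ j → p ∈ interface i j → p.1 = 0 ∨ p.2 = 0 := fun hij hp =>
    ((mem_interface_iff hij).1 hp).imp (fun h => h.2.1) fun h => h.2.1
  cases k with
  | zero =>
    refine ⟨fun _ p => P.tu p - (1 - 4 * θ) ^ 0 * P.tE θ (fold p), fun _ => P.tw, fun _ => P.tψ,
      fun i => ⟨(P.traced_iterU θ 0 i).hasTrace, P.hasTrace_w i, P.hasTrace_psi i⟩,
      fun i => Eventually.of_forall hout, fun i j hij _ => Eventually.of_forall fun p hp => ?_⟩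
    simp only [tE, P.tA_inner p (hax hij hp), P.tB_inner p (hax hij hp)]
    ring
  | succ k =>
    refine ⟨fun _ p => P.tu p - (1 - 4 * θ) ^ (k + 1) * P.tE θ (fold p),
      fun _ p => P.tu p - (1 - 4 * θ) ^ k * P.tE θ (fold p),
      fun _ p => -2 * (1 - 4 * θ) ^ k * P.tE θ (fold p), fun i =>
      ⟨(P.traced_iterU θ (k + 1) i).hasTrace, (P.traced_iterU θ k i).hasTrace,
        (P.traced_iterPsi θ k i).hasTrace⟩, fun i => Eventually.of_forall hout,
      fun i j hij _ => Eventually.of_forall fun p hp => ?_⟩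
    ring

lemma neumannStep (hf : MemLp f 2 (volume.restrict Omega))
    (hu : IsDirichletSolution square f g u) (k : ℕ) :
    NeumannStep f (P.iterU θ (k + 1)) (P.iterPsi θ (k + 1)) := by
  refine ⟨fun i => ⟨(P.traced_iterPsi θ k i).memH1, P.weakPoisson_iterPsi θ k i⟩,
    fun i => ⟨_, (P.traced_iterPsi θ k i).hasTrace, Eventually.of_forall fun p hp => ?_⟩,
    fun i j hij hne φ hφ => ?_⟩
  · rw [P.tE_outer θ p hp, mul_zero]
  · have hsub : Subsq i ∪ interface i j ∪ Subsq j ⊆ Omega :=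
      union_subset (union_subset (subsq_subset_omega i) (interface_subset_omega i j))
        (subsq_subset_omega j)
    rw [P.normalDeriv_iterPsi, P.normalDeriv_iterU θ hf hu.1 hφ.1,
      P.normalDeriv_iterU θ hf hu.1 hφ.1,
      ← integral_gradient_fold_eq (P.divFree_E θ) (P.traced_E θ).memLp_x (P.traced_E θ).memLp_y
        hij hne hφ]
    have h0 := integral_eq_zero_of_subset hf hu (hφ.mono hsub)
      (union_subset (subsq_subset_omega i) (subsq_subset_omega j)) (by
        filter_upwards [ae_notMem_interface hij] with p hp hp'
        have : p ∉ Subsq i ∪ interface i j ∪ Subsq j := fun h' => by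
          rcases h' with (h' | h') | h'
          exacts [hp' (Or.inl h'), hp h', hp' (Or.inr h')]
        exact ⟨hφ.eq_zero this, hφ.dx_eq_zero this, hφ.dy_eq_zero this⟩)
    rw [setIntegral_union (disjoint_subsq hij) (measurableSet_subsq j)
      (integrable_u hf hu.1 hφ.1 (subsq_subset_omega i))
      (integrable_u hf hu.1 hφ.1 (subsq_subset_omega j))] at h0
    linear_combination -h0

lemma isNNSequence (hf : MemLp f 2 (volume.restrict Omega))
    (hu : IsDirichletSolution square f g u) :
    IsNNSequence θ f g w ψ (P.iterU θ) (P.iterPsi θ) :=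
  ⟨fun _ => ae_eq_rfl, fun _ => ae_eq_rfl, P.dirichletStep θ hf hu, P.neumannStep θ hf hu⟩

end ErrorProfile

/-! ### The norms of the errors -/

lemma l2Norm_congr {U : Set Plane} {v v' : Plane → ℝ} (h : v =ᵐ[volume.restrict U] v') :
    l2Norm U v = l2Norm U v' := by
  rw [l2Norm, l2Norm]
  congr 1
  exact integral_congr_ae (h.mono fun p hp => by simp only [hp])

lemma l2Norm_const_mul (U : Set Plane) (k : ℝ) (v : Plane → ℝ) :
    l2Norm U (fun p => k * v p) = |k| * l2Norm U v := by
  simp only [l2Norm, mul_pow]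
  rw [integral_const_mul, Real.sqrt_mul (sq_nonneg k), Real.sqrt_sq_eq_abs]

lemma TracedH1.h1Norm_eq {R : Rect} {v vx vy t : Plane → ℝ} (h : TracedH1 R v vx vy t) :
    h1Norm R.set v = Real.sqrt (∫ p in R.set, (v p ^ 2 + vx p ^ 2 + vy p ^ 2)) := by
  rw [h1Norm]
  congr 1
  refine integral_congr_ae ?_
  filter_upwards [h.wdx_ae, h.wdy_ae] with p hx hy
  rw [hx, hy]

lemma TracedH1.h1Norm_const_mul {R : Rect} {v v' vx vy t : Plane → ℝ} (h : TracedH1 R v vx vy t)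
    (k : ℝ) (hv' : v' =ᵐ[volume.restrict R.set] fun p => k * v p) :
    h1Norm R.set v' = |k| * h1Norm R.set v := by
  have h' := (h.const_mul k).congr hv'.symm ae_eq_rfl ae_eq_rfl (Eventually.of_forall fun p => rfl)
  rw [h'.h1Norm_eq, h.h1Norm_eq, ← Real.sqrt_sq_eq_abs, ← Real.sqrt_mul (sq_nonneg k),
    ← integral_const_mul]
  congr 1
  refine integral_congr_ae (hv'.mono fun p hp => ?_)
  beta_reduce
  rw [hp]; ring

lemma h1Error_nonneg (u : Plane → ℝ) (v : Fin 4 → Plane → ℝ) : 0 ≤ h1Error u v := by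
  rw [h1Error, brokenH1Norm]
  exact Finset.sum_nonneg fun _ _ => Real.sqrt_nonneg _

lemma glue_eq {v : Fin 4 → Plane → ℝ} {i : Fin 4} {p : Plane} (hp : p ∈ Subsq i) :
    glue v p = v i p := by
  rw [glue, Finset.sum_eq_single i, indicator_of_mem hp]
  · exact fun j _ hj => indicator_of_notMem (disjoint_left.1 (disjoint_subsq hj.symm) hp) _
  · simp

lemma integrableOn_omega {F : Plane → ℝ} (h : ∀ i, IntegrableOn F (Subsq i)) :
    IntegrableOn F Omega := by
  have h1 : IntegrableOn F (⋃ i, Subsq i) := integrableOn_finite_iUnion.2 h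
  refine h1.congr_set_ae ?_
  filter_upwards [ae_ne_zero] with p hp
  refine propext ⟨fun h' => mem_iUnion.2 (exists_mem_subsq h' hp), fun h' => ?_⟩
  obtain ⟨i, hi⟩ := mem_iUnion.1 h'
  exact subsq_subset_omega i hi

lemma add_mul_sq_le {s : ℝ} (h0 : 0 ≤ s) (h1 : s ≤ 1) (a b : ℝ) :
    (a + s * b) ^ 2 ≤ 2 * a ^ 2 + 2 * b ^ 2 := by
  have h2 : s ^ 2 * b ^ 2 ≤ 1 * b ^ 2 :=
    mul_le_mul_of_nonneg_right (pow_le_one₀ h0 h1) (sq_nonneg b)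
  nlinarith [sq_nonneg (a - s * b)]

lemma ae_forall_subsq {Q : Fin 4 → Plane → Prop}
    (h : ∀ i, ∀ᵐ p ∂(volume.restrict (Subsq i)), Q i p) :
    ∀ᵐ p ∂(volume.restrict Omega), ∀ i, p ∈ Subsq i → Q i p :=
  ae_all_iff.2 fun i => ae_restrict_of_ae ((ae_restrict_iff' (measurableSet_subsq i)).1 (h i))

namespace ErrorProfile

variable {g u w ψ : Plane → ℝ} (P : ErrorProfile g u w ψ)

lemma l2Error_eq {θ r : ℝ} {v : Fin 4 → Plane → ℝ}
    (hv : ∀ i, ∀ᵐ p ∂(volume.restrict (Subsq i)), u p - v i p = r * P.E θ (fold p)) :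
    l2Error u v = |r| * l2Norm Omega (P.E θ ∘ fold) := by
  rw [← l2Norm_const_mul, l2Error]
  refine l2Norm_congr ?_
  filter_upwards [ae_mem_subsq, ae_forall_subsq hv] with p ⟨i, hi⟩ hp
  rw [glue_eq hi, hp i hi]
  rfl

lemma h1Error_eq {θ r : ℝ} {v : Fin 4 → Plane → ℝ}
    (hv : ∀ i, ∀ᵐ p ∂(volume.restrict (Subsq i)), u p - v i p = r * P.E θ (fold p)) :
    h1Error u v = |r| * brokenH1Norm fun _ => P.E θ ∘ fold := by
  rw [h1Error, brokenH1Norm, brokenH1Norm, Finset.mul_sum]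
  exact Finset.sum_congr rfl fun i _ => ((P.traced_E θ).fold i).h1Norm_const_mul r (hv i)

lemma exists_l2_bound : ∃ C, 0 < C ∧ ∀ θ ∈ Ioo (0 : ℝ) (1 / 2),
    l2Norm Omega (P.E θ ∘ fold) ≤ C := by
  refine ⟨Real.sqrt (∫ p in Omega, (2 * P.A (fold p) ^ 2 + 2 * P.B (fold p) ^ 2)) + 1,
    by positivity, fun θ hθ => ?_⟩
  have hi : IntegrableOn (fun p => 2 * P.A (fold p) ^ 2 + 2 * P.B (fold p) ^ 2) Omega :=
    integrableOn_omega fun i => ((P.traced_A.fold i).memLp.integrable_sq.const_mul 2).add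
      ((P.traced_B.fold i).memLp.integrable_sq.const_mul 2)
  refine le_trans (Real.sqrt_le_sqrt ?_) (le_add_of_nonneg_right zero_le_one)
  exact integral_mono_of_nonneg (Eventually.of_forall fun p => sq_nonneg _) hi
    (Eventually.of_forall fun p =>
      add_mul_sq_le (by linarith [hθ.1]) (by linarith [hθ.2]) _ _)

lemma exists_h1_bound : ∃ C, 0 < C ∧ ∀ θ ∈ Ioo (0 : ℝ) (1 / 2),
    brokenH1Norm (fun _ => P.E θ ∘ fold) ≤ C := by
  let F : Fin 4 → Plane → ℝ := fun i p => (2 * P.A (fold p) ^ 2 + 2 * P.B (fold p) ^ 2) +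
    (2 * (signX i * P.Ax (fold p)) ^ 2 + 2 * (signX i * P.Bx (fold p)) ^ 2) +
    (2 * (signY i * P.Ay (fold p)) ^ 2 + 2 * (signY i * P.By (fold p)) ^ 2)
  refine ⟨(∑ i, Real.sqrt (∫ p in Subsq i, F i p)) + 1, by positivity, fun θ hθ => ?_⟩
  refine le_trans (Finset.sum_le_sum fun i _ => ?_) (le_add_of_nonneg_right zero_le_one)
  rw [Subsq, ((P.traced_E θ).fold i).h1Norm_eq]
  have hA := P.traced_A.fold i
  have hB := P.traced_B.fold i
  have hi : IntegrableOn (F i) (Subsq i) :=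
    (((hA.memLp.integrable_sq.const_mul 2).add (hB.memLp.integrable_sq.const_mul 2)).add
      ((hA.memLp_x.integrable_sq.const_mul 2).add (hB.memLp_x.integrable_sq.const_mul 2))).add
      ((hA.memLp_y.integrable_sq.const_mul 2).add (hB.memLp_y.integrable_sq.const_mul 2))
  refine Real.sqrt_le_sqrt (integral_mono_of_nonneg
    (Eventually.of_forall fun p => by positivity) hi (Eventually.of_forall fun p => ?_))
  have h0 : 0 ≤ 2 * θ := by linarith [hθ.1]
  have h1 : 2 * θ ≤ 1 := by linarith [hθ.2]
  refine add_le_add (add_le_add (add_mul_sq_le h0 h1 _ _) ?_) ?_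
  · refine le_trans (le_of_eq ?_) (add_mul_sq_le h0 h1 _ _)
    simp only [Ex]; ring
  · refine le_trans (le_of_eq ?_) (add_mul_sq_le h0 h1 _ _)
    simp only [Ey]; ring

/-- The errors of any sequence of iterates. -/
lemma error_ae_eq {f : Plane → ℝ} (hf : MemLp f 2 (volume.restrict Omega))
    (hu : IsDirichletSolution square f g u) {θ : ℝ} {v χ : ℕ → Fin 4 → Plane → ℝ}
    (h : IsNNSequence θ f g w ψ v χ) (k : ℕ) (i : Fin 4) :
    ∀ᵐ p ∂(volume.restrict (Subsq i)),
      u p - v (k + 1) i p = (1 - 4 * θ) ^ k * P.E θ (fold p) := by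
  filter_upwards [(h.unique (P.isNNSequence θ hf hu) P.memH1_w P.memH1_psi (k + 1) i).1] with p hp
  rw [hp, iterU, sub_sub_cancel]

end ErrorProfile

lemma tendsto_zero_of_le_pow {a : ℕ → ℝ} {C r : ℝ} (h0 : ∀ k, 0 ≤ a k) (hr : 0 ≤ r) (hr1 : r < 1)
    (h : ∀ k, 1 ≤ k → a k ≤ C * r ^ (k - 1)) : Tendsto a atTop (𝓝 0) := by
  have h1 : Tendsto (fun k : ℕ => C * r ^ (k - 1)) atTop (𝓝 0) := by
    have := ((tendsto_pow_atTop_nhds_zero_of_lt_one hr hr1).comp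
      (tendsto_sub_atTop_nat 1)).const_mul C
    rwa [mul_zero] at this
  exact tendsto_of_tendsto_of_tendsto_of_le_of_le' tendsto_const_nhds h1
    (Eventually.of_forall h0) (eventually_atTop.2 ⟨1, h⟩)

end NeumannNeumann

theorem theorem1
    (f g u0 ψ0 ue : ℝ × ℝ → ℝ)
    (hf : MemLp f 2 (volume.restrict Omega))
    (hg : MemH32 square g)
    (hcomp : Compatible g u0 ψ0)
    (hue : IsDirichletSolution square (evenPart f) (evenPart g) ue) :
    -- the method is well posed and the error is multiplied by `1 - 4 θ` in each iteration
    (∀ θ : ℝ,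
      (∃ u ψ : ℕ → Fin 4 → ℝ × ℝ → ℝ,
        IsNNSequence θ (evenPart f) (evenPart g) (evenPart u0) (evenPart ψ0) u ψ) ∧
      (∀ u ψ u' ψ' : ℕ → Fin 4 → ℝ × ℝ → ℝ,
        IsNNSequence θ (evenPart f) (evenPart g) (evenPart u0) (evenPart ψ0) u ψ →
        IsNNSequence θ (evenPart f) (evenPart g) (evenPart u0) (evenPart ψ0) u' ψ' →
        ∀ k i, u k i =ᵐ[volume.restrict (Subsq i)] u' k i ∧
          ψ k i =ᵐ[volume.restrict (Subsq i)] ψ' k i) ∧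
      (∀ u ψ : ℕ → Fin 4 → ℝ × ℝ → ℝ,
        IsNNSequence θ (evenPart f) (evenPart g) (evenPart u0) (evenPart ψ0) u ψ →
        (∀ k, 1 ≤ k → ∀ i, ∀ᵐ p ∂(volume.restrict (Subsq i)),
          ue p - u k i p = (1 - 4 * θ) ^ (k - 1) * (ue p - u 1 i p)) ∧
        (∀ k, 1 ≤ k → l2Error ue (u k) = |1 - 4 * θ| ^ (k - 1) * l2Error ue (u 1)) ∧
        (∀ k, 1 ≤ k → h1Error ue (u k) = |1 - 4 * θ| ^ (k - 1) * h1Error ue (u 1)) ∧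
        (θ = 1 / 4 → ∀ k, 2 ≤ k → ∀ i, u k i =ᵐ[volume.restrict (Subsq i)] ue))) ∧
    -- geometric convergence for `0 < θ < 1 / 2`, with constants independent of `θ` and `k`
    (∃ C C' : ℝ, 0 < C ∧ 0 < C' ∧
      ∀ θ ∈ Ioo (0 : ℝ) (1 / 2), ∀ u ψ : ℕ → Fin 4 → ℝ × ℝ → ℝ,
        IsNNSequence θ (evenPart f) (evenPart g) (evenPart u0) (evenPart ψ0) u ψ →
        (∀ k, 1 ≤ k → l2Error ue (u k) ≤ C * |1 - 4 * θ| ^ (k - 1)) ∧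
        (∀ k, 1 ≤ k → h1Error ue (u k) ≤ C' * |1 - 4 * θ| ^ (k - 1)) ∧
        Tendsto (fun k => l2Error ue (u k)) atTop (𝓝 0) ∧
        Tendsto (fun k => h1Error ue (u k)) atTop (𝓝 0)) := by
  obtain ⟨P⟩ := nonempty_errorProfile hg hcomp hue
  have hfe := memLp_evenPart hf
  refine ⟨fun θ => ⟨⟨_, _, P.isNNSequence θ hfe hue⟩,
    fun u ψ u' ψ' h h' => h.unique h' P.memH1_w P.memH1_psi, fun u ψ h => ?_⟩, ?_⟩
  · have he := P.error_ae_eq hfe hue h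
    have he1 : ∀ i, ∀ᵐ p ∂(volume.restrict (Subsq i)), ue p - u 1 i p = P.E θ (fold p) :=
      fun i => by simpa using he 0 i
    have hl1 : l2Error ue (u 1) = l2Norm Omega (P.E θ ∘ fold) := by simpa using P.l2Error_eq (he 0)
    have hh1 : h1Error ue (u 1) = brokenH1Norm fun _ => P.E θ ∘ fold := by
      simpa using P.h1Error_eq (he 0)
    refine ⟨fun k hk i => ?_, fun k hk => ?_, fun k hk => ?_, fun hθ k hk i => ?_⟩
    · obtain ⟨k, rfl⟩ := Nat.exists_eq_add_of_le' hk
      filter_upwards [he k i, he1 i] with p h1 h2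
      rw [h1, h2, Nat.add_sub_cancel]
    · obtain ⟨k, rfl⟩ := Nat.exists_eq_add_of_le' hk
      rw [P.l2Error_eq (he k), hl1, Nat.add_sub_cancel, abs_pow]
    · obtain ⟨k, rfl⟩ := Nat.exists_eq_add_of_le' hk
      rw [P.h1Error_eq (he k), hh1, Nat.add_sub_cancel, abs_pow]
    · obtain ⟨k, rfl⟩ := Nat.exists_eq_add_of_le' hk
      filter_upwards [he (k + 1) i] with p hp
      have h0 : 1 - 4 * θ = 0 := by rw [hθ]; norm_num
      rw [h0, zero_pow k.succ_ne_zero, zero_mul] at hp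
      exact (sub_eq_zero.1 hp).symm
  · obtain ⟨C, hC, hCb⟩ := P.exists_l2_bound
    obtain ⟨C', hC', hCb'⟩ := P.exists_h1_bound
    refine ⟨C, C', hC, hC', fun θ hθ u ψ h => ?_⟩
    have he := P.error_ae_eq hfe hue h
    have hr : |1 - 4 * θ| < 1 := abs_lt.2 ⟨by linarith [hθ.2], by linarith [hθ.1]⟩
    have hl : ∀ k, 1 ≤ k → l2Error ue (u k) ≤ C * |1 - 4 * θ| ^ (k - 1) := by
      intro k hk
      obtain ⟨k, rfl⟩ := Nat.exists_eq_add_of_le' hk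
      rw [P.l2Error_eq (he k), Nat.add_sub_cancel, abs_pow, mul_comm]
      exact mul_le_mul_of_nonneg_right (hCb θ hθ) (by positivity)
    have hh : ∀ k, 1 ≤ k → h1Error ue (u k) ≤ C' * |1 - 4 * θ| ^ (k - 1) := by
      intro k hk
      obtain ⟨k, rfl⟩ := Nat.exists_eq_add_of_le' hk
      rw [P.h1Error_eq (he k), Nat.add_sub_cancel, abs_pow, mul_comm]
      exact mul_le_mul_of_nonneg_right (hCb' θ hθ) (by positivity)
    exact ⟨hl, hh, tendsto_zero_of_le_pow (fun k => Real.sqrt_nonneg _) (abs_nonneg _) hr hl,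
      tendsto_zero_of_le_pow (fun k => h1Error_nonneg _ _) (abs_nonneg _) hr hh⟩
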